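/- **Setting.** Let $1<\gamma<3$, $A>0$, $\rho_0>0$; put $c^2(\rho)=A\gamma\rho^{\gamma-1}$, $h(\rho)=c^2(\rho)/(\gamma-1)$. Points are $(t,x)\in\mathbb R\times\mathbb R^3$, $r=|x|$, $\omega=x/|x|$, $\nabla=(\partial_t,\nabla_x)$, $Z_1=x_1\partial_2-x_2\partial_1$, $Z_2=x_2\partial_3-x_3\partial_2$, $Z_3=x_3\partial_1-x_1\partial_3$; functions of $(t,\omega)$ are also regarded as functions of $(t,x)$ through $\omega=x/|x|$. *Background solution.* For $b_0>0$ let $s_0>b_0$ and $(\hat\rho,\hat u)(s)$, $\hat\rho>0$, solve $$\hat\rho'=\frac{2(s-\hat u)\hat\rho\hat u}{s((s-\hat u)^2-c^2(\hat\rho))},\qquad \hat u'=\frac{2c^2(\hat\rho)\hat u}{s((s-\hat u)^2-c^2(\hat\rho))}$$ on $(b_0-\tau_0,s_0+\tau_0)$ for some $0<\tau_0\le b_0^{-4/(\gamma-1)}(s_0-b_0)$, with non-vanishing factor $(s-\hat u)^2-c^2(\hat\rho)$, and with $\hat u(b_0)=b_0$; at $s_0$: $s_0(\hat\rho-\rho_0)=\hat\rho\hat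 u$, $s_0\hat u=\frac12\hat u^2+h(\hat\rho)-h(\rho_0)$, $\hat u-c(\hat\rho)<s_0<\hat u+c(\hat\rho)$, $c(\rho_0)<s_0$. Put $\hat\varphi(s)=\int_{s_0}^s\hat u$, $\hat\Phi(t,x)=t\hat\varphi(r/t)$, and, with all functions taken at $s_0$, $Q=\frac12\hat u^2-h(\hat\rho)+h(\rho_0)$, $$B_1=2\hat\rho\hat u-\frac{\hat\rho\hat u}{c^2(\hat\rho)}Q,\qquad B_2=\hat\rho-\rho_0-\frac{\hat\rho}{c^2(\hat\rho)}Q,\qquad \mathcal B_0=\partial_r+\frac{B_2}{B_1}\partial_t .$$ *Piston.* Let $\varepsilon>0$, $\sigma(t,\omega)=tb(t,\omega)$ with $b$ smooth and $|\partial_t^{k_0}Z^k(b-b_0)|\le K_{k_0,k}\,\varepsilon(1+t)^{-k_0}$ for all $k_0$ and all multi-indices $k$ ($t>0$). Put $\mathcal B_\sigma g=\partial_rg-r^{-2}\sum_{i=1}^3Z_i\sigma\,Z_ig$. Let $f_a$ be the smooth solution in $\{t>0,\ r\ge\sigma\}$ of $$\mathcal B_\sigma f_a=\frac{\partial_t\sigma-\hat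 u(\sigma/t)}{t\,\hat\varphi(\sigma/t)},\qquad f_a=0\ \text{ on } r=\sigma,$$ and $\Phi_a=(1+f_a)\hat\Phi$. *Shock solution.* For $T_0>1$ let $\zeta>\sigma$ be $C^2$ on $[1,T_0]\times\mathbb S^2$ and let $\Phi$ be $C^2$ up to the boundary of $D=\{1\le t\le T_0,\ \sigma\le r\le\zeta\}$ such that, with $\rho=h^{-1}(h(\rho_0)-\partial_t\Phi-\frac12|\nabla_x\Phi|^2)$, $$\partial_t^2\Phi+2\sum_k\partial_k\Phi\,\partial_{tk}^2\Phi+\sum_{i,j}\partial_i\Phi\,\partial_j\Phi\,\partial_{ij}^2\Phi-c^2(\rho)\Delta\Phi=0\ \text{ in } D,\qquad \mathcal B_\sigma\Phi=\partial_t\sigma\ \text{ on } r=\sigma,$$ $$\rho\,\partial_r\Phi-(\rho-\rho_0)\partial_t\zeta=\frac{\rho}{r^2}\sum_iZ_i\zeta\, Z_i\Phi\quad\text{and}\quad \Phi=0\qquad\text{on } r=\zeta .$$ Put $\dot\varphi=\Phi-\Phi_a$, $\xi=\zeta/t-s_0$. Assume that $|\dot\varphi|+|\xi|\le K_0\varepsilon$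 at $t=1$ in $D$, and that $$|\xi|+\sum_{l=0}^1t^l\bigl(|\nabla^{l+1}\dot\varphi|+|\nabla^{l+1}\xi|\bigr)\le M\varepsilon\quad\text{in } D .$$ Write $\int_{\Gamma_{T_0}}g\,dS=\int_{\mathbb S^2}\int_1^{T_0}g(t,\zeta(t,\omega)\omega)\,dt\,d\omega$. **Lemma 5.2 (improved Hardy-type inequality on the shock surface).** There are $b_*>0$ and $C_*>0$, depending only on the gas $(\gamma,A,\rho_0)$, such that for every $b_0\ge b_*$ there is a constant $C$, depending only on $b_0$, the gas and the constants $K_{k_0,k},K_0$ (not on $M$, $\varepsilon$, $T_0$, $\mu$ or the solution), with the following property. For every background solution and every $M>0$ there is $\varepsilon_0>0$ such that, whenever $0<\varepsilon<\varepsilon_0$, in the above setting one has for every $\mu<-1-\frac12\sqrt{\frac{\gamma+7}2}$ $$\begin{aligned}\int_{\Gamma_{T_0}}t^{\mu-1}|\dot\varphi|^2dS\le{}& C\varepsilon^2+\frac1{\mu^2}\Bigl(1+C_*\bigl(b_0^{-\frac2{\gamma-1}}+b_0^{-2}\bigr)\Bigr)\int_{\Gamma_{T_0}}t^{\mu+1}(\partial_t\dot\varphi)^2dS\\&+C\varepsilon\Bigl(\int_{\Gamma_{T_0}}t^{\mu+1}(\mathcal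 B_0\dot\varphi)^2dS+\int_{\Gamma_{T_0}}t^{\mu+1}\frac1{r^2}\sum_{k=1}^3(Z_k\dot\varphi)^2dS\Bigr).\end{aligned}$$ -/

import Mathlib

open MeasureTheory Set
open scoped ContDiff

noncomputable section

/-- Physical space `ℝ³` with its Euclidean norm. Space-time points are `p = (t, x) : ℝ × E3`. -/
abbrev E3 : Type := EuclideanSpace ℝ (Fin 3)

/-! ### Differential operators -/

/-- `∂_t`. -/
def dt (f : ℝ × E3 → ℝ) (p : ℝ × E3) : ℝ := fderiv ℝ f p (1, 0)

/-- `∂_i`, the derivative with respect to the Cartesian coordinate `x_i`. -/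
def dx (i : Fin 3) (f : ℝ × E3 → ℝ) (p : ℝ × E3) : ℝ :=
  fderiv ℝ f p (0, EuclideanSpace.single i 1)

/-- The radial derivative `∂_r`, where `r = |x|`. -/
def dr (f : ℝ × E3 → ℝ) (p : ℝ × E3) : ℝ := fderiv ℝ f p (0, ‖p.2‖⁻¹ • p.2)

/-- The rotation fields `x₁∂₂ - x₂∂₁`, `x₂∂₃ - x₃∂₂`, `x₃∂₁ - x₁∂₃`, as vectors at `x`
(coordinates are numbered `0, 1, 2` in the code). -/
def rotVec (i : Fin 3) (x : E3) : E3 :=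
  match i with
  | 0 => !₂[-x 1, x 0, 0]
  | 1 => !₂[0, -x 2, x 1]
  | 2 => !₂[x 2, 0, -x 0]

/-- The rotation derivative `Z_i f`. -/
def dZ (i : Fin 3) (f : ℝ × E3 → ℝ) (p : ℝ × E3) : ℝ := fderiv ℝ f p (0, rotVec i p.2)

/-- A function `g (t, ω)` of time and of the direction `ω ∈ S²`, regarded as the function
`(t, x) ↦ g (t, x / |x|)`. Only the values of `g t` on the unit sphere matter. -/
def onRays (g : ℝ → E3 → ℝ) (p : ℝ × E3) : ℝ := g p.1 (‖p.2‖⁻¹ • p.2)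

/-! ### The gas -/

/-- A polytropic gas `P = A ρ ^ γ` with `1 < γ < 3`, at rest with density `ρ₀` ahead of the shock. -/
structure Gas where
  γ : ℝ
  A : ℝ
  ρ₀ : ℝ
  one_lt_γ : 1 < γ
  γ_lt_three : γ < 3
  A_pos : 0 < A
  ρ₀_pos : 0 < ρ₀

namespace Gas

/-- `c²(ρ) = P'(ρ)`, the square of the sound speed. -/
def soundSq (G : Gas) (ρ : ℝ) : ℝ := G.A * G.γ * ρ ^ (G.γ - 1)

/-- The sound speed `c(ρ)`. -/
def sound (G : Gas) (ρ : ℝ) : ℝ := Real.sqrt (G.soundSq ρ)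

/-- The specific enthalpy `h(ρ) = c²(ρ) / (γ - 1)`. -/
def enthalpy (G : Gas) (ρ : ℝ) : ℝ := G.soundSq ρ / (G.γ - 1)

/-- The inverse function `h⁻¹` of the enthalpy. -/
def enthalpyInv (G : Gas) (q : ℝ) : ℝ := ((G.γ - 1) * q / (G.A * G.γ)) ^ (1 / (G.γ - 1))

theorem enthalpy_enthalpyInv (G : Gas) {q : ℝ} (hq : 0 ≤ q) :
    G.enthalpy (G.enthalpyInv q) = q := by
  have h1 : 0 < G.γ - 1 := sub_pos.2 G.one_lt_γ
  have h2 : 0 < G.γ := by linarith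
  have h3 := G.A_pos
  unfold enthalpy enthalpyInv soundSq
  rw [← Real.rpow_mul (by positivity), one_div, inv_mul_cancel₀ h1.ne', Real.rpow_one]
  field_simp

/-- The density `H(∇Φ) = h⁻¹(B₀ - ∂_t Φ - |∇ₓΦ|² / 2)` given by Bernoulli's law, `B₀ = h(ρ₀)`. -/
def density (G : Gas) (Φ : ℝ × E3 → ℝ) (p : ℝ × E3) : ℝ :=
  G.enthalpyInv (G.enthalpy G.ρ₀ - dt Φ p - (∑ i, dx i Φ p ^ 2) / 2)

end Gas

/-! ### The self-similar background solution -/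

/-- The self-similar flow `ρ = ρ(s)`, velocity `u(s) x / |x|`, `s = |x| / t`, behind the shock
`|x| = s₀ t` that is driven by the ball `|x| ≤ b₀ t` (in space dimension 3), extended as a solution
of the same system to the slightly larger interval `(b₀ - τ, s₀ + τ)`. -/
structure Background (G : Gas) (b₀ : ℝ) where
  s₀ : ℝ
  τ : ℝ
  ρ : ℝ → ℝ
  u : ℝ → ℝ
  b₀_lt_s₀ : b₀ < s₀
  τ_pos : 0 < τ
  τ_le : τ ≤ b₀ ^ (-4 / (G.γ - 1)) * (s₀ - b₀)
  ρ_pos : ∀ s ∈ Ioo (b₀ - τ) (s₀ + τ), 0 < ρ s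
  /-- the denominator in the system does not vanish -/
  denom_ne : ∀ s ∈ Ioo (b₀ - τ) (s₀ + τ), (s - u s) ^ 2 - G.soundSq (ρ s) ≠ 0
  ode_ρ : ∀ s ∈ Ioo (b₀ - τ) (s₀ + τ),
    HasDerivAt ρ (2 * (s - u s) * ρ s * u s / (s * ((s - u s) ^ 2 - G.soundSq (ρ s)))) s
  ode_u : ∀ s ∈ Ioo (b₀ - τ) (s₀ + τ),
    HasDerivAt u (2 * G.soundSq (ρ s) * u s / (s * ((s - u s) ^ 2 - G.soundSq (ρ s)))) s
  /-- Rankine-Hugoniot conditions -/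
  rh_mass : s₀ * (ρ s₀ - G.ρ₀) - ρ s₀ * u s₀ = 0
  rh_energy : s₀ * u s₀ - (u s₀ ^ 2 / 2 + G.enthalpy (ρ s₀) - G.enthalpy G.ρ₀) = 0
  /-- Lax entropy conditions -/
  lax_left : u s₀ - G.sound (ρ s₀) < s₀
  lax_right : s₀ < u s₀ + G.sound (ρ s₀)
  lax_ahead : G.sound G.ρ₀ < s₀
  /-- the gas does not penetrate the piston -/
  wall : u b₀ = b₀

namespace Background

variable {G : Gas} {b₀ : ℝ}

/-- The profile of the background potential: `φ̂' = û`, `φ̂(s₀) = 0`. -/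
def profile (bg : Background G b₀) (s : ℝ) : ℝ := ∫ y in bg.s₀..s, bg.u y

/-- The background potential `Φ̂(t, x) = t φ̂(|x| / t)`. -/
def potential (bg : Background G b₀) (p : ℝ × E3) : ℝ := p.1 * bg.profile (‖p.2‖ / p.1)

/-- The coefficient of `∂_r` in the linearized Rankine-Hugoniot condition. -/
def B₁ (bg : Background G b₀) : ℝ :=
  2 * bg.ρ bg.s₀ * bg.u bg.s₀ - 1 / G.soundSq (bg.ρ bg.s₀) * bg.ρ bg.s₀ * bg.u bg.s₀ *
    (bg.u bg.s₀ ^ 2 / 2 - G.enthalpy (bg.ρ bg.s₀) + G.enthalpy G.ρ₀)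

/-- The coefficient of `∂_t` in the linearized Rankine-Hugoniot condition. -/
def B₂ (bg : Background G b₀) : ℝ :=
  bg.ρ bg.s₀ - G.ρ₀ - 1 / G.soundSq (bg.ρ bg.s₀) * bg.ρ bg.s₀ *
    (bg.u bg.s₀ ^ 2 / 2 - G.enthalpy (bg.ρ bg.s₀) + G.enthalpy G.ρ₀)

/-- The boundary operator `𝓑₀ = ∂_r + μ₁ ∂_t`, `μ₁ = B₂ / B₁`. -/
def shockOp (bg : Background G b₀) (f : ℝ × E3 → ℝ) (p : ℝ × E3) : ℝ :=
  dr f p + bg.B₂ / bg.B₁ * dt f p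

end Background

/-! ### The perturbed piston and the modified background solution -/

/-- The path `σ(t, ω) = t b(t, ω)` of the piston. -/
def pistonPath (b : ℝ → E3 → ℝ) (t : ℝ) (y : E3) : ℝ := t * b t y

/-- `b` is smooth on `(0, ∞) × S²`, and
`|∂_t^{k₀} Z^k (b - b₀)| ≤ K_{k₀, k} ε / (1 + t)^{k₀}` for all `k₀` and all multi-indices `k`. -/
structure IsPistonSpeed (b₀ ε : ℝ) (K : ℕ → (Fin 3 → ℕ) → ℝ) (b : ℝ → E3 → ℝ) : Prop where
  smooth : ∀ p : ℝ × E3, 0 < p.1 → p.2 ≠ 0 → ContDiffAt ℝ ∞ (onRays b) p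
  bound : ∀ (k₀ : ℕ) (k : Fin 3 → ℕ) (p : ℝ × E3), 0 < p.1 → p.2 ≠ 0 →
    |(dt^[k₀] ((dZ 0)^[k 0] ((dZ 1)^[k 1] ((dZ 2)^[k 2] fun q => onRays b q - b₀)))) p|
      ≤ K k₀ k * ε / (1 + p.1) ^ k₀

/-- The operator `𝓑_σ f = ∂_r f - r⁻² ∑ᵢ Zᵢσ Zᵢf` of the boundary condition on the piston. -/
def wallOp (σ : ℝ → E3 → ℝ) (f : ℝ × E3 → ℝ) (p : ℝ × E3) : ℝ :=
  dr f p - 1 / ‖p.2‖ ^ 2 * ∑ i, dZ i (onRays σ) p * dZ i f p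

/-- `f` is the corrector `f_a`: the smooth solution, on the outside `r ≥ σ(t, ω)` of the piston, of
the transport problem `𝓑_σ f = (∂_t σ - û(σ/t)) / Φ̂|_{r = σ}`, `f = 0` on `r = σ`. -/
structure IsCorrector {G : Gas} {b₀ : ℝ} (bg : Background G b₀) (σ : ℝ → E3 → ℝ)
    (f : ℝ × E3 → ℝ) : Prop where
  smooth : ∀ p : ℝ × E3, 0 < p.1 → p.2 ≠ 0 → onRays σ p ≤ ‖p.2‖ → ContDiffAt ℝ ∞ f p
  transport : ∀ p : ℝ × E3, 0 < p.1 → p.2 ≠ 0 → onRays σ p ≤ ‖p.2‖ →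
    wallOp σ f p = (dt (onRays σ) p - bg.u (onRays σ p / p.1)) /
      (p.1 * bg.profile (onRays σ p / p.1))
  wall : ∀ p : ℝ × E3, 0 < p.1 → p.2 ≠ 0 → onRays σ p = ‖p.2‖ → f p = 0

/-- The modified background potential `Φ_a = (1 + f_a) Φ̂`. -/
def modifiedPotential {G : Gas} {b₀ : ℝ} (bg : Background G b₀) (f : ℝ × E3 → ℝ)
    (p : ℝ × E3) : ℝ := (1 + f p) * bg.potential p

/-! ### Shock solutions and their perturbations -/

/-- The closed domain `1 ≤ t ≤ T`, `σ(t, ω) ≤ r ≤ ζ(t, ω)` between piston and shock. -/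
def shockDomain (σ ζ : ℝ → E3 → ℝ) (T : ℝ) : Set (ℝ × E3) :=
  {p | p.1 ∈ Icc 1 T ∧ p.2 ≠ 0 ∧ onRays σ p ≤ ‖p.2‖ ∧ ‖p.2‖ ≤ onRays ζ p}

/-- `(Φ, ζ)` is a `C²` solution on `[1, T]` of the piston problem for the piston `r = σ(t, ω)`. -/
structure IsShockSolution (G : Gas) (σ : ℝ → E3 → ℝ) (T : ℝ) (ζ : ℝ → E3 → ℝ)
    (Φ : ℝ × E3 → ℝ) : Prop where
  /-- the shock lies ahead of the piston -/
  ahead : ∀ t ∈ Icc 1 T, ∀ y : E3, ‖y‖ = 1 → σ t y < ζ t y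
  /-- `ζ` is `C²` on `[1, T] × S²` -/
  regular_ζ : ∀ p : ℝ × E3, p.1 ∈ Icc 1 T → p.2 ≠ 0 → ContDiffAt ℝ 2 (onRays ζ) p
  /-- `Φ` is `C²` up to the boundary -/
  regular_Φ : ∀ p ∈ shockDomain σ ζ T, ContDiffAt ℝ 2 Φ p
  /-- the potential flow equation -/
  equation : ∀ p ∈ shockDomain σ ζ T,
    dt (dt Φ) p + 2 * ∑ k, dx k Φ p * dt (dx k Φ) p
      + ∑ i, ∑ j, dx i Φ p * dx j Φ p * dx i (dx j Φ) p
      - G.soundSq (G.density Φ p) * ∑ i, dx i (dx i Φ) p = 0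
  /-- the boundary condition on the piston -/
  piston : ∀ p ∈ shockDomain σ ζ T, ‖p.2‖ = onRays σ p → wallOp σ Φ p = dt (onRays σ) p
  /-- the Rankine-Hugoniot condition on the shock -/
  rankineHugoniot : ∀ p ∈ shockDomain σ ζ T, ‖p.2‖ = onRays ζ p →
    G.density Φ p * dr Φ p - (G.density Φ p - G.ρ₀) * dt (onRays ζ) p
      = 1 / ‖p.2‖ ^ 2 * G.density Φ p * ∑ i, dZ i (onRays ζ) p * dZ i Φ p
  /-- continuity of the potential across the shock -/
  continuity : ∀ p ∈ shockDomain σ ζ T, ‖p.2‖ = onRays ζ p → Φ p = 0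

/-- The perturbation `φ̇ = Φ - Φ_a` of the potential. -/
def pertPotential {G : Gas} {b₀ : ℝ} (bg : Background G b₀) (f Φ : ℝ × E3 → ℝ)
    (p : ℝ × E3) : ℝ := Φ p - modifiedPotential bg f p

/-- The perturbation `ξ = ζ / t - s₀` of the shock, as a function of `(t, x)`. -/
def pertShock {G : Gas} {b₀ : ℝ} (bg : Background G b₀) (ζ : ℝ → E3 → ℝ) (p : ℝ × E3) : ℝ :=
  onRays ζ p / p.1 - bg.s₀

/-- The integral of `g` over the shock surface `Γ_T = {1 < t < T, r = ζ(t, ω), ω ∈ S²}` with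
respect to `dω dt`, where `dω` is the surface measure of the unit sphere `S²`. -/
def shockIntegral (ζ : ℝ → E3 → ℝ) (T : ℝ) (g : ℝ × E3 → ℝ) : ℝ :=
  ∫ y : Metric.sphere (0 : E3) 1, (∫ t in (1 : ℝ)..T, g (t, ζ t y • (y : E3)))
    ∂(volume : Measure E3).toSphere

end


/-!
Fix a direction `ω`. The deviation `ψ(t) = ζ(t, ω) - s₀ t` of the shock from the background shock
satisfies the Rankine-Hugoniot conditions linearized at the background, a damped equation
`ψ' + κ/û(s₀) ∂ₜφ̇ + θ ψ/t = small` with `θ ≥ 1/2`, in which the Mach number enters only through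
`κ ≤ 1/2` once `b₀` is large. Multiplying by `t^μ ψ` and integrating gives a Hardy inequality that
bounds `∫ t^(μ-1) ψ²` by `4 (κ/û(s₀))² / μ²` times `∫ t^(μ+1) (∂ₜφ̇)²`. Since `Φ` vanishes on the
shock, `φ̇ = -Φ_a` there, and `|Φ_a| ≤ (1 + η) û(s₀) |ψ|`; the factors `û(s₀)` cancel.
-/

/-! ### The background solution -/

namespace Gas

variable (G : Gas) {ρ : ℝ}

theorem γ_sub_one_pos : 0 < G.γ - 1 := sub_pos.2 G.one_lt_γ

theorem γ_pos : 0 < G.γ := one_pos.trans G.one_lt_γ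

theorem soundSq_pos (hρ : 0 < ρ) : 0 < G.soundSq ρ :=
  mul_pos (mul_pos G.A_pos G.γ_pos) (Real.rpow_pos_of_pos hρ _)

theorem continuousAt_soundSq (hρ : 0 < ρ) : ContinuousAt G.soundSq ρ :=
  continuousAt_const.mul (Real.continuousAt_rpow_const _ _ (Or.inl hρ.ne'))

theorem soundSq_eq_mul_enthalpy (ρ : ℝ) : G.soundSq ρ = (G.γ - 1) * G.enthalpy ρ :=
  (mul_div_cancel₀ _ G.γ_sub_one_pos.ne').symm

theorem enthalpy_pos (hρ : 0 < ρ) : 0 < G.enthalpy ρ :=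
  div_pos (G.soundSq_pos hρ) G.γ_sub_one_pos

theorem rpow_γ_sub_one_eq (ρ : ℝ) : (G.γ - 1) * G.enthalpy ρ / (G.A * G.γ) = ρ ^ (G.γ - 1) := by
  rw [← G.soundSq_eq_mul_enthalpy, soundSq,
    mul_div_cancel_left₀ _ (mul_pos G.A_pos G.γ_pos).ne']

theorem enthalpyInv_enthalpy (hρ : 0 < ρ) : G.enthalpyInv (G.enthalpy ρ) = ρ := by
  rw [enthalpyInv, G.rpow_γ_sub_one_eq, ← Real.rpow_mul hρ.le,
    mul_one_div_cancel G.γ_sub_one_pos.ne', Real.rpow_one]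

theorem hasDerivAt_enthalpyInv (hρ : 0 < ρ) :
    HasDerivAt G.enthalpyInv (ρ / G.soundSq ρ) (G.enthalpy ρ) := by
  have hγ := G.γ_sub_one_pos
  have hpow : 0 < ρ ^ (G.γ - 1) := Real.rpow_pos_of_pos hρ _
  have hlin : HasDerivAt (fun q => (G.γ - 1) * q / (G.A * G.γ)) ((G.γ - 1) / (G.A * G.γ))
      (G.enthalpy ρ) := by
    simpa using ((hasDerivAt_id (G.enthalpy ρ)).const_mul (G.γ - 1)).div_const (G.A * G.γ)
  refine (hlin.rpow_const (p := 1 / (G.γ - 1))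
    (Or.inl (by rw [G.rpow_γ_sub_one_eq]; exact hpow.ne'))).congr_deriv ?_
  have hexp : (ρ ^ (G.γ - 1)) ^ (1 / (G.γ - 1) - 1) = ρ / ρ ^ (G.γ - 1) := by
    rw [← Real.rpow_mul hρ.le, mul_sub, mul_one_div_cancel hγ.ne', mul_one, Real.rpow_sub hρ,
      Real.rpow_one]
  have hγ0 := G.γ_pos
  have hA := G.A_pos
  rw [G.rpow_γ_sub_one_eq, hexp, soundSq]
  field_simp

theorem enthalpy_div_le {q : ℝ} (hρ : 0 < ρ) (hq : 0 < q) (hq1 : q ≤ 1) :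
    G.enthalpy (ρ / q) * q ^ 2 ≤ G.enthalpy ρ := by
  have hhom : G.enthalpy (ρ / q) = G.enthalpy ρ / q ^ (G.γ - 1) := by
    rw [enthalpy, enthalpy, soundSq, soundSq, Real.div_rpow hρ.le hq.le]
    ring
  have hexp : q ^ 2 ≤ q ^ (G.γ - 1) := by
    rw [← Real.rpow_two]
    exact Real.rpow_le_rpow_of_exponent_ge hq hq1 (by linarith [G.γ_lt_three])
  rw [hhom, div_mul_eq_mul_div, div_le_iff₀ (Real.rpow_pos_of_pos hq _)]
  exact mul_le_mul_of_nonneg_left hexp (G.enthalpy_pos hρ).le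

end Gas

theorem pos_of_hasDerivAt_mul_self {f g : ℝ → ℝ} {a b : ℝ}
    (hf : ∀ s ∈ Icc a b, HasDerivAt f (g s * f s) s) (hg : ContinuousOn g (Icc a b))
    (ha : 0 < f a) {s : ℝ} (hs : s ∈ Icc a b) : 0 < f s := by
  obtain ⟨L, hL⟩ := isCompact_Icc.exists_bound_of_continuousOn hg
  have haa : a ∈ Icc a b := ⟨le_rfl, hs.1.trans hs.2⟩
  have hder : ∀ s ∈ Icc a b, HasDerivAt (fun s => f s ^ 2 * Real.exp (2 * L * s))
      (2 * (g s + L) * (f s ^ 2 * Real.exp (2 * L * s))) s := by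
    intro s hs
    have hexp : HasDerivAt (fun s => Real.exp (2 * L * s)) (Real.exp (2 * L * s) * (2 * L)) s := by
      simpa using ((hasDerivAt_id s).const_mul (2 * L)).exp
    refine (((hf s hs).pow 2).mul hexp).congr_deriv ?_
    simp only [Pi.pow_apply, Nat.cast_ofNat, Nat.add_one_sub_one, pow_one]
    ring
  have hmono : MonotoneOn (fun s => f s ^ 2 * Real.exp (2 * L * s)) (Icc a b) := by
    refine monotoneOn_of_hasDerivWithinAt_nonneg (convex_Icc _ _) (HasDerivAt.continuousOn hder)
      (fun s hs => (hder s (interior_subset hs)).hasDerivWithinAt) (fun s hs => ?_)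
    have : 0 ≤ g s + L := by linarith [(abs_le.1 (hL s (interior_subset hs))).1]
    positivity
  have hne : ∀ s ∈ Icc a b, f s ≠ 0 := by
    intro s hs h0
    have hle := hmono haa hs hs.1
    simp only [h0] at hle
    nlinarith [mul_pos (pow_pos ha 2) (Real.exp_pos (2 * L * a))]
  by_contra! hcon
  obtain ⟨x, hx, hx0⟩ := isPreconnected_Icc.intermediate_value hs haa
    (HasDerivAt.continuousOn hf) (show (0 : ℝ) ∈ Icc (f s) (f a) from ⟨hcon, ha.le⟩)
  exact hne x hx hx0

theorem contDiffAt_one_of_hasDerivAt {f f' : ℝ → ℝ} {U : Set ℝ} (hU : IsOpen U)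
    (hf : ∀ x ∈ U, HasDerivAt f (f' x) x) (hf' : ContinuousOn f' U) {x : ℝ} (hx : x ∈ U) :
    ContDiffAt ℝ 1 f x := by
  refine ContDiffOn.contDiffAt ?_ (hU.mem_nhds hx)
  rw [show (1 : WithTop ℕ∞) = 0 + 1 by simp, contDiffOn_succ_iff_deriv_of_isOpen hU,
    contDiffOn_zero]
  exact ⟨fun x hx => (hf x hx).differentiableAt.differentiableWithinAt, by simp,
    hf'.congr fun x hx => (hf x hx).deriv⟩

namespace Background

variable {G : Gas} {b₀ : ℝ} (bg : Background G b₀) {s : ℝ}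

theorem Icc_subset_domain : Icc b₀ bg.s₀ ⊆ Ioo (b₀ - bg.τ) (bg.s₀ + bg.τ) :=
  Icc_subset_Ioo (by linarith [bg.τ_pos]) (by linarith [bg.τ_pos])

theorem wall_mem : b₀ ∈ Icc b₀ bg.s₀ := left_mem_Icc.2 bg.b₀_lt_s₀.le

theorem shock_mem : bg.s₀ ∈ Icc b₀ bg.s₀ := right_mem_Icc.2 bg.b₀_lt_s₀.le

theorem wall_mem_domain : b₀ ∈ Ioo (b₀ - bg.τ) (bg.s₀ + bg.τ) := bg.Icc_subset_domain bg.wall_mem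

theorem shock_mem_domain : bg.s₀ ∈ Ioo (b₀ - bg.τ) (bg.s₀ + bg.τ) :=
  bg.Icc_subset_domain bg.shock_mem

theorem ρ_shock_pos : 0 < bg.ρ bg.s₀ := bg.ρ_pos _ bg.shock_mem_domain

theorem s₀_pos (hb : 0 < b₀) : 0 < bg.s₀ := hb.trans bg.b₀_lt_s₀

theorem continuousOn_u : ContinuousOn bg.u (Ioo (b₀ - bg.τ) (bg.s₀ + bg.τ)) :=
  HasDerivAt.continuousOn bg.ode_u

theorem continuousOn_soundSq :
    ContinuousOn (fun s => G.soundSq (bg.ρ s)) (Ioo (b₀ - bg.τ) (bg.s₀ + bg.τ)) := fun s hs =>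
  (ContinuousAt.comp (f := bg.ρ) (G.continuousAt_soundSq (bg.ρ_pos s hs))
    (bg.ode_ρ s hs).continuousAt).continuousWithinAt

theorem continuousOn_denom : ContinuousOn (fun s => (s - bg.u s) ^ 2 - G.soundSq (bg.ρ s))
    (Ioo (b₀ - bg.τ) (bg.s₀ + bg.τ)) :=
  ((continuousOn_id.sub bg.continuousOn_u).pow 2).sub bg.continuousOn_soundSq

theorem denom_neg (hs : s ∈ Ioo (b₀ - bg.τ) (bg.s₀ + bg.τ)) :
    (s - bg.u s) ^ 2 - G.soundSq (bg.ρ s) < 0 := by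
  have hshock : (bg.s₀ - bg.u bg.s₀) ^ 2 - G.soundSq (bg.ρ bg.s₀) < 0 := by
    have hleft := bg.lax_left
    have hright := bg.lax_right
    rw [Gas.sound] at hleft hright
    rw [← Real.sq_sqrt (G.soundSq_pos bg.ρ_shock_pos).le, sub_neg]
    exact sq_lt_sq' (by linarith) (by linarith)
  by_contra! hcon
  obtain ⟨x, hx, hx0⟩ := isPreconnected_Ioo.intermediate_value bg.shock_mem_domain hs
    bg.continuousOn_denom ⟨hshock.le, hcon⟩
  exact bg.denom_ne x hx hx0

theorem continuousOn_rate (hb : 0 < b₀) :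
    ContinuousOn (fun s => 2 * G.soundSq (bg.ρ s) / (s * ((s - bg.u s) ^ 2 - G.soundSq (bg.ρ s))))
      (Icc b₀ bg.s₀) :=
  ((continuousOn_const.mul bg.continuousOn_soundSq).mono bg.Icc_subset_domain).div
    (continuousOn_id.mul (bg.continuousOn_denom.mono bg.Icc_subset_domain)) fun s hs =>
    mul_ne_zero (hb.trans_le hs.1).ne' (bg.denom_ne s (bg.Icc_subset_domain hs))

theorem u_pos (hb : 0 < b₀) (hs : s ∈ Icc b₀ bg.s₀) : 0 < bg.u s :=
  pos_of_hasDerivAt_mul_self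
    (fun s hs => (bg.ode_u s (bg.Icc_subset_domain hs)).congr_deriv (by ring))
    (bg.continuousOn_rate hb) (by rwa [bg.wall]) hs

theorem deriv_u_neg (hb : 0 < b₀) (hs : s ∈ Icc b₀ bg.s₀) :
    2 * G.soundSq (bg.ρ s) * bg.u s / (s * ((s - bg.u s) ^ 2 - G.soundSq (bg.ρ s))) < 0 := by
  have hs' := bg.Icc_subset_domain hs
  have hc := G.soundSq_pos (bg.ρ_pos s hs')
  have hu := bg.u_pos hb hs
  exact div_neg_of_pos_of_neg (by positivity)
    (mul_neg_of_pos_of_neg (hb.trans_le hs.1) (bg.denom_neg hs'))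

theorem antitoneOn_u (hb : 0 < b₀) : AntitoneOn bg.u (Icc b₀ bg.s₀) :=
  antitoneOn_of_hasDerivWithinAt_nonpos (convex_Icc _ _)
    (bg.continuousOn_u.mono bg.Icc_subset_domain)
    (fun s hs => (bg.ode_u s (bg.Icc_subset_domain (interior_subset hs))).hasDerivWithinAt)
    (fun _ hs => (bg.deriv_u_neg hb (interior_subset hs)).le)

theorem hasDerivAt_u_wall (hb : 0 < b₀) : HasDerivAt bg.u (-2) b₀ := by
  refine (bg.ode_u b₀ bg.wall_mem_domain).congr_deriv ?_
  have hc := (G.soundSq_pos (bg.ρ_pos _ bg.wall_mem_domain)).ne'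
  rw [bg.wall, sub_self, zero_pow two_ne_zero, zero_sub]
  field_simp

/-- The slope `û'(s₀)` of the velocity profile at the shock. -/
noncomputable def shockSlope : ℝ :=
  2 * G.soundSq (bg.ρ bg.s₀) * bg.u bg.s₀ /
    (bg.s₀ * ((bg.s₀ - bg.u bg.s₀) ^ 2 - G.soundSq (bg.ρ bg.s₀)))

theorem hasDerivAt_u_shock : HasDerivAt bg.u bg.shockSlope bg.s₀ := bg.ode_u _ bg.shock_mem_domain

theorem two_mul_u_le_neg_shockSlope (hb : 0 < b₀) :
    2 * bg.u bg.s₀ ≤ -(bg.s₀ * bg.shockSlope) := by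
  have hden := bg.denom_neg bg.shock_mem_domain
  have hu := bg.u_pos hb bg.shock_mem
  have hs₀ := (bg.s₀_pos hb).ne'
  have hslope : -(bg.s₀ * bg.shockSlope) = 2 * G.soundSq (bg.ρ bg.s₀) * bg.u bg.s₀ /
      (G.soundSq (bg.ρ bg.s₀) - (bg.s₀ - bg.u bg.s₀) ^ 2) := by
    rw [shockSlope, ← neg_sub, mul_neg, div_neg]
    field_simp
  rw [hslope, le_div_iff₀ (by linarith)]
  nlinarith [mul_nonneg hu.le (sq_nonneg (bg.s₀ - bg.u bg.s₀))]

theorem intervalIntegrable_u {s' : ℝ} (hs : s ∈ Ioo (b₀ - bg.τ) (bg.s₀ + bg.τ))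
    (hs' : s' ∈ Ioo (b₀ - bg.τ) (bg.s₀ + bg.τ)) : IntervalIntegrable bg.u volume s s' :=
  (bg.continuousOn_u.mono (ordConnected_Ioo.uIcc_subset hs hs')).intervalIntegrable

theorem hasDerivAt_profile (hs : s ∈ Ioo (b₀ - bg.τ) (bg.s₀ + bg.τ)) :
    HasDerivAt bg.profile (bg.u s) s :=
  intervalIntegral.integral_hasDerivAt_right (bg.intervalIntegrable_u bg.shock_mem_domain hs)
    (bg.continuousOn_u.stronglyMeasurableAtFilter isOpen_Ioo s hs)
    (bg.continuousOn_u.continuousAt (isOpen_Ioo.mem_nhds hs))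

theorem profile_shock : bg.profile bg.s₀ = 0 := intervalIntegral.integral_same

theorem profile_wall_le (hb : 0 < b₀) :
    bg.profile b₀ ≤ -((bg.s₀ - b₀) * bg.u bg.s₀) := by
  have hle : ∫ _ in b₀..bg.s₀, bg.u bg.s₀ ≤ ∫ y in b₀..bg.s₀, bg.u y :=
    intervalIntegral.integral_mono_on bg.b₀_lt_s₀.le (by simp)
      (bg.intervalIntegrable_u bg.wall_mem_domain bg.shock_mem_domain)
      (fun x hx => bg.antitoneOn_u hb hx bg.shock_mem hx.2)
  rw [intervalIntegral.integral_const, smul_eq_mul] at hle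
  rw [profile, intervalIntegral.integral_symm]
  linarith

theorem contDiffAt_profile (hs : s ∈ Ioo (b₀ - bg.τ) (bg.s₀ + bg.τ)) :
    ContDiffAt ℝ 1 bg.profile s :=
  contDiffAt_one_of_hasDerivAt isOpen_Ioo (fun _ => bg.hasDerivAt_profile) bg.continuousOn_u hs

theorem contDiffAt_u (hb : 0 < b₀) (hs : s ∈ Icc b₀ bg.s₀) : ContDiffAt ℝ 1 bg.u s := by
  refine contDiffAt_one_of_hasDerivAt (isOpen_Ioo.inter isOpen_Ioi) (fun x hx => bg.ode_u x hx.1)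
    ?_ (x := s) ⟨bg.Icc_subset_domain hs, hb.trans_le hs.1⟩
  exact (((continuousOn_const.mul bg.continuousOn_soundSq).mul bg.continuousOn_u).mono
    inter_subset_left).div (continuousOn_id.mul (bg.continuousOn_denom.mono inter_subset_left))
    fun x hx => mul_ne_zero (ne_of_gt hx.2) (bg.denom_ne x hx.1)

/-- The ratio `ρ₀ / ρ̂(s₀)` of the densities ahead of and behind the shock. -/
noncomputable def densityRatio : ℝ := G.ρ₀ / bg.ρ bg.s₀

theorem densityRatio_pos : 0 < bg.densityRatio := div_pos G.ρ₀_pos bg.ρ_shock_pos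

theorem ρ_shock : bg.ρ bg.s₀ = G.ρ₀ / bg.densityRatio := by
  rw [densityRatio, div_div_cancel₀ G.ρ₀_pos.ne']

theorem u_shock : bg.u bg.s₀ = bg.s₀ * (1 - bg.densityRatio) := by
  have hρ := bg.ρ_shock_pos
  rw [densityRatio]
  field_simp
  linarith [bg.rh_mass]

theorem densityRatio_lt_one (hb : 0 < b₀) : bg.densityRatio < 1 := by
  have hu := bg.u_pos hb bg.shock_mem
  rw [bg.u_shock] at hu
  linarith [pos_of_mul_pos_right hu (bg.s₀_pos hb).le]

theorem enthalpy_shock : G.enthalpy (bg.ρ bg.s₀) =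
    G.enthalpy G.ρ₀ + bg.s₀ * bg.u bg.s₀ - bg.u bg.s₀ ^ 2 / 2 := by linarith [bg.rh_energy]

theorem sq_s₀_mul_densityRatio_le (hb : 0 < b₀) :
    (bg.s₀ * bg.densityRatio) ^ 2 ≤ 2 * G.enthalpy G.ρ₀ := by
  have hq1 := bg.densityRatio_lt_one hb
  have hbound := G.enthalpy_div_le G.ρ₀_pos bg.densityRatio_pos hq1.le
  rw [← bg.ρ_shock, bg.enthalpy_shock, bg.u_shock] at hbound
  have hfactor : 0 < 1 - bg.densityRatio ^ 2 := by nlinarith [bg.densityRatio_pos]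
  refine le_of_mul_le_mul_left ?_ hfactor
  linarith

theorem densityRatio_le {δ : ℝ} (hδ : 0 < δ) (hb : 0 < b₀)
    (hlarge : 2 * G.enthalpy G.ρ₀ ≤ (b₀ * δ) ^ 2) : bg.densityRatio ≤ δ := by
  have hle : bg.s₀ * bg.densityRatio ≤ b₀ * δ :=
    le_of_sq_le_sq ((bg.sq_s₀_mul_densityRatio_le hb).trans hlarge) (by positivity)
  refine le_of_mul_le_mul_left (hle.trans ?_) (bg.s₀_pos hb)
  exact mul_le_mul_of_nonneg_right bg.b₀_lt_s₀.le hδ.le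

/-- The coefficient `1 - s₀ B₂ / B₁` of the linearized shock polar: up to the factor `û(s₀)`, the
negative of the derivative of the shock speed with respect to `∂_t Φ`. -/
noncomputable def polarCoeff : ℝ := 1 - bg.s₀ * (bg.B₂ / bg.B₁)

/-- The dimensionless quantity `û (s₀ - û) / c²(ρ̂)` at the shock. -/
noncomputable def machTerm : ℝ :=
  bg.u bg.s₀ * (bg.s₀ - bg.u bg.s₀) / G.soundSq (bg.ρ bg.s₀)

theorem bernoulli_deficit_eq : bg.u bg.s₀ ^ 2 / 2 - G.enthalpy (bg.ρ bg.s₀) + G.enthalpy G.ρ₀ =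
    -(bg.u bg.s₀ * (bg.s₀ - bg.u bg.s₀)) := by
  rw [bg.enthalpy_shock]
  ring

theorem B₁_eq : bg.B₁ = bg.ρ bg.s₀ * bg.u bg.s₀ * (2 + bg.machTerm) := by
  rw [B₁, bg.bernoulli_deficit_eq, machTerm]
  ring

theorem B₂_eq : bg.B₂ = bg.ρ bg.s₀ * (1 - bg.densityRatio + bg.machTerm) := by
  have hρ := bg.ρ_shock_pos.ne'
  rw [B₂, bg.bernoulli_deficit_eq, machTerm, densityRatio]
  field_simp
  ring

theorem s₀_sub_u_shock : bg.s₀ - bg.u bg.s₀ = bg.s₀ * bg.densityRatio := by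
  rw [bg.u_shock]
  ring

theorem u_shock_le (hb : 0 < b₀) : bg.u bg.s₀ ≤ bg.s₀ := by
  linarith [bg.s₀_sub_u_shock, mul_pos (bg.s₀_pos hb) bg.densityRatio_pos]

theorem machTerm_nonneg (hb : 0 < b₀) : 0 ≤ bg.machTerm :=
  div_nonneg (mul_nonneg (bg.u_pos hb bg.shock_mem).le (sub_nonneg.2 (bg.u_shock_le hb)))
    (G.soundSq_pos bg.ρ_shock_pos).le

theorem machTerm_le (hb : 0 < b₀) : bg.machTerm ≤ 2 * bg.densityRatio / (G.γ - 1) := by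
  have hu := bg.u_pos hb bg.shock_mem
  have henergy : bg.s₀ * bg.u bg.s₀ / 2 ≤ G.enthalpy (bg.ρ bg.s₀) := by
    rw [bg.enthalpy_shock]
    nlinarith [G.enthalpy_pos G.ρ₀_pos, mul_le_mul_of_nonneg_right (bg.u_shock_le hb) hu.le]
  have hq := mul_le_mul_of_nonneg_left henergy bg.densityRatio_pos.le
  rw [machTerm, bg.s₀_sub_u_shock, G.soundSq_eq_mul_enthalpy,
    div_le_div_iff₀ (mul_pos G.γ_sub_one_pos (G.enthalpy_pos bg.ρ_shock_pos)) G.γ_sub_one_pos]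
  nlinarith [mul_le_mul_of_nonneg_left hq G.γ_sub_one_pos.le]

theorem B₁_pos (hb : 0 < b₀) : 0 < bg.B₁ := by
  have hmach := bg.machTerm_nonneg hb
  have hu := bg.u_pos hb bg.shock_mem
  have hρ := bg.ρ_shock_pos
  rw [bg.B₁_eq]
  positivity

theorem polarCoeff_eq (hb : 0 < b₀) : bg.polarCoeff =
    (1 - bg.densityRatio - bg.densityRatio * bg.machTerm) /
      ((1 - bg.densityRatio) * (2 + bg.machTerm)) := by
  have hs₀ := (bg.s₀_pos hb).ne'
  have hq : 1 - bg.densityRatio ≠ 0 := by linarith [bg.densityRatio_lt_one hb]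
  have hmach : 2 + bg.machTerm ≠ 0 := by linarith [bg.machTerm_nonneg hb]
  have hρ := bg.ρ_shock_pos.ne'
  rw [polarCoeff, bg.B₁_eq, bg.B₂_eq, bg.u_shock]
  field_simp
  ring

theorem polarCoeff_mem (hb : 0 < b₀) (h4 : bg.densityRatio ≤ 1 / 4)
    (h8 : bg.densityRatio ≤ (G.γ - 1) / 8) : bg.polarCoeff ∈ Icc (1 / 4 : ℝ) (1 / 2) := by
  have hmach0 := bg.machTerm_nonneg hb
  have hmach4 : bg.machTerm ≤ 1 / 4 := (bg.machTerm_le hb).trans <| by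
    rw [div_le_iff₀ G.γ_sub_one_pos]
    linarith
  have hden : 0 < (1 - bg.densityRatio) * (2 + bg.machTerm) :=
    mul_pos (by linarith) (by linarith)
  have hmul := mul_nonneg bg.densityRatio_pos.le hmach0
  rw [bg.polarCoeff_eq hb]
  constructor
  · rw [le_div_iff₀ hden]
    nlinarith
  · rw [div_le_iff₀ hden]
    nlinarith

end Background

/-! ### Rotations and directional derivatives -/

/-- `rotVec i` as a continuous linear map. -/
noncomputable def rotL (i : Fin 3) : E3 →L[ℝ] E3 :=
  LinearMap.toContinuousLinearMap
    { toFun := rotVec i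
      map_add' := fun x y => by
        fin_cases i <;> ext j <;> fin_cases j <;> simp [rotVec] <;> ring
      map_smul' := fun c x => by
        fin_cases i <;> ext j <;> fin_cases j <;> simp [rotVec] }

@[simp] theorem rotL_apply (i : Fin 3) (x : E3) : rotL i x = rotVec i x := rfl

theorem inner_rotVec (i : Fin 3) (x : E3) : inner ℝ x (rotVec i x) = 0 := by
  fin_cases i <;> simp [rotVec, PiLp.inner_apply, Fin.sum_univ_three] <;> ring

theorem norm_rotVec_le (i : Fin 3) (x : E3) : ‖rotVec i x‖ ≤ ‖x‖ := by
  rw [EuclideanSpace.norm_eq, EuclideanSpace.norm_eq]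
  refine Real.sqrt_le_sqrt ?_
  simp only [Real.norm_eq_abs, sq_abs, Fin.sum_univ_three]
  fin_cases i <;> simp [rotVec] <;> nlinarith [sq_nonneg (x 0), sq_nonneg (x 1), sq_nonneg (x 2)]

theorem rotVec_commutator (i k : Fin 3) : ∃ c : Fin 3 → ℝ, (∀ j, |c j| ≤ 1) ∧
    ∀ x, rotVec i (rotVec k x) - rotVec k (rotVec i x) = ∑ j, c j • rotVec j x := by
  -- The structure constants of `so(3)`: `[R₀, R₁] = R₂` and cyclically.
  refine ⟨![![![0, 0, 0], ![0, 0, 1], ![0, -1, 0]], ![![0, 0, -1], ![0, 0, 0], ![1, 0, 0]],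
    ![![0, 1, 0], ![-1, 0, 0], ![0, 0, 0]]] i k, fun j => ?_, fun x => ?_⟩
  · fin_cases i <;> fin_cases k <;> fin_cases j <;> simp
  · ext j
    fin_cases i <;> fin_cases k <;> fin_cases j <;> simp [rotVec, Fin.sum_univ_three]

theorem fderiv_space_apply (f : ℝ × E3 → ℝ) (p : ℝ × E3) (v : E3) :
    fderiv ℝ f p (0, v) = ∑ i, v i * dx i f p := by
  have hv : ((0 : ℝ), v) = ∑ i, v i • ((0 : ℝ), EuclideanSpace.single i (1 : ℝ)) := by
    rw [Fin.sum_univ_three]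
    ext j
    · simp
    · fin_cases j <;> simp
  simp only [hv, map_sum, map_smul, smul_eq_mul, dx]

theorem sum_dx_sq (f : ℝ × E3 → ℝ) {p : ℝ × E3} (hp : p.2 ≠ 0) :
    ∑ i, dx i f p ^ 2 = dr f p ^ 2 + 1 / ‖p.2‖ ^ 2 * ∑ k, dZ k f p ^ 2 := by
  have norm_sq : ‖p.2‖ ^ 2 = p.2 0 ^ 2 + p.2 1 ^ 2 + p.2 2 ^ 2 := by
    simp [EuclideanSpace.norm_sq_eq, Fin.sum_univ_three]
  have unit : (‖p.2‖⁻¹) ^ 2 * ‖p.2‖ ^ 2 = 1 := by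
    rw [← mul_pow, inv_mul_cancel₀ (norm_ne_zero_iff.2 hp), one_pow]
  simp only [dr, dZ, fderiv_space_apply, Fin.sum_univ_three, rotVec, PiLp.smul_apply, smul_eq_mul,
    one_div, ← inv_pow, Matrix.cons_val_zero, Matrix.cons_val_one, Matrix.cons_val]
  rw [norm_sq] at unit
  linear_combination (-(dx 0 f p ^ 2 + dx 1 f p ^ 2 + dx 2 f p ^ 2)) * unit

theorem fderiv_sum_rotVec (g : ℝ × E3 → ℝ) (p : ℝ × E3) (c : Fin 3 → ℝ) :
    fderiv ℝ g p (0, ∑ i, c i • rotVec i p.2) = ∑ i, c i * dZ i g p := by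
  have hsum : ((0 : ℝ), ∑ i, c i • rotVec i p.2) = ∑ i, c i • ((0 : ℝ), rotVec i p.2) := by
    simp [Fin.sum_univ_three]
  simp only [hsum, map_sum, map_smul, smul_eq_mul, dZ]

theorem fderiv_fderiv_apply_comm {E : Type*} [NormedAddCommGroup E] [NormedSpace ℝ E]
    {f : E → ℝ} {V X : E → E} {p : E} (hf : ContDiffAt ℝ 2 f p)
    (hV : DifferentiableAt ℝ V p) (hX : DifferentiableAt ℝ X p) :
    fderiv ℝ (fun q => fderiv ℝ f q (X q)) p (V p) =
      fderiv ℝ (fun q => fderiv ℝ f q (V q)) p (X p) +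
        fderiv ℝ f p (fderiv ℝ X p (V p) - fderiv ℝ V p (X p)) := by
  have hd : DifferentiableAt ℝ (fderiv ℝ f) p :=
    (hf.fderiv_right (m := 1) (by norm_num)).differentiableAt (by norm_num)
  have hsymm := (hf.isSymmSndFDerivAt (by simp)).eq (V p) (X p)
  rw [fderiv_clm_apply hd hX, fderiv_clm_apply hd hV]
  simp only [_root_.add_apply, ContinuousLinearMap.comp_apply,
    ContinuousLinearMap.flip_apply, map_sub]
  linarith

theorem contDiffAt_fderiv_apply {E : Type*} [NormedAddCommGroup E] [NormedSpace ℝ E]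
    {f : E → ℝ} {X : E → E} {p : E} {n m : WithTop ℕ∞} (hf : ContDiffAt ℝ m f p)
    (hX : ContDiffAt ℝ n X p) (hnm : n + 1 ≤ m) :
    ContDiffAt ℝ n (fun q => fderiv ℝ f q (X q)) p :=
  (hf.fderiv_right hnm).clm_apply hX

/-- The rotation field on space-time. -/
noncomputable def rotField (i : Fin 3) : ℝ × E3 →L[ℝ] ℝ × E3 :=
  (0 : ℝ × E3 →L[ℝ] ℝ).prod ((rotL i).comp (ContinuousLinearMap.snd ℝ ℝ E3))

@[simp] theorem rotField_apply (i : Fin 3) (p : ℝ × E3) : rotField i p = (0, rotVec i p.2) := rfl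

theorem contDiffAt_dZ {f : ℝ × E3 → ℝ} {p : ℝ × E3} {n m : WithTop ℕ∞} (hf : ContDiffAt ℝ m f p)
    (hnm : n + 1 ≤ m) (i : Fin 3) : ContDiffAt ℝ n (dZ i f) p :=
  contDiffAt_fderiv_apply hf (rotField i).contDiff.contDiffAt hnm

theorem contDiffAt_dt {f : ℝ × E3 → ℝ} {p : ℝ × E3} {n m : WithTop ℕ∞} (hf : ContDiffAt ℝ m f p)
    (hnm : n + 1 ≤ m) : ContDiffAt ℝ n (dt f) p :=
  contDiffAt_fderiv_apply hf contDiffAt_const hnm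

theorem dZ_dZ_comm {f : ℝ × E3 → ℝ} {p : ℝ × E3} (hf : ContDiffAt ℝ 2 f p) (i k : Fin 3) :
    dZ k (dZ i f) p = dZ i (dZ k f) p +
      fderiv ℝ f p (0, rotVec i (rotVec k p.2) - rotVec k (rotVec i p.2)) := by
  have h := fderiv_fderiv_apply_comm hf (rotField k).differentiableAt (rotField i).differentiableAt
  simp only [ContinuousLinearMap.fderiv, rotField_apply, Prod.mk_sub_mk, sub_self] at h
  exact h

theorem dt_dZ_comm {f : ℝ × E3 → ℝ} {p : ℝ × E3} (hf : ContDiffAt ℝ 2 f p) (i : Fin 3) :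
    dt (dZ i f) p = dZ i (dt f) p := by
  have h := fderiv_fderiv_apply_comm hf (V := fun _ => ((1 : ℝ), (0 : E3)))
    (differentiableAt_const _) (rotField i).differentiableAt
  have rotVec_zero : rotVec i 0 = 0 := map_zero (rotL i)
  simp only [ContinuousLinearMap.fderiv, rotField_apply, rotVec_zero, fderiv_fun_const,
    Pi.zero_apply, _root_.zero_apply, sub_zero, Prod.mk_zero_zero, map_zero, add_zero] at h
  exact h

theorem abs_fderiv_commutator_le (f : ℝ × E3 → ℝ) (p : ℝ × E3) (i k : Fin 3) :
    |fderiv ℝ f p (0, rotVec i (rotVec k p.2) - rotVec k (rotVec i p.2))| ≤ ∑ j, |dZ j f p| := by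
  obtain ⟨c, hc, h⟩ := rotVec_commutator i k
  rw [h, fderiv_sum_rotVec]
  refine (Finset.abs_sum_le_sum_abs _ _).trans (Finset.sum_le_sum fun j _ => ?_)
  rw [abs_mul]
  exact mul_le_of_le_one_left (abs_nonneg _) (hc j)

theorem hasFDerivAt_norm_of_ne_zero {E : Type*} [NormedAddCommGroup E] [InnerProductSpace ℝ E]
    {x : E} (hx : x ≠ 0) : HasFDerivAt (fun y : E => ‖y‖) (‖x‖⁻¹ • innerSL ℝ x) x := by
  have h := ((hasStrictFDerivAt_norm_sq x).hasFDerivAt).sqrt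
    (pow_ne_zero 2 (norm_ne_zero_iff.2 hx))
  simp only [Real.sqrt_sq (norm_nonneg _)] at h
  refine h.congr_fderiv ?_
  ext v
  simp
  field_simp

/-! ### Functions of time and direction -/

theorem onRays_smul (g : ℝ → E3 → ℝ) (t : ℝ) (x : E3) {c : ℝ} (hc : 0 < c) :
    onRays g (t, c • x) = onRays g (t, x) := by
  simp only [onRays, norm_smul, Real.norm_eq_abs, abs_of_pos hc, smul_smul, mul_inv]
  rw [mul_right_comm, inv_mul_cancel₀ hc.ne', one_mul]

theorem fderiv_onRays_radial {g : ℝ → E3 → ℝ} {p : ℝ × E3}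
    (hg : DifferentiableAt ℝ (onRays g) p) : fderiv ℝ (onRays g) p (0, p.2) = 0 := by
  have hray : HasDerivAt (fun c : ℝ => (p.1, c • p.2)) ((0 : ℝ), p.2) 1 := by
    simpa using (hasDerivAt_const (1 : ℝ) p.1).prodMk ((hasDerivAt_id (1 : ℝ)).smul_const p.2)
  have hcomp : HasDerivAt (onRays g ∘ fun c : ℝ => (p.1, c • p.2)) _ 1 :=
    HasFDerivAt.comp_hasDerivAt 1 (by simpa using hg.hasFDerivAt) hray
  have hconst : (fun _ => onRays g p) =ᶠ[nhds 1] onRays g ∘ fun c : ℝ => (p.1, c • p.2) := by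
    filter_upwards [lt_mem_nhds (zero_lt_one (α := ℝ))] with c hc
    exact (onRays_smul g p.1 p.2 hc).symm
  exact (hcomp.congr_of_eventuallyEq hconst).unique (hasDerivAt_const _ _)

theorem hasDerivAt_onRays_time {g : ℝ → E3 → ℝ} {t : ℝ} {y : E3} {c : ℝ} (hc : 0 < c)
    (hy : ‖y‖ = 1) (hg : DifferentiableAt ℝ (onRays g) (t, c • y)) :
    HasDerivAt (fun s => g s y) (dt (onRays g) (t, c • y)) t := by
  have hline : HasDerivAt (fun s : ℝ => (s, c • y)) ((1 : ℝ), (0 : E3)) t :=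
    (hasDerivAt_id t).prodMk (hasDerivAt_const t _)
  refine (HasFDerivAt.comp_hasDerivAt t hg.hasFDerivAt hline).congr_of_eventuallyEq
    (Filter.Eventually.of_forall fun s => ?_)
  rw [Function.comp_apply, onRays_smul g s y hc]
  simp [onRays, hy]

theorem fderiv_add_mul_dr_eq_zero_of_vanishing {σ : ℝ → E3 → ℝ} {f : ℝ × E3 → ℝ} {p v : ℝ × E3}
    (hp : p.2 ≠ 0) (hσ : DifferentiableAt ℝ (onRays σ) p) (hf : DifferentiableAt ℝ f p)
    (hr : onRays σ p = ‖p.2‖)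
    (hvan : ∀ᶠ q in nhds p, f (q.1, (onRays σ q * ‖q.2‖⁻¹) • q.2) = 0)
    (hv : inner ℝ p.2 v.2 = 0) :
    fderiv ℝ f p v + fderiv ℝ (onRays σ) p v * dr f p = 0 := by
  have hn : ‖p.2‖ ≠ 0 := norm_ne_zero_iff.2 hp
  have hinv : HasFDerivAt (fun q : ℝ × E3 => ‖q.2‖⁻¹) _ p :=
    (hasDerivAt_inv hn).comp_hasFDerivAt p
      ((hasFDerivAt_norm_of_ne_zero hp).comp p hasFDerivAt_snd)
  have hproj : HasFDerivAt (fun q : ℝ × E3 => (q.1, (onRays σ q * ‖q.2‖⁻¹) • q.2)) _ p :=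
    hasFDerivAt_fst.prodMk ((hσ.hasFDerivAt.mul hinv).smul hasFDerivAt_snd)
  have hfix : (p.1, (onRays σ p * ‖p.2‖⁻¹) • p.2) = p := by
    rw [hr, mul_inv_cancel₀ hn, one_smul]
  have hcomp := HasFDerivAt.comp p (g := f) (by rw [hfix]; exact hf.hasFDerivAt) hproj
  have hzero := (hcomp.congr_of_eventuallyEq (f₁ := fun _ => (0 : ℝ))
    (hvan.mono fun q hq => hq.symm)).unique (hasFDerivAt_const (0 : ℝ) p)
  have happly := congrArg (fun L => L v) hzero
  simp only [ContinuousLinearMap.comp_apply, ContinuousLinearMap.prod_apply, _root_.add_apply,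
    _root_.smul_apply, ContinuousLinearMap.smulRight_apply, _root_.zero_apply, Pi.mul_apply,
    ContinuousLinearMap.coe_fst', ContinuousLinearMap.coe_snd', innerSL_apply_apply, hv, hr,
    smul_zero, zero_add, mul_inv_cancel₀ hn, one_smul] at happly
  have hsplit : (v.1, v.2 + (‖p.2‖⁻¹ • fderiv ℝ (onRays σ) p v) • p.2) =
      v + fderiv ℝ (onRays σ) p v • ((0 : ℝ), ‖p.2‖⁻¹ • p.2) := by
    ext1 <;> simp [smul_smul, mul_comm]
  rwa [hsplit, map_add, map_smul, smul_eq_mul] at happly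

theorem tangential_derivatives {σ : ℝ → E3 → ℝ} {f : ℝ × E3 → ℝ} {p : ℝ × E3} (hp : p.2 ≠ 0)
    (hσ : DifferentiableAt ℝ (onRays σ) p) (hf : DifferentiableAt ℝ f p)
    (hr : onRays σ p = ‖p.2‖)
    (hvan : ∀ᶠ q in nhds p, f (q.1, (onRays σ q * ‖q.2‖⁻¹) • q.2) = 0) :
    dt f p + dt (onRays σ) p * dr f p = 0 ∧
      ∀ k, dZ k f p + dZ k (onRays σ) p * dr f p = 0 :=
  ⟨fderiv_add_mul_dr_eq_zero_of_vanishing hp hσ hf hr hvan (by simp),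
    fun k => fderiv_add_mul_dr_eq_zero_of_vanishing hp hσ hf hr hvan (inner_rotVec k p.2)⟩

/-! ### The transport operator of the piston -/

/-- The vector field of the transport operator `𝓑_σ`. -/
noncomputable def wallField (σ : ℝ → E3 → ℝ) (p : ℝ × E3) : ℝ × E3 :=
  (0, ‖p.2‖⁻¹ • p.2 - ∑ i, ((‖p.2‖ ^ 2)⁻¹ * dZ i (onRays σ) p) • rotVec i p.2)

theorem wallOp_eq_fderiv (σ : ℝ → E3 → ℝ) (f : ℝ × E3 → ℝ) (p : ℝ × E3) :
    wallOp σ f p = fderiv ℝ f p (wallField σ p) := by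
  have hsplit : wallField σ p = (0, ‖p.2‖⁻¹ • p.2) -
      (0, ∑ i, ((‖p.2‖ ^ 2)⁻¹ * dZ i (onRays σ) p) • rotVec i p.2) := by
    simp [wallField]
  rw [hsplit, map_sub, fderiv_sum_rotVec, wallOp, dr, Finset.mul_sum]
  simp only [one_div, mul_assoc]

theorem inner_wallField {σ : ℝ → E3 → ℝ} {p : ℝ × E3} (hp : p.2 ≠ 0) :
    inner ℝ p.2 (wallField σ p).2 = ‖p.2‖ := by
  have hn : ‖p.2‖ ≠ 0 := norm_ne_zero_iff.2 hp
  simp only [wallField, inner_sub_right, inner_smul_right, inner_sum, inner_rotVec,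
    real_inner_self_eq_norm_sq, mul_zero, Finset.sum_const_zero, sub_zero]
  field_simp

theorem fderiv_onRays_wallField_nonpos {σ : ℝ → E3 → ℝ} {p : ℝ × E3}
    (hσ : DifferentiableAt ℝ (onRays σ) p) : fderiv ℝ (onRays σ) p (wallField σ p) ≤ 0 := by
  have radial : dr (onRays σ) p = 0 := by
    have hsmul : ((0 : ℝ), ‖p.2‖⁻¹ • p.2) = ‖p.2‖⁻¹ • ((0 : ℝ), p.2) := by simp
    rw [dr, hsmul, map_smul, fderiv_onRays_radial hσ, smul_zero]
  rw [← wallOp_eq_fderiv, wallOp, radial, zero_sub, neg_nonpos]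
  exact mul_nonneg (by positivity) (Finset.sum_nonneg fun i _ => mul_self_nonneg _)

theorem contDiffAt_wallField {σ : ℝ → E3 → ℝ} {p : ℝ × E3} (hp : p.2 ≠ 0)
    (hσ : ContDiffAt ℝ 2 (onRays σ) p) : ContDiffAt ℝ 1 (wallField σ) p := by
  have hn : ‖p.2‖ ≠ 0 := norm_ne_zero_iff.2 hp
  have hnorm : ContDiffAt ℝ 1 (fun q : ℝ × E3 => ‖q.2‖) p := contDiffAt_snd.norm ℝ hp
  refine contDiffAt_const.prodMk (((hnorm.inv hn).smul contDiffAt_snd).sub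
    (ContDiffAt.sum fun i _ => ?_))
  refine (((hnorm.pow 2).inv (pow_ne_zero 2 hn)).mul (contDiffAt_dZ hσ (by norm_num) i)).smul ?_
  exact (rotL i).contDiff.contDiffAt.comp p contDiffAt_snd

theorem fderiv_wallField_apply {σ : ℝ → E3 → ℝ} {p v : ℝ × E3} (hp : p.2 ≠ 0)
    (hσ : ContDiffAt ℝ 2 (onRays σ) p) (hv : inner ℝ p.2 v.2 = 0) :
    fderiv ℝ (wallField σ) p v = (0, ‖p.2‖⁻¹ • v.2 - ∑ i, (‖p.2‖ ^ 2)⁻¹ •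
      (fderiv ℝ (dZ i (onRays σ)) p v • rotVec i p.2 +
        dZ i (onRays σ) p • rotVec i v.2)) := by
  have hn : ‖p.2‖ ≠ 0 := norm_ne_zero_iff.2 hp
  have hinv : HasFDerivAt (fun q : ℝ × E3 => ‖q.2‖⁻¹) _ p :=
    (hasDerivAt_inv hn).comp_hasFDerivAt p
      ((hasFDerivAt_norm_of_ne_zero hp).comp p hasFDerivAt_snd)
  have hZ : ∀ i, HasFDerivAt (dZ i (onRays σ)) (fderiv ℝ (dZ i (onRays σ)) p) p := fun i =>
    ((contDiffAt_dZ hσ (n := 1) (by norm_num) i).differentiableAt (by norm_num)).hasFDerivAt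
  have hR : ∀ i, HasFDerivAt (fun q : ℝ × E3 => rotVec i q.2) _ p := fun i =>
    (rotL i).hasFDerivAt.comp p hasFDerivAt_snd
  have hsum : HasFDerivAt (fun q : ℝ × E3 => ∑ i, ((‖q.2‖⁻¹ ^ 2) * dZ i (onRays σ) q) •
      rotVec i q.2) _ p := HasFDerivAt.fun_sum fun i _ => ((hinv.pow 2).mul (hZ i)).smul (hR i)
  have hW : HasFDerivAt (wallField σ) _ p :=
    ((hasFDerivAt_const (0 : ℝ) p).prodMk
      ((hinv.smul hasFDerivAt_snd).sub hsum)).congr_of_eventuallyEq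
    (Filter.Eventually.of_forall fun q => by simp [wallField])
  rw [hW.fderiv]
  simp only [ContinuousLinearMap.prod_apply, _root_.zero_apply, Prod.mk.injEq, true_and,
    _root_.sub_apply, _root_.add_apply, _root_.smul_apply, ContinuousLinearMap.smulRight_apply,
    ContinuousLinearMap.comp_apply, ContinuousLinearMap.coe_snd', innerSL_apply_apply, hv,
    smul_zero, zero_smul, add_zero, _root_.sum_apply]
  congr 1
  refine Finset.sum_congr rfl fun i _ => ?_
  simp only [Pi.mul_apply, inv_pow, rotL_apply, smul_eq_mul]
  module

theorem isCompact_shell {s : E3 → ℝ} (hs : ∀ y ≠ 0, ContinuousAt s y) {c : ℝ} (hc : 0 < c)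
    (R : ℝ) : IsCompact {y : E3 | c ≤ ‖y‖ ∧ s y ≤ ‖y‖ ∧ ‖y‖ ≤ R} := by
  have hgap : ContinuousOn (fun y => ‖y‖ - s y) {y : E3 | c ≤ ‖y‖} := fun y hy =>
    (continuous_norm.continuousAt.sub
      (hs y (norm_pos_iff.1 (hc.trans_le hy)))).continuousWithinAt
  have hclosed := hgap.preimage_isClosed_of_isClosed
    (isClosed_le continuous_const continuous_norm) (isClosed_Ici (a := (0 : ℝ)))
  have hinter : {y : E3 | c ≤ ‖y‖ ∧ s y ≤ ‖y‖ ∧ ‖y‖ ≤ R} =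
      ({y | c ≤ ‖y‖} ∩ (fun y => ‖y‖ - s y) ⁻¹' Ici 0) ∩ Metric.closedBall 0 R := by
    ext y
    simp [and_assoc]
  exact hinter ▸ (isCompact_closedBall (0 : E3) R).inter_left hclosed

theorem neg_wallField_mem_posTangentConeAt {σ : ℝ → E3 → ℝ} {t c R : ℝ} {y : E3}
    (hσc : ∀ x : E3, x ≠ 0 → c ≤ onRays σ (t, x))
    (hσ : ContinuousAt (fun x => onRays σ (t, x)) y) (hy : y ≠ 0)
    (hlt : onRays σ (t, y) < ‖y‖) (hR : ‖y‖ ≤ R) :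
    -(wallField σ (t, y)).2 ∈
      posTangentConeAt {x : E3 | c ≤ ‖x‖ ∧ onRays σ (t, x) ≤ ‖x‖ ∧ ‖x‖ ≤ R} y := by
  set w := (wallField σ (t, y)).2
  have hinner : inner ℝ y w = ‖y‖ := inner_wallField (p := (t, y)) hy
  have hline : Filter.Tendsto (fun s : ℝ => y + s • -w) (nhds 0) (nhds y) := by
    simpa using (Continuous.tendsto (by fun_prop : Continuous fun s : ℝ => y + s • -w) 0)
  have hbehind : ∀ᶠ x in nhds y, onRays σ (t, x) < ‖x‖ :=
    hσ.eventually_lt continuous_norm.continuousAt hlt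
  have hsmall : ∀ᶠ s : ℝ in nhds 0, s * ‖w‖ ^ 2 < 2 * ‖y‖ :=
    ContinuousAt.eventually_lt (by fun_prop) continuousAt_const (by simpa using hy)
  refine mem_posTangentConeAt_of_frequently_mem (Filter.Eventually.frequently ?_)
  filter_upwards [((hline.eventually hbehind).and
    (hline.eventually_ne hy)).filter_mono nhdsWithin_le_nhds,
    hsmall.filter_mono nhdsWithin_le_nhds, self_mem_nhdsWithin] with s ⟨hs, hne⟩ hsw hs0
  have hs0 : 0 < s := hs0
  have hnorm : ‖y + s • -w‖ ^ 2 ≤ ‖y‖ ^ 2 := by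
    rw [norm_add_sq_real, smul_neg, inner_neg_right, inner_smul_right, hinner, norm_neg,
      norm_smul, Real.norm_of_nonneg hs0.le]
    nlinarith
  exact ⟨(hσc _ hne).trans hs.le, hs.le,
    (pow_le_pow_iff_left₀ (norm_nonneg _) (norm_nonneg _) two_ne_zero).1 hnorm |>.trans hR⟩

theorem le_of_fderiv_wallField_le {σ : ℝ → E3 → ℝ} {F : ℝ × E3 → ℝ} {t R B κ c : ℝ} (hc : 0 < c)
    (hσc : ∀ x : E3, x ≠ 0 → c ≤ onRays σ (t, x))
    (hσ : ∀ x : E3, x ≠ 0 → DifferentiableAt ℝ (onRays σ) (t, x))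
    (hF : ∀ x : E3, x ≠ 0 → onRays σ (t, x) ≤ ‖x‖ → ‖x‖ ≤ R → DifferentiableAt ℝ F (t, x))
    (hin : ∀ x : E3, x ≠ 0 → onRays σ (t, x) < ‖x‖ → ‖x‖ ≤ R →
      fderiv ℝ F (t, x) (wallField σ (t, x)) ≤ κ)
    (hwall : ∀ x : E3, x ≠ 0 → onRays σ (t, x) = ‖x‖ → ‖x‖ ≤ R → F (t, x) ≤ B)
    (hκ : 0 ≤ κ) {x : E3} (hx : x ≠ 0) (hσx : onRays σ (t, x) ≤ ‖x‖) (hxR : ‖x‖ ≤ R) :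
    F (t, x) ≤ B + κ * (‖x‖ - onRays σ (t, x)) := by
  suffices strict : ∀ κ' > κ, F (t, x) ≤ B + κ' * (‖x‖ - onRays σ (t, x)) by
    have hlim : Filter.Tendsto (fun κ' => B + κ' * (‖x‖ - onRays σ (t, x)))
        (nhdsWithin κ (Ioi κ)) (nhds (B + κ * (‖x‖ - onRays σ (t, x)))) :=
      (Continuous.tendsto (by fun_prop) κ).mono_left nhdsWithin_le_nhds
    exact ge_of_tendsto hlim (eventually_mem_nhdsWithin.mono strict)
  intro κ' hκ'
  set K : Set E3 := {y | c ≤ ‖y‖ ∧ onRays σ (t, y) ≤ ‖y‖ ∧ ‖y‖ ≤ R}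
  have hne : ∀ y ∈ K, y ≠ 0 := fun y hy => norm_pos_iff.1 (hc.trans_le hy.1)
  have hslice : ∀ y : E3, HasFDerivAt (fun z : E3 => (t, z)) (.inr ℝ ℝ E3) y := fun y =>
    hasFDerivAt_prodMk_right t y
  have hderiv : ∀ y ∈ K, HasFDerivAt
      (fun z => F (t, z) - κ' * (‖z‖ - onRays σ (t, z))) _ y := fun y hy =>
    ((hF y (hne y hy) hy.2.1 hy.2.2).hasFDerivAt.comp y (hslice y)).sub
      (((hasFDerivAt_norm_of_ne_zero (hne y hy)).sub
        ((hσ y (hne y hy)).hasFDerivAt.comp y (hslice y))).const_mul κ')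
  have hσcont : ∀ y ≠ 0, ContinuousAt (fun z => onRays σ (t, z)) y := fun y hy =>
    ((hσ y hy).hasFDerivAt.comp y (hslice y)).continuousAt
  have hxK : x ∈ K := ⟨(hσc x hx).trans hσx, hσx, hxR⟩
  obtain ⟨y, hy, hmax⟩ := (isCompact_shell hσcont hc R).exists_isMaxOn ⟨x, hxK⟩
    fun z hz => (hderiv z hz).continuousAt.continuousWithinAt
  have hy0 := hne y hy
  have hxy : F (t, x) - κ' * (‖x‖ - onRays σ (t, x)) ≤
      F (t, y) - κ' * (‖y‖ - onRays σ (t, y)) := hmax hxK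
  rcases hy.2.1.eq_or_lt with heq | hlt
  · have := hwall y hy0 heq hy.2.2
    rw [heq, sub_self, mul_zero, sub_zero] at hxy
    linarith
  -- In the interior, the penalized function would still increase along the reversed field.
  · exfalso
    have hnonpos := hmax.localize.hasFDerivWithinAt_nonpos (hderiv y hy).hasFDerivWithinAt
      (neg_wallField_mem_posTangentConeAt hσc (hσcont y hy0) hy0 hlt hy.2.2)
    have hfield : ((0 : ℝ), (wallField σ (t, y)).2) = wallField σ (t, y) := rfl
    have hinner : inner ℝ y (wallField σ (t, y)).2 = ‖y‖ := inner_wallField (p := (t, y)) hy0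
    simp only [map_neg, _root_.sub_apply, _root_.smul_apply, ContinuousLinearMap.comp_apply,
      ContinuousLinearMap.inr_apply, innerSL_apply_apply, hfield, hinner, smul_eq_mul,
      inv_mul_cancel₀ (norm_ne_zero_iff.2 hy0)] at hnonpos
    nlinarith [hin y hy0 hlt hy.2.2, fderiv_onRays_wallField_nonpos (hσ y hy0)]

/-! ### Bounds on the piston -/

/-- `b` is smooth and, for `t ≥ 1`, the function `b - b₀` and those first and second derivatives of
it that enter the transport problem are at most `δ` when weighted by powers of `t`. -/
structure IsPistonClose (b₀ δ : ℝ) (b : ℝ → E3 → ℝ) : Prop where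
  smooth : ∀ p : ℝ × E3, 0 < p.1 → p.2 ≠ 0 → ContDiffAt ℝ ∞ (onRays b) p
  speed : ∀ p : ℝ × E3, 1 ≤ p.1 → p.2 ≠ 0 → |onRays b p - b₀| ≤ δ
  time : ∀ p : ℝ × E3, 1 ≤ p.1 → p.2 ≠ 0 → |p.1 * dt (onRays b) p| ≤ δ
  time_time : ∀ p : ℝ × E3, 1 ≤ p.1 → p.2 ≠ 0 → |p.1 ^ 2 * dt (dt (onRays b)) p| ≤ δ
  angular : ∀ p : ℝ × E3, 1 ≤ p.1 → p.2 ≠ 0 → ∀ i, |dZ i (onRays b) p| ≤ δ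
  angular_angular : ∀ p : ℝ × E3, 1 ≤ p.1 → p.2 ≠ 0 → ∀ i k, |dZ k (dZ i (onRays b)) p| ≤ δ
  time_angular : ∀ p : ℝ × E3, 1 ≤ p.1 → p.2 ≠ 0 → ∀ i, |p.1 * dt (dZ i (onRays b)) p| ≤ δ

theorem two_le_infty : (2 : WithTop ℕ∞) ≤ ∞ := WithTop.coe_le_coe.2 le_top

theorem dZ_sub_const (i : Fin 3) (g : ℝ × E3 → ℝ) (c : ℝ) :
    dZ i (fun q => g q - c) = dZ i g := by
  ext p; simp [dZ, fderiv_sub_const]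

theorem dt_sub_const (g : ℝ × E3 → ℝ) (c : ℝ) : dt (fun q => g q - c) = dt g := by
  ext p; simp [dt, fderiv_sub_const]

theorem IsPistonSpeed.abs_weighted_le {b₀ ε : ℝ} {K : ℕ → (Fin 3 → ℕ) → ℝ} {b : ℝ → E3 → ℝ}
    (hb : IsPistonSpeed b₀ ε K b) (hε : 0 ≤ ε) {p : ℝ × E3} (ht : 1 ≤ p.1) (hp : p.2 ≠ 0) {k₀ : ℕ}
    (hk₀ : k₀ ∈ Finset.range 3) {k : Fin 3 → ℕ}
    (hk : k ∈ Fintype.piFinset fun _ => Finset.range 3) :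
    |p.1 ^ k₀ * (dt^[k₀] ((dZ 0)^[k 0] ((dZ 1)^[k 1] ((dZ 2)^[k 2] fun q => onRays b q - b₀)))) p|
      ≤ (∑ l₀ ∈ Finset.range 3, ∑ l ∈ Fintype.piFinset fun _ => Finset.range 3, |K l₀ l|) * ε := by
  have hbound := hb.bound k₀ k p (by linarith) hp
  rw [le_div_iff₀ (by positivity)] at hbound
  have hpow : p.1 ^ k₀ ≤ (1 + p.1) ^ k₀ := by gcongr; linarith
  have hK : |K k₀ k| ≤
      ∑ l₀ ∈ Finset.range 3, ∑ l ∈ Fintype.piFinset fun _ => Finset.range 3, |K l₀ l| :=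
    (Finset.single_le_sum (f := fun l => |K k₀ l|) (fun _ _ => abs_nonneg _) hk).trans
      (Finset.single_le_sum (f := fun l₀ => ∑ l ∈ _, |K l₀ l|)
        (fun _ _ => Finset.sum_nonneg fun _ _ => abs_nonneg _) hk₀)
  rw [abs_mul, abs_of_nonneg (by positivity : 0 ≤ p.1 ^ k₀), mul_comm]
  calc _ ≤ _ := mul_le_mul_of_nonneg_left hpow (abs_nonneg _)
    _ ≤ _ := hbound
    _ ≤ _ := mul_le_mul_of_nonneg_right ((le_abs_self _).trans hK) hε

theorem exists_isPistonClose (b₀ : ℝ) (K : ℕ → (Fin 3 → ℕ) → ℝ) : ∃ N : ℝ, 0 < N ∧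
    ∀ ε : ℝ, 0 < ε → ∀ b, IsPistonSpeed b₀ ε K b → IsPistonClose b₀ (N * ε) b := by
  set N₀ : ℝ := ∑ k₀ ∈ Finset.range 3, ∑ k ∈ Fintype.piFinset fun _ => Finset.range 3, |K k₀ k|
    with hN₀
  have N₀_nonneg : 0 ≤ N₀ :=
    Finset.sum_nonneg fun _ _ => Finset.sum_nonneg fun _ _ => abs_nonneg _
  refine ⟨4 * N₀ + 1, by positivity, fun ε hε b hb => ?_⟩
  have weaken : ∀ {a : ℝ}, a ≤ N₀ * ε → a ≤ (4 * N₀ + 1) * ε := fun ha => by nlinarith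
  have weighted := fun {p : ℝ × E3} (ht : 1 ≤ p.1) (hp : p.2 ≠ 0) (k₀ : ℕ)
    (hk₀ : k₀ ∈ Finset.range 3) (k : Fin 3 → ℕ)
    (hk : k ∈ Fintype.piFinset fun _ => Finset.range 3) =>
      hN₀ ▸ hb.abs_weighted_le hε.le ht hp hk₀ hk
  have angular : ∀ p : ℝ × E3, 1 ≤ p.1 → p.2 ≠ 0 → ∀ i, |dZ i (onRays b) p| ≤ N₀ * ε := by
    intro p ht hp i
    have h := weighted ht hp 0 (by decide) (Pi.single i 1) (by fin_cases i <;> decide)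
    fin_cases i <;> simpa [dZ_sub_const] using h
  have ordered : ∀ p : ℝ × E3, 1 ≤ p.1 → p.2 ≠ 0 → ∀ i k, k ≤ i →
      |dZ k (dZ i (onRays b)) p| ≤ N₀ * ε := by
    intro p ht hp i k hki
    have h := weighted ht hp 0 (by decide) (Pi.single i 1 + Pi.single k 1)
      (by fin_cases i <;> fin_cases k <;> decide)
    fin_cases i <;> fin_cases k <;> first
      | exact absurd hki (by decide)
      | simpa [dZ_sub_const] using h
  refine ⟨hb.smooth, fun p ht hp => weaken ?_, fun p ht hp => weaken ?_,
    fun p ht hp => weaken ?_, fun p ht hp i => weaken (angular p ht hp i),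
    fun p ht hp i k => ?_, fun p ht hp i => weaken ?_⟩
  · simpa using weighted ht hp 0 (by decide) 0 (by decide)
  · simpa [dt_sub_const] using weighted ht hp 1 (by decide) 0 (by decide)
  · simpa [dt_sub_const] using weighted ht hp 2 (by decide) 0 (by decide)
  · rcases le_total k i with hki | hik
    · exact weaken (ordered p ht hp i k hki)
    · have hsum : ∑ j, |dZ j (onRays b) p| ≤ 3 * (N₀ * ε) :=
        (Finset.sum_le_sum fun j _ => angular p ht hp j).trans (by simp)
      rw [dZ_dZ_comm ((hb.smooth p (by linarith) hp).of_le two_le_infty) i k]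
      refine (abs_add_le _ _).trans ?_
      nlinarith [ordered p ht hp k i hik, abs_fderiv_commutator_le (onRays b) p i k]
  · have h := weighted ht hp 1 (by decide) (Pi.single i 1) (by fin_cases i <;> decide)
    fin_cases i <;> simpa [dZ_sub_const] using h

theorem onRays_pistonPath (b : ℝ → E3 → ℝ) (p : ℝ × E3) :
    onRays (pistonPath b) p = p.1 * onRays b p := rfl

theorem eventually_pos_and_ne_zero {p : ℝ × E3} (ht : 0 < p.1) (hp : p.2 ≠ 0) :
    ∀ᶠ q in nhds p, 0 < q.1 ∧ q.2 ≠ 0 :=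
  (continuous_fst.continuousAt.eventually (lt_mem_nhds ht)).and
    (continuous_snd.continuousAt.eventually_ne hp)

namespace IsPistonClose

variable {b₀ δ : ℝ} {b : ℝ → E3 → ℝ} {p : ℝ × E3}

theorem contDiffAt_path (hb : IsPistonClose b₀ δ b) (ht : 0 < p.1)
    (hp : p.2 ≠ 0) : ContDiffAt ℝ ∞ (onRays (pistonPath b)) p :=
  contDiffAt_fst.mul (hb.smooth p ht hp)

theorem hasFDerivAt_path (hb : IsPistonClose b₀ δ b) (ht : 0 < p.1) (hp : p.2 ≠ 0) :
    HasFDerivAt (onRays (pistonPath b))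
      (p.1 • fderiv ℝ (onRays b) p + onRays b p • ContinuousLinearMap.fst ℝ ℝ E3) p :=
  hasFDerivAt_fst.mul ((hb.smooth p ht hp).differentiableAt (by simp)).hasFDerivAt

theorem dZ_path (hb : IsPistonClose b₀ δ b) (ht : 0 < p.1) (hp : p.2 ≠ 0) (i : Fin 3) :
    dZ i (onRays (pistonPath b)) p = p.1 * dZ i (onRays b) p := by
  simp [dZ, (hb.hasFDerivAt_path ht hp).fderiv]

theorem dt_path (hb : IsPistonClose b₀ δ b) (ht : 0 < p.1) (hp : p.2 ≠ 0) :
    dt (onRays (pistonPath b)) p = onRays b p + p.1 * dt (onRays b) p := by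
  simp [dt, (hb.hasFDerivAt_path ht hp).fderiv, add_comm]

theorem hasFDerivAt_dZ_path (hb : IsPistonClose b₀ δ b) (ht : 0 < p.1) (hp : p.2 ≠ 0)
    (i : Fin 3) : HasFDerivAt (dZ i (onRays (pistonPath b)))
      (p.1 • fderiv ℝ (dZ i (onRays b)) p +
        dZ i (onRays b) p • ContinuousLinearMap.fst ℝ ℝ E3) p := by
  have hZ : ContDiffAt ℝ 1 (dZ i (onRays b)) p :=
    contDiffAt_dZ (hb.smooth p ht hp) (by norm_num; exact two_le_infty) i
  exact (hasFDerivAt_fst.mul (hZ.differentiableAt (by norm_num)).hasFDerivAt).congr_of_eventuallyEq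
    ((eventually_pos_and_ne_zero ht hp).mono fun q hq => hb.dZ_path hq.1 hq.2 i)

theorem abs_dZ_path_le (hb : IsPistonClose b₀ δ b) (ht : 1 ≤ p.1) (hp : p.2 ≠ 0) (i : Fin 3) :
    |dZ i (onRays (pistonPath b)) p| ≤ p.1 * δ := by
  have ht₀ : 0 < p.1 := by linarith
  rw [hb.dZ_path ht₀ hp, abs_mul, abs_of_pos ht₀]
  exact mul_le_mul_of_nonneg_left (hb.angular p ht hp i) ht₀.le

theorem abs_dZ_dZ_path_le (hb : IsPistonClose b₀ δ b) (ht : 1 ≤ p.1) (hp : p.2 ≠ 0)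
    (i k : Fin 3) : |dZ k (dZ i (onRays (pistonPath b))) p| ≤ p.1 * δ := by
  have ht₀ : 0 < p.1 := by linarith
  have hprod : dZ k (dZ i (onRays (pistonPath b))) p = p.1 * dZ k (dZ i (onRays b)) p := by
    rw [dZ, (hb.hasFDerivAt_dZ_path ht₀ hp i).fderiv]
    simp [dZ]
  rw [hprod, abs_mul, abs_of_pos ht₀]
  exact mul_le_mul_of_nonneg_left (hb.angular_angular p ht hp i k) ht₀.le

theorem abs_dt_dZ_path_le (hb : IsPistonClose b₀ δ b) (ht : 1 ≤ p.1) (hp : p.2 ≠ 0)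
    (i : Fin 3) : |dt (dZ i (onRays (pistonPath b))) p| ≤ 2 * δ := by
  have hprod : dt (dZ i (onRays (pistonPath b))) p =
      p.1 * dt (dZ i (onRays b)) p + dZ i (onRays b) p := by
    rw [dt, (hb.hasFDerivAt_dZ_path (by linarith) hp i).fderiv]
    simp [dt]
  rw [hprod]
  linarith [abs_add_le (p.1 * dt (dZ i (onRays b)) p) (dZ i (onRays b) p),
    hb.time_angular p ht hp i, hb.angular p ht hp i]

theorem abs_dt_path_le (hb : IsPistonClose b₀ δ b) (ht : 1 ≤ p.1) (hp : p.2 ≠ 0) :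
    |dt (onRays (pistonPath b)) p| ≤ |b₀| + 2 * δ := by
  rw [hb.dt_path (by linarith) hp]
  have hspeed : |onRays b p| ≤ |b₀| + |onRays b p - b₀| := by
    simpa using abs_add_le b₀ (onRays b p - b₀)
  linarith [abs_add_le (onRays b p) (p.1 * dt (onRays b) p), hb.time p ht hp, hb.speed p ht hp]

end IsPistonClose

/-! ### The transport problem of the corrector -/

namespace Background

variable {G : Gas} {b₀ : ℝ} (bg : Background G b₀)

/-- The datum of the transport problem of the corrector, multiplied by `t`, as a function of
`σ / t` and `∂_t σ - σ / t`. -/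
noncomputable def wallDatum (z : ℝ × ℝ) : ℝ := (z.1 + z.2 - bg.u z.1) / bg.profile z.1

/-- `t` times the datum of the transport problem of the corrector. -/
noncomputable def wallSource (b : ℝ → E3 → ℝ) (p : ℝ × E3) : ℝ :=
  bg.wallDatum (onRays b p, p.1 * dt (onRays b) p)

theorem contDiffAt_wallDatum (hb : 0 < b₀) : ContDiffAt ℝ 1 bg.wallDatum (b₀, 0) := by
  have hprofile : bg.profile b₀ < 0 := by
    have := mul_pos (sub_pos.2 bg.b₀_lt_s₀) (bg.u_pos hb bg.shock_mem)
    linarith [bg.profile_wall_le hb]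
  have hu : ContDiffAt ℝ 1 (fun z : ℝ × ℝ => bg.u z.1) (b₀, 0) :=
    (bg.contDiffAt_u hb bg.wall_mem).comp (b₀, (0 : ℝ)) contDiffAt_fst
  have hφ : ContDiffAt ℝ 1 (fun z : ℝ × ℝ => bg.profile z.1) (b₀, 0) :=
    (bg.contDiffAt_profile bg.wall_mem_domain).comp (b₀, (0 : ℝ)) contDiffAt_fst
  exact ((contDiffAt_fst.add contDiffAt_snd).sub hu).div hφ hprofile.ne

theorem eventually_abs_u_sub_wall_le (hb : 0 < b₀) :
    ∀ᶠ s in nhds b₀, |bg.u s - b₀| ≤ 3 * |s - b₀| := by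
  filter_upwards [(bg.hasDerivAt_u_wall hb).isLittleO.bound (c := 1) one_pos] with s hs
  simp only [Real.norm_eq_abs, smul_eq_mul, one_mul, bg.wall] at hs
  calc |bg.u s - b₀| = |(bg.u s - b₀ - (s - b₀) * -2) + (s - b₀) * -2| := by congr 1; ring
    _ ≤ |bg.u s - b₀ - (s - b₀) * -2| + |s - b₀| * 2 := by
        refine (abs_add_le _ _).trans_eq ?_
        rw [abs_mul, abs_neg, abs_two]
    _ ≤ 3 * |s - b₀| := by linarith

theorem eventually_abs_wallDatum_le (hb : 0 < b₀) : ∀ᶠ z in nhds ((b₀ : ℝ), (0 : ℝ)),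
    |bg.wallDatum z| ≤ 10 / ((bg.s₀ - b₀) * bg.u bg.s₀) * ‖z - (b₀, 0)‖ := by
  have hgap : 0 < (bg.s₀ - b₀) * bg.u bg.s₀ :=
    mul_pos (sub_pos.2 bg.b₀_lt_s₀) (bg.u_pos hb bg.shock_mem)
  have hprofile : ∀ᶠ s in nhds b₀, bg.profile s < -((bg.s₀ - b₀) * bg.u bg.s₀) / 2 :=
    (bg.contDiffAt_profile bg.wall_mem_domain).continuousAt.eventually
      (gt_mem_nhds (by linarith [bg.profile_wall_le hb]))
  have hfst := continuousAt_fst (p := (b₀, (0 : ℝ)))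
  filter_upwards [hfst.eventually hprofile, hfst.eventually (bg.eventually_abs_u_sub_wall_le hb)]
    with z hφ hu
  have hz₁ : |z.1 - b₀| ≤ ‖z - (b₀, 0)‖ := norm_fst_le (z - (b₀, 0))
  have hz₂ : |z.2| ≤ ‖z - (b₀, 0)‖ := by
    have := norm_snd_le (z - (b₀, 0))
    rwa [Prod.snd_sub, sub_zero] at this
  have hnum : |z.1 + z.2 - bg.u z.1| ≤ 5 * ‖z - (b₀, 0)‖ := by
    calc |z.1 + z.2 - bg.u z.1| = |(z.1 - b₀) + z.2 - (bg.u z.1 - b₀)| := by congr 1; ring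
      _ ≤ |z.1 - b₀| + |z.2| + |bg.u z.1 - b₀| :=
          (abs_sub _ _).trans (add_le_add_left (abs_add_le _ _) _)
      _ ≤ 5 * ‖z - (b₀, 0)‖ := by linarith
  rw [wallDatum, abs_div, abs_of_neg (by linarith : bg.profile z.1 < 0),
    div_le_iff₀ (by linarith)]
  calc |z.1 + z.2 - bg.u z.1|
      ≤ 10 / ((bg.s₀ - b₀) * bg.u bg.s₀) * ‖z - (b₀, 0)‖ * ((bg.s₀ - b₀) * bg.u bg.s₀ / 2) := by
        refine hnum.trans_eq ?_
        have := (bg.u_pos hb bg.shock_mem).ne'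
        have := (sub_pos.2 bg.b₀_lt_s₀).ne'
        field_simp
        ring
    _ ≤ 10 / ((bg.s₀ - b₀) * bg.u bg.s₀) * ‖z - (b₀, 0)‖ * -bg.profile z.1 :=
        mul_le_mul_of_nonneg_left (by linarith) (by positivity)

theorem exists_wallDatum_bounds (hb : 0 < b₀) : ∃ d : ℝ, 0 < d ∧ ∃ L : ℝ, 0 ≤ L ∧
    ∀ z : ℝ × ℝ, ‖z - (b₀, 0)‖ ≤ d →
      DifferentiableAt ℝ bg.wallDatum z ∧ ‖fderiv ℝ bg.wallDatum z‖ ≤ L ∧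
      |bg.wallDatum z| ≤ 10 / ((bg.s₀ - b₀) * bg.u bg.s₀) * ‖z - (b₀, 0)‖ := by
  have hdatum := bg.contDiffAt_wallDatum hb
  have hdiff : ∀ᶠ z in nhds ((b₀ : ℝ), (0 : ℝ)), DifferentiableAt ℝ bg.wallDatum z :=
    (hdatum.eventually (by simp)).mono fun z hz => hz.differentiableAt (by norm_num)
  have hderiv : ∀ᶠ z in nhds ((b₀ : ℝ), (0 : ℝ)),
      ‖fderiv ℝ bg.wallDatum z‖ < ‖fderiv ℝ bg.wallDatum (b₀, 0)‖ + 1 :=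
    (hdatum.fderiv_right (m := 0) (by norm_num)).continuousAt.norm.eventually
      (gt_mem_nhds (lt_add_one _))
  obtain ⟨d, hd, hball⟩ := Metric.eventually_nhds_iff_ball.1
    (hdiff.and (hderiv.and (bg.eventually_abs_wallDatum_le hb)))
  refine ⟨d / 2, half_pos hd, ‖fderiv ℝ bg.wallDatum (b₀, 0)‖ + 1, by positivity, fun z hz => ?_⟩
  obtain ⟨hz_diff, hz_deriv, hz_le⟩ := hball z (mem_ball_iff_norm.2 (by linarith))
  exact ⟨hz_diff, hz_deriv.le, hz_le⟩

theorem hasFDerivAt_wallSource {δ : ℝ} {b : ℝ → E3 → ℝ} (hb : IsPistonClose b₀ δ b)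
    {p : ℝ × E3} (ht : 1 ≤ p.1) (hp : p.2 ≠ 0)
    (hdatum : DifferentiableAt ℝ bg.wallDatum (onRays b p, p.1 * dt (onRays b) p)) :
    HasFDerivAt (bg.wallSource b)
      ((fderiv ℝ bg.wallDatum (onRays b p, p.1 * dt (onRays b) p)).comp
        ((fderiv ℝ (onRays b) p).prod (p.1 • fderiv ℝ (dt (onRays b)) p +
          dt (onRays b) p • ContinuousLinearMap.fst ℝ ℝ E3))) p := by
  have hβ := hb.smooth p (one_pos.trans_le ht) hp
  have hβt := (contDiffAt_dt (n := 1) (hβ.of_le two_le_infty) (by norm_num)).differentiableAt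
    (by norm_num)
  exact hdatum.hasFDerivAt.comp p ((hβ.differentiableAt (by simp)).hasFDerivAt.prodMk
    (hasFDerivAt_fst.mul hβt.hasFDerivAt))

theorem abs_fderiv_wallDatum_apply_le {L : ℝ} {w z : ℝ × ℝ} (hL : ‖fderiv ℝ bg.wallDatum w‖ ≤ L)
    {c : ℝ} (hz₁ : |z.1| ≤ c) (hz₂ : |z.2| ≤ c) : |fderiv ℝ bg.wallDatum w z| ≤ L * c :=
  (ContinuousLinearMap.le_opNorm _ _).trans
    (mul_le_mul hL (max_le hz₁ hz₂) (norm_nonneg _) ((norm_nonneg _).trans hL))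

theorem abs_dZ_wallSource_le {δ L : ℝ} {b : ℝ → E3 → ℝ} (hb : IsPistonClose b₀ δ b)
    {p : ℝ × E3} (ht : 1 ≤ p.1) (hp : p.2 ≠ 0)
    (hdatum : DifferentiableAt ℝ bg.wallDatum (onRays b p, p.1 * dt (onRays b) p))
    (hL : ‖fderiv ℝ bg.wallDatum (onRays b p, p.1 * dt (onRays b) p)‖ ≤ L) (k : Fin 3) :
    |dZ k (bg.wallSource b) p| ≤ L * δ := by
  have hmixed := hb.time_angular p ht hp k
  rw [dt_dZ_comm ((hb.smooth p (one_pos.trans_le ht) hp).of_le two_le_infty)] at hmixed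
  rw [dZ, (bg.hasFDerivAt_wallSource hb ht hp hdatum).fderiv, ContinuousLinearMap.comp_apply]
  refine bg.abs_fderiv_wallDatum_apply_le hL ?_ ?_
  · simpa [dZ] using hb.angular p ht hp k
  · simpa [dZ] using hmixed

theorem abs_dt_wallSource_le {δ L : ℝ} {b : ℝ → E3 → ℝ} (hb : IsPistonClose b₀ δ b)
    {p : ℝ × E3} (ht : 1 ≤ p.1) (hp : p.2 ≠ 0)
    (hdatum : DifferentiableAt ℝ bg.wallDatum (onRays b p, p.1 * dt (onRays b) p))
    (hL : ‖fderiv ℝ bg.wallDatum (onRays b p, p.1 * dt (onRays b) p)‖ ≤ L) :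
    |p.1 * dt (bg.wallSource b) p| ≤ L * (2 * δ) := by
  have htime := hb.time p ht hp
  have hsecond : |p.1 * (p.1 * dt (dt (onRays b)) p + dt (onRays b) p)| ≤ 2 * δ := by
    calc |p.1 * (p.1 * dt (dt (onRays b)) p + dt (onRays b) p)|
        = |p.1 ^ 2 * dt (dt (onRays b)) p + p.1 * dt (onRays b) p| := by congr 1; ring
      _ ≤ 2 * δ := (abs_add_le _ _).trans (by linarith [hb.time_time p ht hp])
  rw [dt, (bg.hasFDerivAt_wallSource hb ht hp hdatum).fderiv, ContinuousLinearMap.comp_apply,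
    ← smul_eq_mul, ← map_smul]
  refine bg.abs_fderiv_wallDatum_apply_le hL ?_ ?_
  · have : |p.1 * dt (onRays b) p| ≤ 2 * δ := by linarith [abs_nonneg (p.1 * dt (onRays b) p)]
    simpa [dt] using this
  · simpa [dt] using hsecond

/-- The piston speed `b` is `δ`-close to `b₀`, and `δ` is so small in terms of the background
solution that the datum of the transport problem of the corrector and its first derivatives are
controlled, with constants `N` and `L`, along the piston. -/
structure IsSmallPiston (δ N L : ℝ) (b : ℝ → E3 → ℝ) : Prop where
  close : IsPistonClose b₀ δ b
  pos : 0 < b₀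
  nonneg : 0 ≤ δ
  le_one : δ ≤ 1
  le_half_wall : δ ≤ b₀ / 2
  le_half_gap : δ ≤ (bg.s₀ - b₀) / 2
  N_nonneg : 0 ≤ N
  N_mul_le_one : N * δ ≤ 1
  L_nonneg : 0 ≤ L
  differentiable_source : ∀ p : ℝ × E3, 1 ≤ p.1 → p.2 ≠ 0 → DifferentiableAt ℝ (bg.wallSource b) p
  abs_source_le : ∀ p : ℝ × E3, 1 ≤ p.1 → p.2 ≠ 0 → |bg.wallSource b p| ≤ N * δ
  abs_dZ_source_le : ∀ p : ℝ × E3, 1 ≤ p.1 → p.2 ≠ 0 → ∀ k, |dZ k (bg.wallSource b) p| ≤ L * δ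
  abs_dt_source_le : ∀ p : ℝ × E3, 1 ≤ p.1 → p.2 ≠ 0 →
    |p.1 * dt (bg.wallSource b) p| ≤ L * (2 * δ)

theorem exists_isSmallPiston (hb₀ : 0 < b₀) : ∃ δ₁ : ℝ, 0 < δ₁ ∧ ∃ L : ℝ, 0 ≤ L ∧
    ∀ (δ : ℝ) (b : ℝ → E3 → ℝ), 0 ≤ δ → δ ≤ δ₁ → IsPistonClose b₀ δ b →
      bg.IsSmallPiston δ (10 / ((bg.s₀ - b₀) * bg.u bg.s₀)) L b := by
  obtain ⟨d, hd, L, hL, hdatum⟩ := bg.exists_wallDatum_bounds hb₀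
  have hgap : 0 < bg.s₀ - b₀ := sub_pos.2 bg.b₀_lt_s₀
  have hu := bg.u_pos hb₀ bg.shock_mem
  set N := 10 / ((bg.s₀ - b₀) * bg.u bg.s₀)
  have hN : 0 < N := by positivity
  refine ⟨min (min d (b₀ / 2)) (min (min ((bg.s₀ - b₀) / 2) 1) (1 / N)), by positivity, L, hL,
    fun δ b hδ hδ_le hb => ?_⟩
  simp only [le_min_iff, le_div_iff₀ hN] at hδ_le
  obtain ⟨⟨hδd, hδb₀⟩, ⟨hδgap, hδ₁⟩, hδN⟩ := hδ_le
  have hnorm (p : ℝ × E3) (ht : 1 ≤ p.1) (hp : p.2 ≠ 0) :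
      ‖(onRays b p, p.1 * dt (onRays b) p) - (b₀, 0)‖ ≤ δ := by
    rw [Prod.mk_sub_mk, sub_zero]
    exact max_le (hb.speed p ht hp) (hb.time p ht hp)
  have hsource (p : ℝ × E3) (ht : 1 ≤ p.1) (hp : p.2 ≠ 0) :=
    hdatum (onRays b p, p.1 * dt (onRays b) p) ((hnorm p ht hp).trans hδd)
  exact
    { close := hb
      pos := hb₀
      nonneg := hδ
      le_one := hδ₁
      le_half_wall := hδb₀
      le_half_gap := hδgap
      N_nonneg := hN.le
      N_mul_le_one := by linarith
      L_nonneg := hL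
      differentiable_source := fun p ht hp =>
        (bg.hasFDerivAt_wallSource hb ht hp (hsource p ht hp).1).differentiableAt
      abs_source_le := fun p ht hp =>
        (hsource p ht hp).2.2.trans (mul_le_mul_of_nonneg_left (hnorm p ht hp) hN.le)
      abs_dZ_source_le := fun p ht hp =>
        bg.abs_dZ_wallSource_le hb ht hp (hsource p ht hp).1 (hsource p ht hp).2.1
      abs_dt_source_le := fun p ht hp =>
        bg.abs_dt_wallSource_le hb ht hp (hsource p ht hp).1 (hsource p ht hp).2.1 }

end Background

namespace IsCorrector

variable {G : Gas} {b₀ δ : ℝ} {bg : Background G b₀} {b : ℝ → E3 → ℝ} {f : ℝ × E3 → ℝ}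
  {p : ℝ × E3}

theorem fderiv_wallField (hf : IsCorrector bg (pistonPath b) f) (hb : IsPistonClose b₀ δ b)
    (ht : 0 < p.1) (hp : p.2 ≠ 0) (hr : onRays (pistonPath b) p ≤ ‖p.2‖) :
    fderiv ℝ f p (wallField (pistonPath b) p) = p.1⁻¹ * bg.wallSource b p := by
  have htransport := hf.transport p ht hp hr
  have hspeed : onRays (pistonPath b) p / p.1 = onRays b p := by
    rw [onRays_pistonPath, mul_div_cancel_left₀ _ ht.ne']
  rw [wallOp_eq_fderiv, hspeed, hb.dt_path ht hp] at htransport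
  rw [htransport, Background.wallSource, Background.wallDatum]
  simp only [div_eq_mul_inv, mul_inv]
  ring

theorem eventually_fderiv_wallField (hf : IsCorrector bg (pistonPath b) f)
    (hb : IsPistonClose b₀ δ b) (ht : 0 < p.1) (hp : p.2 ≠ 0)
    (hr : onRays (pistonPath b) p < ‖p.2‖) :
    (fun q => fderiv ℝ f q (wallField (pistonPath b) q)) =ᶠ[nhds p]
      fun q => q.1⁻¹ * bg.wallSource b q := by
  have hout : ∀ᶠ q in nhds p, 0 < ‖q.2‖ - onRays (pistonPath b) q :=
    (continuous_snd.continuousAt.norm.sub (hb.contDiffAt_path ht hp).continuousAt).eventually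
      (lt_mem_nhds (sub_pos.2 hr))
  filter_upwards [hout, eventually_pos_and_ne_zero ht hp] with q hq hq_pos
  exact hf.fderiv_wallField hb hq_pos.1 hq_pos.2 (by linarith)

theorem fderiv_apply_wallField (hf : IsCorrector bg (pistonPath b) f)
    (hb : IsPistonClose b₀ δ b) (ht : 0 < p.1) (hp : p.2 ≠ 0)
    (hr : onRays (pistonPath b) p < ‖p.2‖) (hsource : DifferentiableAt ℝ (bg.wallSource b) p)
    {X : ℝ × E3 → ℝ × E3} (hX : DifferentiableAt ℝ X p) :
    fderiv ℝ (fun q => fderiv ℝ f q (X q)) p (wallField (pistonPath b) p) =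
      p.1⁻¹ * fderiv ℝ (bg.wallSource b) p (X p) - (p.1 ^ 2)⁻¹ * (X p).1 * bg.wallSource b p +
        fderiv ℝ f p (fderiv ℝ X p (wallField (pistonPath b) p) -
          fderiv ℝ (wallField (pistonPath b)) p (X p)) := by
  have hW := (contDiffAt_wallField hp
    ((hb.contDiffAt_path ht hp).of_le two_le_infty)).differentiableAt (by norm_num)
  have hprod : HasFDerivAt (fun q : ℝ × E3 => q.1⁻¹ * bg.wallSource b q) _ p :=
    ((hasDerivAt_inv ht.ne').comp_hasFDerivAt p hasFDerivAt_fst).mul hsource.hasFDerivAt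
  rw [fderiv_fderiv_apply_comm ((hf.smooth p ht hp hr.le).of_le two_le_infty) hW hX,
    (hf.eventually_fderiv_wallField hb ht hp hr).fderiv_eq, hprod.fderiv]
  simp only [Function.comp_apply, _root_.add_apply, _root_.smul_apply, smul_eq_mul,
    ContinuousLinearMap.coe_fst']
  ring

theorem fderiv_dZ_wallField (hf : IsCorrector bg (pistonPath b) f)
    (hb : IsPistonClose b₀ δ b) (ht : 0 < p.1) (hp : p.2 ≠ 0)
    (hr : onRays (pistonPath b) p < ‖p.2‖) (hsource : DifferentiableAt ℝ (bg.wallSource b) p)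
    (k : Fin 3) :
    fderiv ℝ (dZ k f) p (wallField (pistonPath b) p) = p.1⁻¹ * dZ k (bg.wallSource b) p +
      ∑ i, (‖p.2‖ ^ 2)⁻¹ * (dZ k (dZ i (onRays (pistonPath b))) p * dZ i f p +
        dZ i (onRays (pistonPath b)) p *
          fderiv ℝ f p (0, rotVec i (rotVec k p.2) - rotVec k (rotVec i p.2))) := by
  have hσ := (hb.contDiffAt_path ht hp).of_le two_le_infty
  have hbracket : fderiv ℝ (rotField k) p (wallField (pistonPath b) p) -
      fderiv ℝ (wallField (pistonPath b)) p (rotField k p) =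
      ∑ i, (‖p.2‖ ^ 2)⁻¹ • (dZ k (dZ i (onRays (pistonPath b))) p • ((0 : ℝ), rotVec i p.2) +
        dZ i (onRays (pistonPath b)) p •
          ((0 : ℝ), rotVec i (rotVec k p.2) - rotVec k (rotVec i p.2))) := by
    have hrot : rotVec k (wallField (pistonPath b) p).2 = ‖p.2‖⁻¹ • rotVec k p.2 -
        ∑ i, ((‖p.2‖ ^ 2)⁻¹ * dZ i (onRays (pistonPath b)) p) • rotVec k (rotVec i p.2) := by
      simp only [← rotL_apply k, wallField, map_sub, map_smul, map_sum]
    rw [ContinuousLinearMap.fderiv, fderiv_wallField_apply hp hσ (inner_rotVec k p.2),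
      rotField_apply, hrot]
    simp only [Fin.sum_univ_three]
    refine Prod.ext (by simp) ?_
    simp only [Prod.mk_sub_mk, Prod.snd_add, Prod.smul_snd, dZ, rotField_apply]
    module
  refine (hf.fderiv_apply_wallField hb ht hp hr hsource (rotField k).differentiableAt).trans ?_
  rw [hbracket]
  simp only [map_sum, map_smul, map_add, smul_eq_mul, rotField_apply, mul_zero, zero_mul, sub_zero]
  rfl

theorem fderiv_dt_wallField (hf : IsCorrector bg (pistonPath b) f)
    (hb : IsPistonClose b₀ δ b) (ht : 0 < p.1) (hp : p.2 ≠ 0)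
    (hr : onRays (pistonPath b) p < ‖p.2‖) (hsource : DifferentiableAt ℝ (bg.wallSource b) p) :
    fderiv ℝ (dt f) p (wallField (pistonPath b) p) =
      p.1⁻¹ * dt (bg.wallSource b) p - (p.1 ^ 2)⁻¹ * bg.wallSource b p +
      ∑ i, (‖p.2‖ ^ 2)⁻¹ * (dt (dZ i (onRays (pistonPath b))) p * dZ i f p) := by
  have hσ := (hb.contDiffAt_path ht hp).of_le two_le_infty
  have hbracket : fderiv ℝ (fun _ : ℝ × E3 => ((1 : ℝ), (0 : E3))) p
      (wallField (pistonPath b) p) - fderiv ℝ (wallField (pistonPath b)) p (1, 0) =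
      ∑ i, (‖p.2‖ ^ 2)⁻¹ •
        (dt (dZ i (onRays (pistonPath b))) p • ((0 : ℝ), rotVec i p.2)) := by
    have rotVec_zero : ∀ i, rotVec i 0 = 0 := fun i => map_zero (rotL i)
    rw [fderiv_wallField_apply hp hσ (by simp)]
    simp only [Fin.sum_univ_three, rotVec_zero, fderiv_fun_const, Pi.zero_apply, _root_.zero_apply]
    refine Prod.ext (by simp) ?_
    simp only [Prod.snd_sub, Prod.snd_zero, Prod.snd_add, Prod.smul_snd, dt]
    module
  refine (hf.fderiv_apply_wallField hb ht hp hr hsource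
    (X := fun _ => ((1 : ℝ), (0 : E3))) (differentiableAt_const _)).trans ?_
  rw [hbracket]
  simp only [map_sum, map_smul, smul_eq_mul, mul_one]
  rfl

theorem eventually_vanishing (hf : IsCorrector bg (pistonPath b) f) (hb : IsPistonClose b₀ δ b)
    (ht : 0 < p.1) (hp : p.2 ≠ 0) (hr : onRays (pistonPath b) p = ‖p.2‖) :
    ∀ᶠ q in nhds p, f (q.1, (onRays (pistonPath b) q * ‖q.2‖⁻¹) • q.2) = 0 := by
  have hpos : ∀ᶠ q in nhds p, 0 < onRays (pistonPath b) q :=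
    (hb.contDiffAt_path ht hp).continuousAt.eventually
      (lt_mem_nhds (by rw [hr]; exact norm_pos_iff.2 hp))
  filter_upwards [hpos, eventually_pos_and_ne_zero ht hp] with q hσq ⟨hq₁, hq₂⟩
  have hnorm : 0 < ‖q.2‖ := norm_pos_iff.2 hq₂
  refine hf.wall _ hq₁ (smul_ne_zero (by positivity) hq₂) ?_
  rw [onRays_smul _ _ _ (by positivity)]
  simp only [norm_smul, norm_mul, norm_inv, Real.norm_eq_abs, abs_of_pos hσq, abs_norm]
  exact (inv_mul_cancel_right₀ hnorm.ne' _).symm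

theorem wall_derivatives (hf : IsCorrector bg (pistonPath b) f) (hb : IsPistonClose b₀ δ b)
    (ht : 0 < p.1) (hp : p.2 ≠ 0) (hr : onRays (pistonPath b) p = ‖p.2‖) :
    dt f p = -(dt (onRays (pistonPath b)) p * dr f p) ∧
      ∀ k, dZ k f p = -(dZ k (onRays (pistonPath b)) p * dr f p) := by
  obtain ⟨htime, hrot⟩ := tangential_derivatives hp
    ((hb.contDiffAt_path ht hp).differentiableAt (by simp))
    ((hf.smooth p ht hp hr.le).differentiableAt (by simp)) hr (hf.eventually_vanishing hb ht hp hr)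
  exact ⟨by linarith, fun k => by linarith [hrot k]⟩

theorem abs_dr_wall_le (hf : IsCorrector bg (pistonPath b) f) (hb : IsPistonClose b₀ δ b)
    (ht : 0 < p.1) (hp : p.2 ≠ 0) (hr : onRays (pistonPath b) p = ‖p.2‖) :
    |dr f p| ≤ p.1⁻¹ * |bg.wallSource b p| := by
  set m := 1 / ‖p.2‖ ^ 2 * ∑ i, dZ i (onRays (pistonPath b)) p ^ 2
  have hm : 0 ≤ m := mul_nonneg (by positivity) (Finset.sum_nonneg fun _ _ => sq_nonneg _)
  have hfactor : dr f p * (1 + m) = p.1⁻¹ * bg.wallSource b p := by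
    rw [← hf.fderiv_wallField hb ht hp hr.le, ← wallOp_eq_fderiv, wallOp]
    simp only [(hf.wall_derivatives hb ht hp hr).2, m, Fin.sum_univ_three]
    ring
  calc |dr f p| ≤ |dr f p| * |1 + m| :=
        le_mul_of_one_le_right (abs_nonneg _) (by rw [abs_of_nonneg] <;> linarith)
    _ = p.1⁻¹ * |bg.wallSource b p| := by
        rw [← abs_mul, hfactor, abs_mul, abs_of_pos (inv_pos.2 ht)]

end IsCorrector

namespace Background

variable {G : Gas} {b₀ : ℝ} (bg : Background G b₀)

/-- The part of the exterior of the piston on which the corrector is estimated: it extends beyond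
the background shock `|x| = s₀ t` by half of the distance from the piston to the shock. -/
def shockLayer (b : ℝ → E3 → ℝ) : Set (ℝ × E3) :=
  {p | 1 ≤ p.1 ∧ p.2 ≠ 0 ∧ onRays (pistonPath b) p ≤ ‖p.2‖ ∧
    ‖p.2‖ ≤ p.1 * (bg.s₀ + (bg.s₀ - b₀) / 2)}

namespace IsSmallPiston

variable {δ N L : ℝ} {bg : Background G b₀} {b : ℝ → E3 → ℝ} (hb : bg.IsSmallPiston δ N L b)
  {p : ℝ × E3}
include hb

theorem le_path (ht : 1 ≤ p.1) (hp : p.2 ≠ 0) :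
    p.1 * (b₀ / 2) ≤ onRays (pistonPath b) p := by
  rw [onRays_pistonPath]
  exact mul_le_mul_of_nonneg_left
    (by linarith [(abs_le.1 (hb.close.speed p ht hp)).1, hb.le_half_wall]) (by linarith)

theorem inv_sq_norm_le (hp : p ∈ bg.shockLayer b) :
    (‖p.2‖ ^ 2)⁻¹ ≤ 4 / b₀ ^ 2 / p.1 ^ 2 := by
  obtain ⟨ht, hp₂, hr, -⟩ := hp
  have hb₀ := hb.pos
  have : 0 < p.1 := one_pos.trans_le ht
  calc (‖p.2‖ ^ 2)⁻¹ ≤ ((p.1 * (b₀ / 2)) ^ 2)⁻¹ := by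
        gcongr
        exact (hb.le_path ht hp₂).trans hr
    _ = 4 / b₀ ^ 2 / p.1 ^ 2 := by
        field_simp
        norm_num

theorem le_of_fderiv_wallField_le {F : ℝ × E3 → ℝ} {κ B : ℝ} (hκ : 0 ≤ κ)
    (hF : ∀ q ∈ bg.shockLayer b, DifferentiableAt ℝ F q)
    (hin : ∀ q ∈ bg.shockLayer b, onRays (pistonPath b) q < ‖q.2‖ →
      fderiv ℝ F q (wallField (pistonPath b) q) ≤ κ / q.1)
    (hwall : ∀ q ∈ bg.shockLayer b, onRays (pistonPath b) q = ‖q.2‖ → F q ≤ B)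
    (hp : p ∈ bg.shockLayer b) : F p ≤ B + 2 * κ * (bg.s₀ - b₀) := by
  obtain ⟨t, x⟩ := p
  obtain ⟨ht, hx, hσx, hxR⟩ := hp
  dsimp only at ht hx hσx hxR
  have ht₀ : 0 < t := one_pos.trans_le ht
  have hb₀ := hb.pos
  have hlayer (y : E3) (hy : y ≠ 0) (hσy : onRays (pistonPath b) (t, y) ≤ ‖y‖)
      (hyx : ‖y‖ ≤ ‖x‖) : (t, y) ∈ bg.shockLayer b := ⟨ht, hy, hσy, hyx.trans hxR⟩
  refine (_root_.le_of_fderiv_wallField_le (c := t * (b₀ / 2)) (R := ‖x‖) (B := B) (κ := κ / t)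
    (by positivity) (fun y hy => hb.le_path (p := (t, y)) ht hy)
    (fun y hy => (hb.close.contDiffAt_path (p := (t, y)) ht₀ hy).differentiableAt (by simp))
    (fun y hy hσy hyx => hF _ (hlayer y hy hσy hyx))
    (fun y hy hσy hyx => hin _ (hlayer y hy hσy.le hyx) hσy)
    (fun y hy hσy hyx => hwall _ (hlayer y hy hσy.le hyx) hσy)
    (by positivity) hx hσx le_rfl).trans (add_le_add_right ?_ B)
  have hwidth : ‖x‖ - onRays (pistonPath b) (t, x) ≤ t * (2 * (bg.s₀ - b₀)) := by
    have hspeed := (abs_le.1 (hb.close.speed (t, x) ht hx)).1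
    have : t * (b₀ - (bg.s₀ - b₀) / 2) ≤ t * onRays b (t, x) :=
      mul_le_mul_of_nonneg_left (by linarith [hb.le_half_gap]) ht₀.le
    rw [onRays_pistonPath]
    linarith
  calc κ / t * (‖x‖ - onRays (pistonPath b) (t, x)) ≤ κ / t * (t * (2 * (bg.s₀ - b₀))) :=
        mul_le_mul_of_nonneg_left hwidth (by positivity)
    _ = 2 * κ * (bg.s₀ - b₀) := by field_simp

theorem abs_le_of_abs_fderiv_wallField_le {F : ℝ × E3 → ℝ} {κ B : ℝ} (hκ : 0 ≤ κ)
    (hF : ∀ q ∈ bg.shockLayer b, DifferentiableAt ℝ F q)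
    (hin : ∀ q ∈ bg.shockLayer b, onRays (pistonPath b) q < ‖q.2‖ →
      |fderiv ℝ F q (wallField (pistonPath b) q)| ≤ κ / q.1)
    (hwall : ∀ q ∈ bg.shockLayer b, onRays (pistonPath b) q = ‖q.2‖ → |F q| ≤ B)
    (hp : p ∈ bg.shockLayer b) : |F p| ≤ B + 2 * κ * (bg.s₀ - b₀) := by
  refine abs_le'.2 ⟨hb.le_of_fderiv_wallField_le hκ hF
    (fun q hq hσq => (le_abs_self _).trans (hin q hq hσq))
    (fun q hq hσq => (le_abs_self _).trans (hwall q hq hσq)) hp,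
    hb.le_of_fderiv_wallField_le (F := fun q => -F q) hκ (fun q hq => (hF q hq).neg)
    (fun q hq hσq => ?_) (fun q hq hσq => (neg_le_abs _).trans (hwall q hq hσq)) hp⟩
  rw [fderiv_fun_neg]
  exact (neg_le_abs _).trans (hin q hq hσq)

end IsSmallPiston

end Background

namespace IsCorrector

variable {G : Gas} {b₀ δ N L : ℝ} {bg : Background G b₀} {b : ℝ → E3 → ℝ} {f : ℝ × E3 → ℝ}
  {p : ℝ × E3}

theorem abs_value_le (hf : IsCorrector bg (pistonPath b) f) (hb : bg.IsSmallPiston δ N L b)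
    (hp : p ∈ bg.shockLayer b) : |f p| ≤ 2 * (N * δ) * (bg.s₀ - b₀) := by
  have hNδ := mul_nonneg hb.N_nonneg hb.nonneg
  rw [← zero_add (2 * (N * δ) * _)]
  refine hb.abs_le_of_abs_fderiv_wallField_le hNδ (fun q ⟨ht, hq, hr, _⟩ => ?_)
    (fun q ⟨ht, hq, hr, _⟩ _ => ?_) (fun q ⟨ht, hq, _⟩ hr => ?_) hp
  · exact (hf.smooth q (one_pos.trans_le ht) hq hr).differentiableAt (by simp)
  · have ht₀ : 0 < q.1 := one_pos.trans_le ht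
    rw [hf.fderiv_wallField hb.close ht₀ hq hr, abs_mul, abs_of_pos (inv_pos.2 ht₀), inv_mul_eq_div]
    exact div_le_div_of_nonneg_right (hb.abs_source_le q ht hq) ht₀.le
  · rw [hf.wall q (one_pos.trans_le ht) hq hr, abs_zero]

theorem abs_fderiv_dZ_wallField_le (hf : IsCorrector bg (pistonPath b) f)
    (hb : bg.IsSmallPiston δ N L b) (hp : p ∈ bg.shockLayer b)
    (hr : onRays (pistonPath b) p < ‖p.2‖) (k : Fin 3) :
    |p.1 * fderiv ℝ (dZ k f) p (wallField (pistonPath b) p)| ≤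
      L + 16 / b₀ ^ 2 * ∑ j, |dZ j f p| := by
  have hinv := hb.inv_sq_norm_le hp
  obtain ⟨ht, hp₂, -, -⟩ := hp
  have ht₀ : 0 < p.1 := one_pos.trans_le ht
  have hδ := hb.nonneg
  have hδ₁ := hb.le_one
  have hL := hb.L_nonneg
  have hb₀ := hb.pos
  set S := ∑ j, |dZ j f p|
  have : 0 ≤ S := Finset.sum_nonneg fun _ _ => abs_nonneg _
  have hterm (i : Fin 3) : |(‖p.2‖ ^ 2)⁻¹ * (dZ k (dZ i (onRays (pistonPath b))) p * dZ i f p +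
      dZ i (onRays (pistonPath b)) p *
        fderiv ℝ f p (0, rotVec i (rotVec k p.2) - rotVec k (rotVec i p.2)))| ≤
      4 / b₀ ^ 2 / p.1 ^ 2 * (p.1 * δ * |dZ i f p| + p.1 * δ * S) := by
    rw [abs_mul, abs_of_nonneg (by positivity : 0 ≤ (‖p.2‖ ^ 2)⁻¹)]
    refine mul_le_mul hinv ((abs_add_le _ _).trans ?_) (abs_nonneg _) (by positivity)
    rw [abs_mul, abs_mul]
    exact add_le_add
      (mul_le_mul_of_nonneg_right (hb.close.abs_dZ_dZ_path_le ht hp₂ i k) (abs_nonneg _))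
      (mul_le_mul (hb.close.abs_dZ_path_le ht hp₂ i) (abs_fderiv_commutator_le f p i k)
        (abs_nonneg _) (by positivity))
  have hsum :=
    (Finset.abs_sum_le_sum_abs _ Finset.univ).trans (Finset.sum_le_sum fun i _ => hterm i)
  have hsource := hb.abs_dZ_source_le p ht hp₂ k
  rw [hf.fderiv_dZ_wallField hb.close ht₀ hp₂ hr (hb.differentiable_source p ht hp₂), mul_add,
    mul_inv_cancel_left₀ ht₀.ne']
  calc _ ≤ L * δ + p.1 * ∑ i, 4 / b₀ ^ 2 / p.1 ^ 2 * (p.1 * δ * |dZ i f p| + p.1 * δ * S) := by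
        refine (abs_add_le _ _).trans (add_le_add hsource ?_)
        rw [abs_mul, abs_of_pos ht₀]
        exact mul_le_mul_of_nonneg_left hsum ht₀.le
    _ = (L + 16 / b₀ ^ 2 * S) * δ := by
        simp only [S, Fin.sum_univ_three]
        field_simp
        ring
    _ ≤ L + 16 / b₀ ^ 2 * S := mul_le_of_le_one_right (by positivity) hδ₁

theorem abs_dZ_wall_le_one (hf : IsCorrector bg (pistonPath b) f)
    (hb : bg.IsSmallPiston δ N L b) (ht : 1 ≤ p.1) (hp : p.2 ≠ 0)
    (hr : onRays (pistonPath b) p = ‖p.2‖) (k : Fin 3) : |dZ k f p| ≤ 1 := by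
  have ht₀ : 0 < p.1 := one_pos.trans_le ht
  have hsource := hb.abs_source_le p ht hp
  have hδ := hb.nonneg
  rw [(hf.wall_derivatives hb.close ht₀ hp hr).2 k, abs_neg, abs_mul]
  calc _ ≤ p.1 * δ * (p.1⁻¹ * (N * δ)) :=
        mul_le_mul (hb.close.abs_dZ_path_le ht hp k) ((hf.abs_dr_wall_le hb.close ht₀ hp hr).trans
          (mul_le_mul_of_nonneg_left hsource (by positivity))) (abs_nonneg _) (by positivity)
    _ = δ * (N * δ) := by field_simp
    _ ≤ 1 := mul_le_one₀ hb.le_one ((abs_nonneg _).trans hsource) hb.N_mul_le_one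

end IsCorrector

theorem two_mul_sum_mul_le {z v : Fin 3 → ℝ} {L c : ℝ} (hL : 0 ≤ L) (hc : 0 ≤ c)
    (hv : ∀ k, |v k| ≤ L + c * ∑ j, |z j|) :
    ∑ k, 2 * z k * v k ≤ (4 * L + 6 * c) * (1 + ∑ k, z k ^ 2) := by
  set S := ∑ j, |z j| with hS
  have hsq : S ^ 2 ≤ 3 * ∑ k, z k ^ 2 := by
    simpa using sq_sum_le_card_mul_sum_sq (s := Finset.univ) (f := fun j => |z j|)
  have hlin : S ≤ 2 * (1 + ∑ k, z k ^ 2) := by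
    nlinarith [sq_nonneg (S - 1), Finset.sum_nonneg fun k (_ : k ∈ Finset.univ) => sq_nonneg (z k)]
  calc ∑ k, 2 * z k * v k ≤ ∑ k, 2 * |z k| * (L + c * S) := by
        refine Finset.sum_le_sum fun k _ => (le_abs_self _).trans ?_
        rw [abs_mul, abs_mul, abs_two]
        exact mul_le_mul_of_nonneg_left (hv k) (by positivity)
    _ = 2 * L * S + 2 * c * S ^ 2 := by
        rw [← Finset.sum_mul, ← Finset.mul_sum, ← hS]
        ring
    _ ≤ 2 * L * (2 * (1 + ∑ k, z k ^ 2)) + 2 * c * (3 * (1 + ∑ k, z k ^ 2)) := by gcongr; linarith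
    _ = (4 * L + 6 * c) * (1 + ∑ k, z k ^ 2) := by ring

theorem hasFDerivAt_log_one_add_sum_sq {E ι : Type*} [NormedAddCommGroup E] [NormedSpace ℝ E]
    [Fintype ι] {g : ι → E → ℝ} {p : E} (hg : ∀ k, DifferentiableAt ℝ (g k) p) :
    HasFDerivAt (fun q => Real.log (1 + ∑ k, g k q ^ 2))
      ((1 + ∑ k, g k p ^ 2)⁻¹ • ∑ k, (2 * g k p) • fderiv ℝ (g k) p) p := by
  have hsum : HasFDerivAt (fun q => 1 + ∑ k, g k q ^ 2)
      (∑ k, (2 * g k p) • fderiv ℝ (g k) p) p := by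
    refine (HasFDerivAt.fun_sum fun k _ => ?_).const_add 1
    exact ((hg k).hasFDerivAt.pow 2).congr_fderiv (by simp)
  exact hsum.log (add_pos_of_pos_of_nonneg one_pos
    (Finset.sum_nonneg fun _ _ => sq_nonneg _)).ne'

namespace IsCorrector

variable {G : Gas} {b₀ δ N L : ℝ} {bg : Background G b₀} {b : ℝ → E3 → ℝ} {f : ℝ × E3 → ℝ}
  {p : ℝ × E3}

theorem differentiableAt_dZ (hf : IsCorrector bg (pistonPath b) f) (hp : p ∈ bg.shockLayer b)
    (k : Fin 3) : DifferentiableAt ℝ (dZ k f) p := by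
  obtain ⟨ht, hp₂, hr, -⟩ := hp
  exact (contDiffAt_dZ (n := 1) ((hf.smooth p (one_pos.trans_le ht) hp₂ hr).of_le two_le_infty)
    (by norm_num) k).differentiableAt (by norm_num)

theorem differentiableAt_dt (hf : IsCorrector bg (pistonPath b) f) (hp : p ∈ bg.shockLayer b) :
    DifferentiableAt ℝ (dt f) p := by
  obtain ⟨ht, hp₂, hr, -⟩ := hp
  exact (contDiffAt_dt (n := 1) ((hf.smooth p (one_pos.trans_le ht) hp₂ hr).of_le two_le_infty)
    (by norm_num)).differentiableAt (by norm_num)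

theorem log_one_add_sum_sq_dZ_le (hf : IsCorrector bg (pistonPath b) f)
    (hb : bg.IsSmallPiston δ N L b) (hp : p ∈ bg.shockLayer b) :
    Real.log (1 + ∑ k, dZ k f p ^ 2) ≤
      Real.log 4 + 2 * (4 * L + 6 * (16 / b₀ ^ 2)) * (bg.s₀ - b₀) := by
  have hL := hb.L_nonneg
  have hderiv (q : ℝ × E3) (hq : q ∈ bg.shockLayer b) :=
    hasFDerivAt_log_one_add_sum_sq fun k => hf.differentiableAt_dZ hq k
  have hsum_nonneg (q : ℝ × E3) : 0 ≤ ∑ k, dZ k f q ^ 2 :=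
    Finset.sum_nonneg fun _ _ => sq_nonneg _
  refine hb.le_of_fderiv_wallField_le (F := fun q => Real.log (1 + ∑ k, dZ k f q ^ 2))
    (by positivity) (fun q hq => (hderiv q hq).differentiableAt) (fun q hq hr => ?_)
    (fun q ⟨ht, hq, _⟩ hr => ?_) hp
  · have ht₀ : 0 < q.1 := one_pos.trans_le hq.1
    rw [(hderiv q hq).fderiv, _root_.smul_apply, smul_eq_mul,
      inv_mul_le_iff₀ (by linarith [hsum_nonneg q]), ← mul_div_assoc, le_div_iff₀ ht₀]
    simp only [_root_.sum_apply, _root_.smul_apply, smul_eq_mul]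
    refine (le_of_eq ?_).trans ((two_mul_sum_mul_le hL (by positivity)
      (hf.abs_fderiv_dZ_wallField_le hb hq hr)).trans_eq (mul_comm _ _))
    rw [Finset.sum_mul]
    exact Finset.sum_congr rfl fun k _ => by ring
  · refine Real.log_le_log (by linarith [hsum_nonneg q]) ?_
    have hone : ∑ k, dZ k f q ^ 2 ≤ ∑ _k : Fin 3, (1 : ℝ) :=
      Finset.sum_le_sum fun k _ =>
        (sq_le_one_iff_abs_le_one _).2 (hf.abs_dZ_wall_le_one hb ht hq hr k)
    rw [Finset.sum_const, Finset.card_univ, Fintype.card_fin, nsmul_one] at hone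
    norm_num at hone
    linarith

theorem abs_dZ_le (hf : IsCorrector bg (pistonPath b) f) (hb : bg.IsSmallPiston δ N L b)
    (hp : p ∈ bg.shockLayer b) (k : Fin 3) :
    |dZ k f p| ≤ Real.exp (Real.log 4 + 2 * (4 * L + 6 * (16 / b₀ ^ 2)) * (bg.s₀ - b₀)) := by
  have hsingle : dZ k f p ^ 2 ≤ ∑ k, dZ k f p ^ 2 :=
    Finset.single_le_sum (f := fun k => dZ k f p ^ 2) (fun _ _ => sq_nonneg _) (Finset.mem_univ k)
  have hpos : 0 < 1 + ∑ k, dZ k f p ^ 2 := by linarith [sq_nonneg (dZ k f p)]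
  calc |dZ k f p| ≤ 1 + ∑ k, dZ k f p ^ 2 := by
        nlinarith [sq_nonneg (|dZ k f p| - 1), sq_abs (dZ k f p)]
    _ = Real.exp (Real.log (1 + ∑ k, dZ k f p ^ 2)) := (Real.exp_log hpos).symm
    _ ≤ _ := Real.exp_le_exp.2 (hf.log_one_add_sum_sq_dZ_le hb hp)

theorem abs_fderiv_dt_wallField_le (hf : IsCorrector bg (pistonPath b) f)
    (hb : bg.IsSmallPiston δ N L b) (hp : p ∈ bg.shockLayer b)
    (hr : onRays (pistonPath b) p < ‖p.2‖) {A : ℝ} (hA : ∀ k, |dZ k f p| ≤ A) :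
    |p.1 * fderiv ℝ (dt f) p (wallField (pistonPath b) p)| ≤
      (2 * L + N + 24 / b₀ ^ 2 * A) * δ / p.1 := by
  have hinv := hb.inv_sq_norm_le hp
  obtain ⟨ht, hp₂, -, -⟩ := hp
  have ht₀ : 0 < p.1 := one_pos.trans_le ht
  have hδ := hb.nonneg
  have hb₀ := hb.pos
  have hterm (i : Fin 3) : |(‖p.2‖ ^ 2)⁻¹ * (dt (dZ i (onRays (pistonPath b))) p * dZ i f p)| ≤
      4 / b₀ ^ 2 / p.1 ^ 2 * (2 * δ * A) := by
    rw [abs_mul, abs_of_nonneg (by positivity : 0 ≤ (‖p.2‖ ^ 2)⁻¹), abs_mul]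
    exact mul_le_mul hinv (mul_le_mul (hb.close.abs_dt_dZ_path_le ht hp₂ i) (hA i) (abs_nonneg _)
      (by positivity)) (by positivity) (by positivity)
  have hsum :=
    (Finset.abs_sum_le_sum_abs _ Finset.univ).trans (Finset.sum_le_sum fun i _ => hterm i)
  have hsource := hb.abs_dt_source_le p ht hp₂
  have hvalue := hb.abs_source_le p ht hp₂
  set drag := ∑ i, (‖p.2‖ ^ 2)⁻¹ * (dt (dZ i (onRays (pistonPath b))) p * dZ i f p)
  have hsplit : p.1 * (p.1⁻¹ * dt (bg.wallSource b) p - (p.1 ^ 2)⁻¹ * bg.wallSource b p + drag) =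
      (p.1 * dt (bg.wallSource b) p - bg.wallSource b p + p.1 ^ 2 * drag) / p.1 := by
    field_simp
  rw [hf.fderiv_dt_wallField hb.close ht₀ hp₂ hr (hb.differentiable_source p ht hp₂), hsplit,
    abs_div, abs_of_pos ht₀]
  refine div_le_div_of_nonneg_right ?_ ht₀.le
  calc |p.1 * dt (bg.wallSource b) p - bg.wallSource b p + p.1 ^ 2 * drag|
      ≤ |p.1 * dt (bg.wallSource b) p| + |bg.wallSource b p| + |p.1 ^ 2 * drag| :=
        (abs_add_le _ _).trans (add_le_add_left (abs_sub _ _) _)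
    _ ≤ L * (2 * δ) + N * δ + p.1 ^ 2 * ∑ _i : Fin 3, 4 / b₀ ^ 2 / p.1 ^ 2 * (2 * δ * A) := by
        rw [abs_mul (p.1 ^ 2), abs_of_pos (by positivity : 0 < p.1 ^ 2)]
        gcongr
    _ = (2 * L + N + 24 / b₀ ^ 2 * A) * δ := by
        rw [Finset.sum_const, Finset.card_univ, Fintype.card_fin, nsmul_eq_mul]
        field_simp
        ring

theorem abs_dt_wall_le (hf : IsCorrector bg (pistonPath b) f) (hb : bg.IsSmallPiston δ N L b)
    (ht : 1 ≤ p.1) (hp : p.2 ≠ 0) (hr : onRays (pistonPath b) p = ‖p.2‖) :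
    |p.1 * dt f p| ≤ 2 * b₀ * N * δ := by
  have ht₀ : 0 < p.1 := one_pos.trans_le ht
  have hb₀ := hb.pos
  have hspeed : |dt (onRays (pistonPath b)) p| ≤ 2 * b₀ := by
    have := hb.close.abs_dt_path_le ht hp
    rw [abs_of_pos hb₀] at this
    linarith [hb.le_half_wall]
  rw [(hf.wall_derivatives hb.close ht₀ hp hr).1, abs_mul, abs_neg, abs_mul, abs_of_pos ht₀]
  calc _ ≤ p.1 * ((2 * b₀) * (p.1⁻¹ * (N * δ))) :=
        mul_le_mul_of_nonneg_left (mul_le_mul hspeed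
          ((hf.abs_dr_wall_le hb.close ht₀ hp hr).trans (mul_le_mul_of_nonneg_left
            (hb.abs_source_le p ht hp) (by positivity))) (abs_nonneg _) (by positivity)) ht₀.le
    _ = 2 * b₀ * N * δ := by field_simp

theorem abs_dt_le (hf : IsCorrector bg (pistonPath b) f) (hb : bg.IsSmallPiston δ N L b) {A : ℝ}
    (hA : ∀ q ∈ bg.shockLayer b, ∀ k, |dZ k f q| ≤ A) (hp : p ∈ bg.shockLayer b) :
    |p.1 * dt f p| ≤
      2 * b₀ * N * δ + 2 * ((2 * L + N + 24 / b₀ ^ 2 * A) * δ) * (bg.s₀ - b₀) := by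
  have hA₀ : 0 ≤ A := (abs_nonneg _).trans (hA p hp 0)
  have hκ : 0 ≤ (2 * L + N + 24 / b₀ ^ 2 * A) * δ := by
    have := hb.L_nonneg
    have := hb.N_nonneg
    have := hb.nonneg
    positivity
  have hderiv (q : ℝ × E3) (hq : q ∈ bg.shockLayer b) :
      HasFDerivAt (fun q : ℝ × E3 => q.1 * dt f q) _ q :=
    hasFDerivAt_fst.mul (hf.differentiableAt_dt hq).hasFDerivAt
  refine hb.abs_le_of_abs_fderiv_wallField_le (F := fun q => q.1 * dt f q) hκ
    (fun q hq => (hderiv q hq).differentiableAt) (fun q hq hr => ?_)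
    (fun q ⟨ht, hq, _⟩ hr => hf.abs_dt_wall_le hb ht hq hr) hp
  rw [(hderiv q hq).fderiv]
  simpa [wallField] using hf.abs_fderiv_dt_wallField_le hb hq hr (hA q hq)

theorem abs_dr_le (hf : IsCorrector bg (pistonPath b) f) (hb : bg.IsSmallPiston δ N L b)
    (hp : p ∈ bg.shockLayer b) {A : ℝ} (hA : ∀ k, |dZ k f p| ≤ A) :
    |p.1 * dr f p| ≤ (N + 12 / b₀ ^ 2 * A) * δ := by
  have hinv := hb.inv_sq_norm_le hp
  obtain ⟨ht, hp₂, hr, -⟩ := hp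
  have ht₀ : 0 < p.1 := one_pos.trans_le ht
  have hδ := hb.nonneg
  have hb₀ := hb.pos
  have htransport := hf.fderiv_wallField hb.close ht₀ hp₂ hr
  rw [← wallOp_eq_fderiv, wallOp] at htransport
  have hdr : p.1 * dr f p = bg.wallSource b p +
      p.1 * ((‖p.2‖ ^ 2)⁻¹ * ∑ i, dZ i (onRays (pistonPath b)) p * dZ i f p) := by
    rw [← mul_inv_cancel_left₀ ht₀.ne' (bg.wallSource b p), ← htransport, one_div]
    ring
  have hsum : |∑ i, dZ i (onRays (pistonPath b)) p * dZ i f p| ≤ 3 * (p.1 * δ * A) := by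
    refine (Finset.abs_sum_le_sum_abs _ _).trans ((Finset.sum_le_sum fun i _ => ?_).trans
      (le_of_eq (by simp : ∑ _ : Fin 3, p.1 * δ * A = 3 * (p.1 * δ * A))))
    rw [abs_mul]
    exact mul_le_mul (hb.close.abs_dZ_path_le ht hp₂ i) (hA i) (abs_nonneg _) (by positivity)
  rw [hdr]
  calc _ ≤ N * δ + p.1 * (4 / b₀ ^ 2 / p.1 ^ 2 * (3 * (p.1 * δ * A))) := by
        refine (abs_add_le _ _).trans (add_le_add (hb.abs_source_le p ht hp₂) ?_)
        rw [abs_mul, abs_mul, abs_of_pos ht₀, abs_of_nonneg (by positivity : 0 ≤ (‖p.2‖ ^ 2)⁻¹)]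
        exact mul_le_mul_of_nonneg_left (mul_le_mul hinv hsum (abs_nonneg _) (by positivity))
          ht₀.le
    _ = (N + 12 / b₀ ^ 2 * A) * δ := by
        field_simp
        ring

end IsCorrector

theorem exists_corrector_bounds {G : Gas} {b₀ : ℝ} (bg : Background G b₀) (hb₀ : 0 < b₀) :
    ∃ δ₁ : ℝ, 0 < δ₁ ∧ ∃ L : ℝ, 0 < L ∧ ∀ (δ : ℝ) (b : ℝ → E3 → ℝ) (f : ℝ × E3 → ℝ),
      0 ≤ δ → δ ≤ δ₁ → IsPistonClose b₀ δ b → IsCorrector bg (pistonPath b) f →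
      ∀ p ∈ bg.shockLayer b, |f p| ≤ 20 / bg.u bg.s₀ * δ ∧ |p.1 * dt f p| ≤ L * δ ∧
        (∀ k, |dZ k f p| ≤ L) ∧ |p.1 * dr f p| ≤ L * δ := by
  obtain ⟨δ₁, hδ₁, L, hL, hsmall⟩ := bg.exists_isSmallPiston hb₀
  have hu := bg.u_pos hb₀ bg.shock_mem
  have hgap : 0 < bg.s₀ - b₀ := sub_pos.2 bg.b₀_lt_s₀
  set N := 10 / ((bg.s₀ - b₀) * bg.u bg.s₀) with hN
  have : 0 < N := by positivity
  set A := Real.exp (Real.log 4 + 2 * (4 * L + 6 * (16 / b₀ ^ 2)) * (bg.s₀ - b₀))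
  have hA₀ : 0 < A := Real.exp_pos _
  set Lt := 2 * b₀ * N + 2 * (2 * L + N + 24 / b₀ ^ 2 * A) * (bg.s₀ - b₀)
  set Lr := N + 12 / b₀ ^ 2 * A
  have hLt : 0 < Lt := by positivity
  have hLr : 0 < Lr := by positivity
  refine ⟨δ₁, hδ₁, Lt + A + Lr, by positivity, fun δ b f hδ hδ_le hclose hf p hp => ?_⟩
  have hb := hsmall δ b hδ hδ_le hclose
  have hA (q : ℝ × E3) (hq : q ∈ bg.shockLayer b) (k : Fin 3) : |dZ k f q| ≤ A :=
    hf.abs_dZ_le hb hq k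
  refine ⟨(hf.abs_value_le hb hp).trans_eq ?_, (hf.abs_dt_le hb hA hp).trans ?_,
    fun k => (hA p hp k).trans (by linarith), (hf.abs_dr_le hb hp (hA p hp)).trans ?_⟩
  · rw [hN]
    field_simp
    ring
  · calc _ = Lt * δ := by ring
      _ ≤ (Lt + A + Lr) * δ := mul_le_mul_of_nonneg_right (by linarith) hδ
  · exact mul_le_mul_of_nonneg_right (by linarith) hδ

/-! ### The linearized shock polar -/

theorem exists_forall_norm_sub_le_of_hasFDerivAt {E F : Type*} [NormedAddCommGroup E]
    [NormedSpace ℝ E] [NormedAddCommGroup F] [NormedSpace ℝ F] {f : E → F} {f' : E →L[ℝ] F}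
    {x : E} (hf : HasFDerivAt f f' x) {η : ℝ} (hη : 0 < η) :
    ∃ d, 0 < d ∧ ∀ v, ‖v‖ ≤ d → ‖f (x + v) - f x - f' v‖ ≤ η * ‖v‖ := by
  obtain ⟨d, hd, hball⟩ := Metric.eventually_nhds_iff_ball.1 (hf.isLittleO.bound hη)
  refine ⟨d / 2, half_pos hd, fun v hv => ?_⟩
  have h := hball (x + v) (by rw [mem_ball_iff_norm, add_sub_cancel_left]; linarith)
  rwa [add_sub_cancel_left] at h

theorem norm_prod_triple_le (a v m : ℝ) : ‖(a, v, m)‖ ≤ |a| + |v| + |m| := by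
  simp only [Prod.norm_def, Real.norm_eq_abs]
  refine max_le ?_ (max_le ?_ ?_) <;> linarith [abs_nonneg a, abs_nonneg v, abs_nonneg m]

theorem abs_add_mul_le_of_abs_add_mul_add_le {η η' κ c x D ξ E e e' : ℝ} (hη' : 0 ≤ η')
    (hκ : 0 ≤ κ) (hη : η' ≤ η) (hc : η' * |c| ≤ η / 2)
    (hE : (η' + κ) * |E| ≤ η / 2 * |ξ| + e')
    (hx : |x + κ * (D - c * ξ + E)| ≤ η' * |D - c * ξ + E| + e) :
    |x + κ * (D - c * ξ)| ≤ η * (|D| + |ξ|) + e + e' := by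
  calc |x + κ * (D - c * ξ)| = |(x + κ * (D - c * ξ + E)) - κ * E| := by ring_nf
    _ ≤ η' * (|D| + |c| * |ξ| + |E|) + e + κ * |E| := by
        refine (abs_sub _ _).trans ?_
        rw [abs_mul κ, abs_of_nonneg hκ, ← abs_mul]
        gcongr
        exact hx.trans (add_le_add_left (mul_le_mul_of_nonneg_left
          ((abs_add_le _ _).trans (add_le_add_left (abs_sub _ _) _)) hη') e)
    _ = η' * |D| + η' * |c| * |ξ| + (η' + κ) * |E| + e := by ring
    _ ≤ η * |D| + η / 2 * |ξ| + (η / 2 * |ξ| + e') + e := by gcongr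
    _ = η * (|D| + |ξ|) + e + e' := by ring

/-- The defect of the Rankine-Hugoniot condition at `(a, v, m) = (∂_t Φ, ∂_r Φ, r⁻² ∑ (Z_k Φ)²)`.
On the shock `Φ` vanishes, which eliminates the derivatives of `ζ` from that condition. -/
noncomputable def Gas.jump (G : Gas) (z : ℝ × ℝ × ℝ) : ℝ :=
  G.enthalpyInv (G.enthalpy G.ρ₀ - z.1 - (z.2.1 ^ 2 + z.2.2) / 2) * (z.2.1 ^ 2 + z.2.2 + z.1) -
    G.ρ₀ * z.1

namespace Background

variable {G : Gas} {b₀ : ℝ} (bg : Background G b₀)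

/-- The values of `(∂_t Φ̂, ∂_r Φ̂, r⁻² ∑ (Z_k Φ̂)²)` on the shock of the background solution. -/
def shockState : ℝ × ℝ × ℝ := (-(bg.s₀ * bg.u bg.s₀), bg.u bg.s₀, 0)

theorem enthalpy_shockState :
    G.enthalpy G.ρ₀ - bg.shockState.1 - (bg.shockState.2.1 ^ 2 + bg.shockState.2.2) / 2 =
      G.enthalpy (bg.ρ bg.s₀) := by
  rw [bg.enthalpy_shock, shockState]; ring

theorem enthalpyInv_shockState :
    G.enthalpyInv (G.enthalpy G.ρ₀ - bg.shockState.1 -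
      (bg.shockState.2.1 ^ 2 + bg.shockState.2.2) / 2) = bg.ρ bg.s₀ := by
  rw [bg.enthalpy_shockState, G.enthalpyInv_enthalpy bg.ρ_shock_pos]

theorem jump_shockState : G.jump bg.shockState = 0 := by
  rw [Gas.jump, bg.enthalpyInv_shockState, shockState]
  linear_combination -bg.u bg.s₀ * bg.rh_mass

theorem exists_hasFDerivAt_jump : ∃ (F' : ℝ × ℝ × ℝ →L[ℝ] ℝ) (B₃ : ℝ),
    HasFDerivAt G.jump F' bg.shockState ∧
    ∀ a v m, F' (a, v, m) = bg.B₂ * a + bg.B₁ * v + B₃ * m := by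
  have ha : HasFDerivAt (fun z : ℝ × ℝ × ℝ => z.1)
      (ContinuousLinearMap.fst ℝ ℝ (ℝ × ℝ)) bg.shockState := hasFDerivAt_fst
  have hv : HasFDerivAt (fun z : ℝ × ℝ × ℝ => z.2.1)
      ((ContinuousLinearMap.fst ℝ ℝ ℝ).comp (ContinuousLinearMap.snd ℝ ℝ (ℝ × ℝ)))
      bg.shockState := hasFDerivAt_snd.fst
  have hm : HasFDerivAt (fun z : ℝ × ℝ × ℝ => z.2.2)
      ((ContinuousLinearMap.snd ℝ ℝ ℝ).comp (ContinuousLinearMap.snd ℝ ℝ (ℝ × ℝ)))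
      bg.shockState := hasFDerivAt_snd.snd
  have hspeed := (hv.pow 2).add hm
  have henthalpy : HasFDerivAt
      (fun z : ℝ × ℝ × ℝ => G.enthalpy G.ρ₀ - z.1 - (z.2.1 ^ 2 + z.2.2) / 2) _
      bg.shockState := (ha.const_sub _).sub (hspeed.mul_const 2⁻¹)
  have hinv := G.hasDerivAt_enthalpyInv bg.ρ_shock_pos
  rw [← bg.enthalpy_shockState] at hinv
  have hdensity := hinv.comp_hasFDerivAt bg.shockState henthalpy
  have hjump : HasFDerivAt G.jump _ bg.shockState :=
    ((hdensity.mul (hspeed.add ha)).sub (ha.const_mul G.ρ₀)).congr_of_eventuallyEq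
      (Filter.Eventually.of_forall fun _ => rfl)
  refine ⟨_, bg.ρ bg.s₀ - bg.ρ bg.s₀ / G.soundSq (bg.ρ bg.s₀) *
    (bg.u bg.s₀ ^ 2 - bg.s₀ * bg.u bg.s₀) / 2, hjump, fun a v m => ?_⟩
  have hQ : bg.u bg.s₀ ^ 2 / 2 - G.enthalpy (bg.ρ bg.s₀) + G.enthalpy G.ρ₀ =
      bg.u bg.s₀ ^ 2 - bg.s₀ * bg.u bg.s₀ := by rw [bg.enthalpy_shock]; ring
  simp only [Function.comp_apply, bg.enthalpyInv_shockState]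
  simp [shockState, B₁, B₂, hQ]
  ring

theorem exists_shockPolar_radial (hb : 0 < b₀) : ∃ d, 0 < d ∧ ∃ k, 0 ≤ k ∧ ∀ a v m : ℝ,
    ‖(a, v, m)‖ ≤ d → G.jump (bg.shockState + (a, v, m)) = 0 → |v| ≤ k * (|a| + |m|) := by
  obtain ⟨F', B₃, hF, hF'⟩ := bg.exists_hasFDerivAt_jump
  have hB₁ := bg.B₁_pos hb
  obtain ⟨d, hd, hjump⟩ := exists_forall_norm_sub_le_of_hasFDerivAt hF (half_pos hB₁)
  refine ⟨d, hd, 2 / bg.B₁ * (|bg.B₂| + |B₃| + bg.B₁), by positivity, fun a v m hz hJ => ?_⟩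
  have hlin : |bg.B₂ * a + bg.B₁ * v + B₃ * m| ≤ bg.B₁ / 2 * (|a| + |v| + |m|) := by
    have h := hjump _ hz
    rw [hJ, bg.jump_shockState, hF', sub_zero, zero_sub, norm_neg, Real.norm_eq_abs] at h
    exact h.trans (mul_le_mul_of_nonneg_left (norm_prod_triple_le a v m) (half_pos hB₁).le)
  have hB₁v : bg.B₁ * |v| ≤ bg.B₁ / 2 * (|a| + |v| + |m|) + |bg.B₂| * |a| + |B₃| * |m| := by
    calc bg.B₁ * |v|
        = |(bg.B₂ * a + bg.B₁ * v + B₃ * m) - (bg.B₂ * a + B₃ * m)| := by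
          rw [← abs_of_pos hB₁, ← abs_mul, abs_of_pos hB₁]; ring_nf
      _ ≤ |bg.B₂ * a + bg.B₁ * v + B₃ * m| + (|bg.B₂ * a| + |B₃ * m|) :=
          (abs_sub _ _).trans (add_le_add_right (abs_add_le _ _) _)
      _ ≤ _ := by rw [abs_mul, abs_mul]; linarith
  rw [div_mul_eq_mul_div, div_mul_eq_mul_div, le_div_iff₀ hB₁]
  nlinarith [mul_nonneg (abs_nonneg bg.B₂) (abs_nonneg m),
    mul_nonneg (abs_nonneg B₃) (abs_nonneg a), mul_nonneg hB₁.le (abs_nonneg m),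
    mul_nonneg hB₁.le (abs_nonneg a)]

theorem exists_shockPolar_linearization (hb : 0 < b₀) : ∃ C, 0 ≤ C ∧ ∀ η : ℝ, 0 < η →
    ∃ d, 0 < d ∧ ∀ a v m : ℝ, ‖(a, v, m)‖ ≤ d → G.jump (bg.shockState + (a, v, m)) = 0 →
      |-(a - bg.s₀ * bg.u bg.s₀) / (v + bg.u bg.s₀) - bg.s₀ + bg.polarCoeff / bg.u bg.s₀ * a| ≤
        η * ‖(a, v, m)‖ + C * |m| := by
  obtain ⟨F', B₃, hF, hF'⟩ := bg.exists_hasFDerivAt_jump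
  have hB₁ := bg.B₁_pos hb
  have hu := bg.u_pos hb bg.shock_mem
  have hs := bg.s₀_pos hb
  have hinv : HasFDerivAt (fun z : ℝ × ℝ × ℝ => z.2.1⁻¹) _ bg.shockState :=
    (hasDerivAt_inv hu.ne').comp_hasFDerivAt bg.shockState
      (f := fun z : ℝ × ℝ × ℝ => z.2.1) (hasFDerivAt_snd (𝕜 := ℝ) (p := bg.shockState)).fst
  have hquot : HasFDerivAt (fun z : ℝ × ℝ × ℝ => -z.1 * z.2.1⁻¹) _ bg.shockState :=
    hasFDerivAt_fst.neg.mul hinv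
  -- The multiplier `l` is chosen so that `-a / v + l * jump` is stationary in `v`.
  set l := bg.s₀ / (bg.u bg.s₀ * bg.B₁) with hl
  refine ⟨l * |B₃|, by positivity, fun η hη => ?_⟩
  obtain ⟨d, hd, hspeed⟩ := exists_forall_norm_sub_le_of_hasFDerivAt
    (hquot.add (hF.const_mul l)) hη
  refine ⟨d, hd, fun a v m hz hJ => ?_⟩
  have h := hspeed (a, v, m) hz
  simp only [Pi.add_apply, hJ, bg.jump_shockState] at h
  simp only [shockState, Prod.mk_add_mk, add_apply, smul_apply,
    ContinuousLinearMap.comp_apply, neg_apply, ContinuousLinearMap.coe_fst',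
    ContinuousLinearMap.coe_snd', smul_eq_mul, hF', Real.norm_eq_abs, mul_zero, add_zero,
    neg_neg] at h
  have hdecomp :
      -(a - bg.s₀ * bg.u bg.s₀) / (v + bg.u bg.s₀) - bg.s₀ + bg.polarCoeff / bg.u bg.s₀ * a =
      (-(-(bg.s₀ * bg.u bg.s₀) + a) * (bg.u bg.s₀ + v)⁻¹ -
        bg.s₀ * bg.u bg.s₀ * (bg.u bg.s₀)⁻¹ -
        (bg.s₀ * bg.u bg.s₀ * (-(bg.u bg.s₀ ^ 2)⁻¹ * v) + (bg.u bg.s₀)⁻¹ * -a +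
          l * (bg.B₂ * a + bg.B₁ * v + B₃ * m))) + l * B₃ * m := by
    rw [hl, polarCoeff, add_comm v]
    field_simp
    ring
  rw [hdecomp, ← abs_of_pos (by positivity : 0 < l), ← abs_mul, ← abs_mul,
    abs_of_pos (by positivity : 0 < l)]
  exact (abs_add_le _ _).trans (add_le_add_left h _)

theorem exists_shockPolar_speed (hb : 0 < b₀) {η : ℝ} (hη : 0 < η) :
    ∃ d, 0 < d ∧ ∃ C, 0 ≤ C ∧ ∀ a v m : ℝ, |a + bg.s₀ * bg.u bg.s₀| ≤ d →
      |v - bg.u bg.s₀| ≤ d → |m| ≤ d → G.jump (a, v, m) = 0 → 0 < v ∧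
      |-a / v - bg.s₀ + bg.polarCoeff / bg.u bg.s₀ * (a + bg.s₀ * bg.u bg.s₀)| ≤
        η * |a + bg.s₀ * bg.u bg.s₀| + C * |m| := by
  obtain ⟨d₁, hd₁, k, hk, hradial⟩ := bg.exists_shockPolar_radial hb
  obtain ⟨C, hC, hlinearization⟩ := bg.exists_shockPolar_linearization hb
  obtain ⟨d₂, hd₂, hspeed⟩ := hlinearization (η / (1 + k)) (by positivity)
  have hu := bg.u_pos hb bg.shock_mem
  refine ⟨min (min d₁ d₂) (bg.u bg.s₀ / 2), by positivity, C + η, by positivity,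
    fun a v m ha hv hm hJ => ?_⟩
  simp only [le_min_iff] at ha hv hm
  refine ⟨by linarith [(abs_le.1 hv.2).1], ?_⟩
  have hz : (a, v, m) = bg.shockState + (a + bg.s₀ * bg.u bg.s₀, v - bg.u bg.s₀, m) := by
    simp [shockState]
  rw [hz] at hJ
  have hv_le := hradial _ _ m (max_le ha.1.1 (max_le hv.1.1 hm.1.1)) hJ
  have h := hspeed _ _ m (max_le ha.1.2 (max_le hv.1.2 hm.1.2)) hJ
  rw [add_sub_cancel_right, sub_add_cancel] at h
  have hnorm : ‖(a + bg.s₀ * bg.u bg.s₀, v - bg.u bg.s₀, m)‖ ≤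
      (1 + k) * (|a + bg.s₀ * bg.u bg.s₀| + |m|) :=
    (norm_prod_triple_le _ _ m).trans (by linarith)
  calc _ ≤ η / (1 + k) * ((1 + k) * (|a + bg.s₀ * bg.u bg.s₀| + |m|)) + C * |m| :=
        h.trans (add_le_add_left (mul_le_mul_of_nonneg_left hnorm (by positivity)) _)
    _ = η * |a + bg.s₀ * bg.u bg.s₀| + (C + η) * |m| := by
        field_simp
        ring

theorem exists_abs_profile_le {c : ℝ} (hb : 0 < b₀) (hc : bg.u bg.s₀ < c) :
    ∃ d, 0 < d ∧ ∀ ξ, |ξ| ≤ d → |bg.profile (bg.s₀ + ξ)| ≤ c * |ξ| := by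
  have hu := bg.u_pos hb bg.shock_mem
  obtain ⟨d, hd, hexp⟩ := exists_forall_norm_sub_le_of_hasFDerivAt
    (bg.hasDerivAt_profile bg.shock_mem_domain).hasFDerivAt (sub_pos.2 hc)
  refine ⟨d, hd, fun ξ hξ => ?_⟩
  have hexpξ : |bg.profile (bg.s₀ + ξ) - ξ * bg.u bg.s₀| ≤ (c - bg.u bg.s₀) * |ξ| := by
    simpa [bg.profile_shock] using hexp ξ hξ
  calc |bg.profile (bg.s₀ + ξ)|
      ≤ |bg.profile (bg.s₀ + ξ) - ξ * bg.u bg.s₀| + |ξ * bg.u bg.s₀| := by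
        simpa using abs_add_le (bg.profile (bg.s₀ + ξ) - ξ * bg.u bg.s₀) (ξ * bg.u bg.s₀)
    _ ≤ (c - bg.u bg.s₀) * |ξ| + |ξ| * bg.u bg.s₀ := by
        rw [abs_mul, abs_of_pos hu]; gcongr
    _ = c * |ξ| := by ring

theorem hasDerivAt_profile_sub_mul_u :
    HasDerivAt (fun s => bg.profile s - s * bg.u s) (-(bg.s₀ * bg.shockSlope)) bg.s₀ := by
  refine ((bg.hasDerivAt_profile bg.shock_mem_domain).sub
    ((hasDerivAt_id bg.s₀).mul bg.hasDerivAt_u_shock)).congr_deriv ?_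
  rw [id_eq]
  ring

/-- The value of `∂_t Φ_a` at `r = (s₀ + ξ) t`, for the values `f` and `ft` of `f_a` and
`t ∂_t f_a`. -/
noncomputable def modifiedTime (ξ f ft : ℝ) : ℝ :=
  (1 + f) * (bg.profile (bg.s₀ + ξ) - (bg.s₀ + ξ) * bg.u (bg.s₀ + ξ)) +
    ft * bg.profile (bg.s₀ + ξ)

/-- The value of `∂_r Φ_a` at `r = (s₀ + ξ) t`, for the values `f` and `fr` of `f_a` and
`t ∂_r f_a`. -/
noncomputable def modifiedRadial (ξ f fr : ℝ) : ℝ :=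
  (1 + f) * bg.u (bg.s₀ + ξ) + fr * bg.profile (bg.s₀ + ξ)

theorem exists_modifiedTime_expansion (hb : 0 < b₀) {η : ℝ} (hη : 0 < η) :
    ∃ d, 0 < d ∧ ∀ ξ f ft, |ξ| ≤ d → |ft| ≤ d →
      |bg.modifiedTime ξ f ft + bg.s₀ * bg.u bg.s₀ + bg.s₀ * bg.shockSlope * ξ| ≤
        η * |ξ| + 2 * (bg.s₀ * bg.u bg.s₀) * |f| := by
  have hu := bg.u_pos hb bg.shock_mem
  have hsu : 0 < bg.s₀ * bg.u bg.s₀ := mul_pos (bg.s₀_pos hb) hu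
  have hderiv := bg.hasDerivAt_profile_sub_mul_u
  obtain ⟨d₁, hd₁, hexp⟩ :=
    exists_forall_norm_sub_le_of_hasFDerivAt hderiv.hasFDerivAt (half_pos hη)
  obtain ⟨d₂, hd₂, hprofile⟩ := bg.exists_abs_profile_le hb (lt_add_one _)
  obtain ⟨d₃, hd₃, hclose⟩ := Metric.continuousAt_iff.1 hderiv.continuousAt _ hsu
  refine ⟨min (min d₁ d₂) (min (d₃ / 2) (η / 2 / (bg.u bg.s₀ + 1))), by positivity,
    fun ξ f ft hξ hft => ?_⟩
  simp only [le_min_iff] at hξ hft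
  set P := bg.profile (bg.s₀ + ξ)
  set g := P - (bg.s₀ + ξ) * bg.u (bg.s₀ + ξ) with hg
  have hgexp : |g + bg.s₀ * bg.u bg.s₀ + bg.s₀ * bg.shockSlope * ξ| ≤ η / 2 * |ξ| := by
    convert hexp ξ hξ.1.1 using 1
    · rw [bg.profile_shock, hg, ContinuousLinearMap.toSpanSingleton_apply, smul_eq_mul,
        Real.norm_eq_abs]
      congr 1
      ring
    · rw [Real.norm_eq_abs]
  have hgle : |g| ≤ 2 * (bg.s₀ * bg.u bg.s₀) := by
    have h : |g + bg.s₀ * bg.u bg.s₀| < bg.s₀ * bg.u bg.s₀ := by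
      have := hclose (x := bg.s₀ + ξ) (by
        rw [Real.dist_eq, add_sub_cancel_left]; linarith [hξ.2.1])
      rwa [Real.dist_eq, bg.profile_shock, zero_sub, sub_neg_eq_add] at this
    rw [abs_lt] at h
    exact abs_le.2 ⟨by linarith, by linarith⟩
  have hftP : |ft| * |P| ≤ η / 2 * |ξ| := by
    calc |ft| * |P| ≤ η / 2 / (bg.u bg.s₀ + 1) * ((bg.u bg.s₀ + 1) * |ξ|) :=
          mul_le_mul hft.2.2 (hprofile ξ hξ.1.2) (abs_nonneg _) (by positivity)
      _ = η / 2 * |ξ| := by field_simp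
  calc |bg.modifiedTime ξ f ft + bg.s₀ * bg.u bg.s₀ + bg.s₀ * bg.shockSlope * ξ|
      = |(g + bg.s₀ * bg.u bg.s₀ + bg.s₀ * bg.shockSlope * ξ) + f * g + ft * P| := by
        congr 1
        rw [modifiedTime]
        ring
    _ ≤ η / 2 * |ξ| + |f| * (2 * (bg.s₀ * bg.u bg.s₀)) + η / 2 * |ξ| := by
        refine (abs_add_three _ _ _).trans ?_
        rw [abs_mul, abs_mul]
        gcongr
    _ = _ := by ring

theorem exists_modified_close {η : ℝ} (hη : 0 < η) :
    ∃ d, 0 < d ∧ ∀ ξ f ft fr, |ξ| ≤ d → |f| ≤ d → |ft| ≤ d → |fr| ≤ d →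
      |bg.modifiedTime ξ f ft + bg.s₀ * bg.u bg.s₀| ≤ η ∧
        |bg.modifiedRadial ξ f fr - bg.u bg.s₀| ≤ η := by
  have hshift : ContinuousAt (fun z : ℝ × ℝ × ℝ => bg.s₀ + z.1) 0 := by fun_prop
  have hprofile : ContinuousAt (fun z : ℝ × ℝ × ℝ => bg.profile (bg.s₀ + z.1)) 0 :=
    (bg.hasDerivAt_profile bg.shock_mem_domain).continuousAt.comp_of_eq hshift (by simp)
  have hu : ContinuousAt (fun z : ℝ × ℝ × ℝ => bg.u (bg.s₀ + z.1)) 0 :=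
    bg.hasDerivAt_u_shock.continuousAt.comp_of_eq hshift (by simp)
  have htime : ContinuousAt (fun z : ℝ × ℝ × ℝ => bg.modifiedTime z.1 z.2.1 z.2.2) 0 := by
    unfold modifiedTime
    fun_prop
  have hradial : ContinuousAt (fun z : ℝ × ℝ × ℝ => bg.modifiedRadial z.1 z.2.1 z.2.2) 0 := by
    unfold modifiedRadial
    fun_prop
  obtain ⟨d₁, hd₁, hball₁⟩ := Metric.continuousAt_iff.1 htime η hη
  obtain ⟨d₂, hd₂, hball₂⟩ := Metric.continuousAt_iff.1 hradial η hη
  refine ⟨min d₁ d₂ / 2, by positivity, fun ξ f ft fr hξ hf hft hfr => ?_⟩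
  have hsmall : ∀ {c : ℝ}, |c| ≤ min d₁ d₂ / 2 → dist (ξ, f, c) 0 < min d₁ d₂ := fun hc => by
    rw [dist_zero_right]
    exact (max_le hξ (max_le hf hc)).trans_lt (half_lt_self (lt_min hd₁ hd₂))
  have h₁ := hball₁ ((hsmall hft).trans_le (min_le_left _ _))
  have h₂ := hball₂ ((hsmall hfr).trans_le (min_le_right _ _))
  simp only [Real.dist_eq] at h₁ h₂
  simp only [modifiedTime, modifiedRadial, Prod.fst_zero, Prod.snd_zero, add_zero,
    bg.profile_shock, mul_zero, zero_sub, one_mul, sub_neg_eq_add] at h₁ h₂ ⊢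
  exact ⟨h₁.le, h₂.le⟩

theorem exists_perturbedShockSpeed (hb : 0 < b₀)
    (hκ : bg.polarCoeff ∈ Icc (1 / 4 : ℝ) (1 / 2)) {η : ℝ} (hη : 0 < η) :
    ∃ d, 0 < d ∧ ∃ C, 0 ≤ C ∧ ∀ ξ f ft fr D R m, |ξ| ≤ d → |f| ≤ d → |ft| ≤ d → |fr| ≤ d →
      |D| ≤ d → |R| ≤ d → |m| ≤ d → ∀ a v, a = D + bg.modifiedTime ξ f ft →
      v = R + bg.modifiedRadial ξ f fr → G.jump (a, v, m) = 0 → 0 < v ∧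
        |-a / v - bg.s₀ + bg.polarCoeff / bg.u bg.s₀ * (D - bg.s₀ * bg.shockSlope * ξ)| ≤
          η * (|D| + |ξ|) + C * |m| + 3 * bg.s₀ * |f| := by
  have hu := bg.u_pos hb bg.shock_mem
  set u := bg.u bg.s₀
  set s₁ := bg.s₀ * bg.shockSlope
  set ηa := min η (min (η / 2 / (|s₁| + 1)) (1 / u))
  have hηa : 0 < ηa := by positivity
  obtain ⟨d₁, hd₁, C, hC, hspeed⟩ := bg.exists_shockPolar_speed hb hηa
  obtain ⟨d₂, hd₂, htime⟩ := bg.exists_modifiedTime_expansion hb (by positivity : 0 < η * u / 3)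
  obtain ⟨d₃, hd₃, hclose⟩ := bg.exists_modified_close (half_pos hd₁)
  refine ⟨min (min d₂ d₃) (d₁ / 2), by positivity, C, hC,
    fun ξ f ft fr D R m hξ hf hft hfr hD hR hm a v ha hv hJ => ?_⟩
  simp only [le_min_iff] at hξ hf hft hfr hD hR hm
  obtain ⟨hT, hV⟩ := hclose ξ f ft fr hξ.1.2 hf.1.2 hft.1.2 hfr.1.2
  have ha_small : |a + bg.s₀ * u| ≤ d₁ := by
    rw [ha, add_assoc]
    exact (abs_add_le _ _).trans ((add_le_add hD.2 hT).trans_eq (add_halves d₁))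
  have hv_small : |v - u| ≤ d₁ := by
    rw [hv, add_sub_assoc]
    exact (abs_add_le _ _).trans ((add_le_add hR.2 hV).trans_eq (add_halves d₁))
  obtain ⟨hv_pos, hmain⟩ := hspeed a v m ha_small hv_small (by linarith [hm.2]) hJ
  refine ⟨hv_pos, ?_⟩
  set E := bg.modifiedTime ξ f ft + bg.s₀ * u + s₁ * ξ
  have ha_eq : a + bg.s₀ * u = D - s₁ * ξ + E := by rw [ha]; ring
  have hηa_s₁ : ηa * |s₁| ≤ η / 2 := by
    have : ηa ≤ η / 2 / (|s₁| + 1) := (min_le_right _ _).trans (min_le_left _ _)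
    rw [le_div_iff₀ (by positivity)] at this
    linarith
  have hE : (ηa + bg.polarCoeff / u) * |E| ≤ η / 2 * |ξ| + 3 * bg.s₀ * |f| := by
    calc (ηa + bg.polarCoeff / u) * |E|
        ≤ (1 / u + 1 / 2 / u) * (η * u / 3 * |ξ| + 2 * (bg.s₀ * u) * |f|) := by
          gcongr
          exacts [(min_le_right _ _).trans (min_le_right _ _), hκ.2, htime ξ f ft hξ.1.1 hft.1.1]
      _ = η / 2 * |ξ| + 3 * bg.s₀ * |f| := by field_simp; ring
  exact abs_add_mul_le_of_abs_add_mul_add_le hηa.le (div_nonneg (by linarith [hκ.1]) hu.le)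
    (min_le_left _ _) hηa_s₁ hE (ha_eq ▸ hmain)

theorem fderiv_modifiedPotential {f : ℝ × E3 → ℝ} {p : ℝ × E3} {ξ : ℝ} (ht : 0 < p.1)
    (hp : p.2 ≠ 0) (hξ : ‖p.2‖ / p.1 = bg.s₀ + ξ)
    (hs : bg.s₀ + ξ ∈ Ioo (b₀ - bg.τ) (bg.s₀ + bg.τ)) (hf : DifferentiableAt ℝ f p) :
    dt (modifiedPotential bg f) p = bg.modifiedTime ξ (f p) (p.1 * dt f p) ∧
    dr (modifiedPotential bg f) p = bg.modifiedRadial ξ (f p) (p.1 * dr f p) ∧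
    ∀ k, dZ k (modifiedPotential bg f) p = p.1 * dZ k f p * bg.profile (bg.s₀ + ξ) := by
  have hr : ‖p.2‖ = p.1 * (bg.s₀ + ξ) := by rw [← hξ]; field_simp
  have hn : ‖p.2‖ ≠ 0 := norm_ne_zero_iff.2 hp
  have hinv : HasFDerivAt (fun q : ℝ × E3 => q.1⁻¹) _ p :=
    HasFDerivAt.comp (g := Inv.inv) p (hasDerivAt_inv ht.ne').hasFDerivAt hasFDerivAt_fst
  have hratio : HasFDerivAt (fun q : ℝ × E3 => ‖q.2‖ * q.1⁻¹) _ p :=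
    ((hasFDerivAt_norm_of_ne_zero hp).comp p hasFDerivAt_snd).mul hinv
  have hprofile : HasFDerivAt (fun q : ℝ × E3 => bg.profile (‖q.2‖ * q.1⁻¹)) _ p :=
    HasDerivAt.comp_hasFDerivAt (h₂ := bg.profile) p
      (by rw [← div_eq_mul_inv, hξ]; exact bg.hasDerivAt_profile hs) hratio
  have hpotential : bg.potential p = p.1 * bg.profile (bg.s₀ + ξ) := by rw [potential, hξ]
  have hmodified : HasFDerivAt (modifiedPotential bg f) _ p :=
    (hf.hasFDerivAt.const_add 1).mul (hasFDerivAt_fst.mul hprofile)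
  refine ⟨?_, ?_, fun k => ?_⟩
  · rw [dt, dt, hmodified.fderiv, modifiedTime]
    simp [← div_eq_mul_inv, hr, hpotential]
    field_simp
    ring
  · rw [dr, dr, hmodified.fderiv, modifiedRadial]
    simp [← div_eq_mul_inv, hξ, hpotential]
    field_simp
  · rw [dZ, dZ, hmodified.fderiv]
    simp [inner_rotVec, hpotential]
    ring

theorem contDiffAt_modifiedPotential {f : ℝ × E3 → ℝ} {p : ℝ × E3} (ht : 0 < p.1)
    (hp : p.2 ≠ 0) (hs : ‖p.2‖ / p.1 ∈ Ioo (b₀ - bg.τ) (bg.s₀ + bg.τ))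
    (hf : ContDiffAt ℝ 1 f p) : ContDiffAt ℝ 1 (modifiedPotential bg f) p := by
  have hratio : ContDiffAt ℝ 1 (fun q : ℝ × E3 => ‖q.2‖ / q.1) p :=
    (contDiffAt_snd.norm ℝ hp).div contDiffAt_fst ht.ne'
  exact (contDiffAt_const.add hf).mul
    (contDiffAt_fst.mul (ContDiffAt.comp (g := bg.profile) p (bg.contDiffAt_profile hs) hratio))

end Background

/-! ### The linearized shock evolution -/

/-- The shock surface `1 ≤ t ≤ T`, `r = ζ(t, ω)`, as a set of points of space-time. -/
def shockSurface (ζ : ℝ → E3 → ℝ) (T : ℝ) : Set (ℝ × E3) :=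
  {p | p.1 ∈ Icc 1 T ∧ p.2 ≠ 0 ∧ ‖p.2‖ = onRays ζ p}

/-- The angular part `r⁻² ∑ (Z_k f)²` of `|∇_x f|²`. -/
noncomputable def angularSq (f : ℝ × E3 → ℝ) (p : ℝ × E3) : ℝ :=
  1 / ‖p.2‖ ^ 2 * ∑ k, dZ k f p ^ 2

/-- The part of `IsShockSolution` that lives on the shock: `r = ζ(t, ω)` is a `C¹` surface outside
`r = σ(t, ω)` on which `Φ` is `C¹`, vanishes and satisfies the Rankine-Hugoniot condition. -/
structure IsShockFront (G : Gas) (σ : ℝ → E3 → ℝ) (T : ℝ) (ζ : ℝ → E3 → ℝ)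
    (Φ : ℝ × E3 → ℝ) : Prop where
  ahead : ∀ p : ℝ × E3, p.1 ∈ Icc 1 T → p.2 ≠ 0 → onRays σ p ≤ onRays ζ p
  regular_ζ : ∀ p : ℝ × E3, p.1 ∈ Icc 1 T → p.2 ≠ 0 → ContDiffAt ℝ 1 (onRays ζ) p
  regular_Φ : ∀ p ∈ shockSurface ζ T, ContDiffAt ℝ 1 Φ p
  rankineHugoniot : ∀ p ∈ shockSurface ζ T,
    G.density Φ p * dr Φ p - (G.density Φ p - G.ρ₀) * dt (onRays ζ) p
      = 1 / ‖p.2‖ ^ 2 * G.density Φ p * ∑ i, dZ i (onRays ζ) p * dZ i Φ p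
  continuity : ∀ p ∈ shockSurface ζ T, Φ p = 0

section ShockSurface

variable {G : Gas} {σ ζ : ℝ → E3 → ℝ} {T : ℝ} {Φ : ℝ × E3 → ℝ} {p : ℝ × E3}

theorem angularSq_nonneg (f : ℝ × E3 → ℝ) (p : ℝ × E3) : 0 ≤ angularSq f p :=
  mul_nonneg (by positivity) (Finset.sum_nonneg fun _ _ => sq_nonneg _)

theorem onRays_smul_of_norm_eq_one (g : ℝ → E3 → ℝ) (t : ℝ) {y : E3} {c : ℝ} (hy : ‖y‖ = 1)
    (hc : 0 < c) : onRays g (t, c • y) = g t y := by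
  rw [onRays_smul g t y hc]
  simp [onRays, hy]

theorem smul_mem_shockSurface {t : ℝ} {y : E3} (ht : t ∈ Icc 1 T) (hy : ‖y‖ = 1)
    (hζ : 0 < ζ t y) : (t, ζ t y • y) ∈ shockSurface ζ T := by
  have hnorm : ‖ζ t y • y‖ = ζ t y := by rw [norm_smul, hy, mul_one, Real.norm_of_nonneg hζ.le]
  refine ⟨ht, norm_pos_iff.1 (hnorm.symm ▸ hζ), ?_⟩
  rw [onRays_smul_of_norm_eq_one ζ t hy hζ, hnorm]

theorem onRays_le_of_ahead (hahead : ∀ t ∈ Icc 1 T, ∀ y : E3, ‖y‖ = 1 → σ t y < ζ t y)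
    (ht : p.1 ∈ Icc 1 T) (hp : p.2 ≠ 0) : onRays σ p ≤ onRays ζ p :=
  (hahead p.1 ht _ (norm_smul_inv_norm (𝕜 := ℝ) hp)).le

theorem IsShockSolution.isShockFront (hsol : IsShockSolution G σ T ζ Φ) :
    IsShockFront G σ T ζ Φ := by
  have hdomain (q : ℝ × E3) (hq : q ∈ shockSurface ζ T) : q ∈ shockDomain σ ζ T :=
    ⟨hq.1, hq.2.1, (onRays_le_of_ahead hsol.ahead hq.1 hq.2.1).trans_eq hq.2.2.symm, hq.2.2.le⟩
  exact {
    ahead := fun _ ht hp => onRays_le_of_ahead hsol.ahead ht hp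
    regular_ζ := fun q ht hq => (hsol.regular_ζ q ht hq).of_le one_le_two
    regular_Φ := fun q hq => (hsol.regular_Φ q (hdomain q hq)).of_le one_le_two
    rankineHugoniot := fun q hq => hsol.rankineHugoniot q (hdomain q hq) hq.2.2
    continuity := fun q hq => hsol.continuity q (hdomain q hq) hq.2.2 }

namespace IsShockFront

theorem onRays_le_norm (hfront : IsShockFront G σ T ζ Φ) (hp : p ∈ shockSurface ζ T) :
    onRays σ p ≤ ‖p.2‖ :=
  (hfront.ahead p hp.1 hp.2.1).trans_eq hp.2.2.symm

theorem eventually_eq_zero (hfront : IsShockFront G σ T ζ Φ) (hp : p ∈ shockSurface ζ T)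
    (ht : p.1 ∈ Ioo 1 T) : ∀ᶠ q in nhds p, Φ (q.1, (onRays ζ q * ‖q.2‖⁻¹) • q.2) = 0 := by
  have hζ : 0 < onRays ζ p := hp.2.2 ▸ norm_pos_iff.2 hp.2.1
  filter_upwards [continuousAt_fst.eventually (isOpen_Ioo.mem_nhds ht),
    continuousAt_snd.eventually_ne hp.2.1,
    (hfront.regular_ζ p hp.1 hp.2.1).continuousAt.eventually_const_lt hζ] with q hq hq₂ hζq
  rw [mul_smul]
  exact hfront.continuity _ (smul_mem_shockSurface (ζ := ζ) (Ioo_subset_Icc_self hq)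
    (norm_smul_inv_norm (𝕜 := ℝ) hq₂) hζq)

theorem jump_eq_zero (hfront : IsShockFront G σ T ζ Φ) (hp : p ∈ shockSurface ζ T)
    (ht : p.1 ∈ Ioo 1 T) : G.jump (dt Φ p, dr Φ p, angularSq Φ p) = 0 ∧
      dt Φ p + dt (onRays ζ) p * dr Φ p = 0 := by
  obtain ⟨htime, hangular⟩ := tangential_derivatives hp.2.1
    ((hfront.regular_ζ p hp.1 hp.2.1).differentiableAt one_ne_zero)
    ((hfront.regular_Φ p hp).differentiableAt one_ne_zero) hp.2.2.symm
    (hfront.eventually_eq_zero hp ht)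
  refine ⟨?_, htime⟩
  have hdensity : G.density Φ p =
      G.enthalpyInv (G.enthalpy G.ρ₀ - dt Φ p - (dr Φ p ^ 2 + angularSq Φ p) / 2) := by
    rw [Gas.density, sum_dx_sq Φ hp.2.1, angularSq]
  have hsum : (∑ i, dZ i (onRays ζ) p * dZ i Φ p) * dr Φ p = -∑ k, dZ k Φ p ^ 2 := by
    rw [Finset.sum_mul, ← Finset.sum_neg_distrib]
    exact Finset.sum_congr rfl fun k _ => by linear_combination dZ k Φ p * hangular k
  simp only [Gas.jump]
  rw [← hdensity, angularSq]
  linear_combination dr Φ p * hfront.rankineHugoniot p hp +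
    (G.density Φ p - G.ρ₀) * htime + 1 / ‖p.2‖ ^ 2 * G.density Φ p * hsum

end IsShockFront

theorem abs_dt_le_norm_fderiv (f : ℝ × E3 → ℝ) (p : ℝ × E3) : |dt f p| ≤ ‖fderiv ℝ f p‖ :=
  (fderiv ℝ f p).unit_le_opNorm _ (by simp [Prod.norm_def])

theorem abs_dr_le_norm_fderiv (f : ℝ × E3 → ℝ) (p : ℝ × E3) : |dr f p| ≤ ‖fderiv ℝ f p‖ :=
  (fderiv ℝ f p).unit_le_opNorm _
    (by simpa [Prod.norm_def, norm_smul] using inv_mul_le_one (a := ‖p.2‖))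

theorem abs_dZ_le_norm_fderiv (f : ℝ × E3 → ℝ) (p : ℝ × E3) (k : Fin 3) :
    |dZ k f p| ≤ ‖fderiv ℝ f p‖ * ‖p.2‖ :=
  (fderiv ℝ f p).le_of_opNorm_le_of_le le_rfl
    (by simpa [Prod.norm_def] using norm_rotVec_le k p.2)

theorem angularSq_le_norm_fderiv (f : ℝ × E3 → ℝ) (hp : p.2 ≠ 0) :
    angularSq f p ≤ 3 * ‖fderiv ℝ f p‖ ^ 2 := by
  have : 0 < ‖p.2‖ := norm_pos_iff.2 hp
  calc angularSq f p
      ≤ 1 / ‖p.2‖ ^ 2 * ∑ _k : Fin 3, (‖fderiv ℝ f p‖ * ‖p.2‖) ^ 2 := by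
        refine mul_le_mul_of_nonneg_left (Finset.sum_le_sum fun k _ => ?_) (by positivity)
        exact sq_le_sq' (neg_le_of_abs_le (abs_dZ_le_norm_fderiv f p k))
          (le_of_abs_le (abs_dZ_le_norm_fderiv f p k))
    _ = 3 * ‖fderiv ℝ f p‖ ^ 2 := by
        simp only [Finset.sum_const, Finset.card_univ, Fintype.card_fin, nsmul_eq_mul]
        push_cast
        field_simp

theorem angularSq_le_of_dZ_eq_add {f g : ℝ × E3 → ℝ} {v : Fin 3 → ℝ} {B : ℝ}
    (h : ∀ k, dZ k f p = dZ k g p + v k) (hv : ∀ k, |v k| ≤ B) :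
    angularSq f p ≤ 2 * angularSq g p + 6 * (B / ‖p.2‖) ^ 2 := by
  have hterm (k : Fin 3) : dZ k f p ^ 2 ≤ 2 * dZ k g p ^ 2 + 2 * B ^ 2 := by
    have hvk : v k ^ 2 ≤ B ^ 2 := sq_le_sq' (neg_le_of_abs_le (hv k)) (le_of_abs_le (hv k))
    rw [h k]
    linarith [add_sq_le (a := dZ k g p) (b := v k)]
  calc angularSq f p
      ≤ 1 / ‖p.2‖ ^ 2 * ∑ k, (2 * dZ k g p ^ 2 + 2 * B ^ 2) := by
        exact mul_le_mul_of_nonneg_left (Finset.sum_le_sum fun k _ => hterm k) (by positivity)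
    _ = 2 * angularSq g p + 6 * (B / ‖p.2‖) ^ 2 := by
        simp only [Finset.sum_add_distrib, ← Finset.mul_sum, Finset.sum_const, Finset.card_univ,
          Fintype.card_fin, nsmul_eq_mul, angularSq, div_pow]
        push_cast
        ring

end ShockSurface

namespace Background

variable {G : Gas} {b₀ T : ℝ} (bg : Background G b₀) {σ b ζ : ℝ → E3 → ℝ} {f Φ : ℝ × E3 → ℝ}
  {p : ℝ × E3}

theorem norm_div_eq_add_pertShock (hp : p ∈ shockSurface ζ T) :
    ‖p.2‖ / p.1 = bg.s₀ + pertShock bg ζ p := by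
  rw [pertShock, hp.2.2]
  ring

theorem contDiffAt_corrector (hf : IsCorrector bg σ f) (hfront : IsShockFront G σ T ζ Φ)
    (hp : p ∈ shockSurface ζ T) : ContDiffAt ℝ 1 f p :=
  (hf.smooth p (one_pos.trans_le hp.1.1) hp.2.1 (hfront.onRays_le_norm hp)).of_le
    (by exact_mod_cast le_top)

theorem contDiffAt_pertPotential (hf : IsCorrector bg σ f) (hfront : IsShockFront G σ T ζ Φ)
    (hp : p ∈ shockSurface ζ T)
    (hs : bg.s₀ + pertShock bg ζ p ∈ Ioo (b₀ - bg.τ) (bg.s₀ + bg.τ)) :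
    ContDiffAt ℝ 1 (pertPotential bg f Φ) p :=
  (hfront.regular_Φ p hp).sub (bg.contDiffAt_modifiedPotential (one_pos.trans_le hp.1.1) hp.2.1
    (bg.norm_div_eq_add_pertShock hp ▸ hs) (bg.contDiffAt_corrector hf hfront hp))

theorem fderiv_eq_fderiv_pertPotential_add (hf : IsCorrector bg σ f)
    (hfront : IsShockFront G σ T ζ Φ) (hp : p ∈ shockSurface ζ T)
    (hs : bg.s₀ + pertShock bg ζ p ∈ Ioo (b₀ - bg.τ) (bg.s₀ + bg.τ)) :
    dt Φ p = dt (pertPotential bg f Φ) p +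
      bg.modifiedTime (pertShock bg ζ p) (f p) (p.1 * dt f p) ∧
    dr Φ p = dr (pertPotential bg f Φ) p +
      bg.modifiedRadial (pertShock bg ζ p) (f p) (p.1 * dr f p) ∧
    ∀ k, dZ k Φ p = dZ k (pertPotential bg f Φ) p +
      p.1 * dZ k f p * bg.profile (bg.s₀ + pertShock bg ζ p) := by
  have ht : 0 < p.1 := one_pos.trans_le hp.1.1
  have hξ := bg.norm_div_eq_add_pertShock hp
  have hf₁ := bg.contDiffAt_corrector hf hfront hp
  obtain ⟨htime, hradial, hangular⟩ :=
    bg.fderiv_modifiedPotential ht hp.2.1 hξ hs (hf₁.differentiableAt one_ne_zero)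
  have hsum : fderiv ℝ Φ p =
      fderiv ℝ (pertPotential bg f Φ) p + fderiv ℝ (modifiedPotential bg f) p := by
    rw [← fderiv_add
      ((bg.contDiffAt_pertPotential hf hfront hp hs).differentiableAt one_ne_zero)
      ((bg.contDiffAt_modifiedPotential ht hp.2.1 (hξ ▸ hs) hf₁).differentiableAt one_ne_zero)]
    congr 1
    ext q
    exact (sub_add_cancel _ _).symm
  have happly (v : ℝ × E3) : fderiv ℝ Φ p v =
      fderiv ℝ (pertPotential bg f Φ) p v + fderiv ℝ (modifiedPotential bg f) p v := by
    rw [hsum, add_apply]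
  exact ⟨htime ▸ happly _, hradial ▸ happly _, fun k => hangular k ▸ happly _⟩

theorem pertPotential_eq_of_mem_shockSurface (hfront : IsShockFront G σ T ζ Φ)
    (hp : p ∈ shockSurface ζ T) : pertPotential bg f Φ p =
      -((1 + f p) * (p.1 * bg.profile (bg.s₀ + pertShock bg ζ p))) := by
  rw [pertPotential, hfront.continuity p hp, zero_sub, modifiedPotential, potential,
    bg.norm_div_eq_add_pertShock hp]

theorem angularSq_le_of_corrector {L : ℝ} (hs₀ : 0 < bg.s₀) (hf : IsCorrector bg σ f)
    (hfront : IsShockFront G σ T ζ Φ) (hp : p ∈ shockSurface ζ T)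
    (hs : bg.s₀ + pertShock bg ζ p ∈ Ioo (b₀ - bg.τ) (bg.s₀ + bg.τ))
    (hhalf : bg.s₀ / 2 ≤ bg.s₀ + pertShock bg ζ p) (hL : ∀ k, |dZ k f p| ≤ L) :
    angularSq Φ p ≤ 2 * angularSq (pertPotential bg f Φ) p +
      6 * (2 * L / bg.s₀ * bg.profile (bg.s₀ + pertShock bg ζ p)) ^ 2 := by
  have ht : 0 < p.1 := one_pos.trans_le hp.1.1
  have hL0 : 0 ≤ L := (abs_nonneg _).trans (hL 0)
  set P := bg.profile (bg.s₀ + pertShock bg ζ p)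
  have hratio : p.1 * L * |P| / ‖p.2‖ ≤ 2 * L / bg.s₀ * |P| := by
    calc p.1 * L * |P| / ‖p.2‖ = L * |P| / (‖p.2‖ / p.1) := by field_simp
      _ ≤ L * |P| / (bg.s₀ / 2) := by
        rw [bg.norm_div_eq_add_pertShock hp]
        gcongr
      _ = 2 * L / bg.s₀ * |P| := by field_simp
  refine (angularSq_le_of_dZ_eq_add (B := p.1 * L * |P|)
    (bg.fderiv_eq_fderiv_pertPotential_add hf hfront hp hs).2.2 fun k => ?_).trans ?_
  · rw [abs_mul, abs_mul, abs_of_pos ht]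
    gcongr
    exact hL k
  · rw [mul_pow _ P, ← sq_abs P, ← mul_pow]
    exact add_le_add_right (mul_le_mul_of_nonneg_left
      (pow_le_pow_left₀ (by positivity) hratio 2) (by norm_num)) _

theorem exists_shockCorrector_bounds (hb : 0 < b₀) : ∃ d, 0 < d ∧ ∃ L, 0 < L ∧
    ∀ δ b f T ζ Φ p, 0 ≤ δ → δ ≤ d → IsPistonClose b₀ δ b → IsCorrector bg (pistonPath b) f →
    IsShockFront G (pistonPath b) T ζ Φ → p ∈ shockSurface ζ T → |pertShock bg ζ p| ≤ d →
    bg.s₀ + pertShock bg ζ p ∈ Ioo (b₀ - bg.τ) (bg.s₀ + bg.τ) ∧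
    bg.s₀ / 2 ≤ bg.s₀ + pertShock bg ζ p ∧ |f p| ≤ 20 / bg.u bg.s₀ * δ ∧
    |p.1 * dt f p| ≤ L * δ ∧ (∀ k, |dZ k f p| ≤ L) ∧ |p.1 * dr f p| ≤ L * δ := by
  obtain ⟨δ₁, hδ₁, L, hL, hbounds⟩ := exists_corrector_bounds bg hb
  have hgap := sub_pos.2 bg.b₀_lt_s₀
  have hτ := bg.τ_pos
  refine ⟨min δ₁ (min ((bg.s₀ - b₀) / 2) (bg.τ / 2)), by positivity, L, hL,
    fun δ b f T ζ Φ p hδ hδd hpiston hf hfront hp hξ => ?_⟩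
  simp only [le_min_iff] at hδd hξ
  obtain ⟨hlower, hupper⟩ := abs_le.1 hξ.2.1
  have hτξ := le_of_abs_le hξ.2.2
  have hlayer : ‖p.2‖ ≤ p.1 * (bg.s₀ + (bg.s₀ - b₀) / 2) := by
    rw [← div_le_iff₀' (one_pos.trans_le hp.1.1), bg.norm_div_eq_add_pertShock hp]
    gcongr
  exact ⟨⟨by linarith, by linarith⟩, by linarith, hbounds δ b f hδ hδd.1 hpiston hf p
    ⟨hp.1.1, hp.2.1, hfront.onRays_le_norm hp, hlayer⟩⟩

theorem exists_abs_pertPotential_le (hb : 0 < b₀) {η : ℝ} (hη : 0 < η) : ∃ d, 0 < d ∧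
    ∀ δ b f T ζ Φ p, 0 ≤ δ → δ ≤ d → IsPistonClose b₀ δ b → IsCorrector bg (pistonPath b) f →
    IsShockFront G (pistonPath b) T ζ Φ → p ∈ shockSurface ζ T → |pertShock bg ζ p| ≤ d →
    ContDiffAt ℝ 1 (pertPotential bg f Φ) p ∧
    |pertPotential bg f Φ p| ≤ (1 + η) * bg.u bg.s₀ * (p.1 * |pertShock bg ζ p|) := by
  have hu := bg.u_pos hb bg.shock_mem
  obtain ⟨d₁, hd₁, _, _, hbounds⟩ := bg.exists_shockCorrector_bounds hb
  obtain ⟨d₂, hd₂, hprofile⟩ := bg.exists_abs_profile_le hb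
    (by nlinarith : bg.u bg.s₀ < (1 + η / 2) * bg.u bg.s₀)
  refine ⟨min (min d₁ d₂) (η / (2 + η) * (bg.u bg.s₀ / 20)), by positivity,
    fun δ b f T ζ Φ p hδ hδd hpiston hf hfront hp hξ => ?_⟩
  simp only [le_min_iff] at hδd hξ
  obtain ⟨hs, -, hfp, -⟩ := hbounds δ b f T ζ Φ p hδ hδd.1.1 hpiston hf hfront hp hξ.1.1
  refine ⟨bg.contDiffAt_pertPotential hf hfront hp hs, ?_⟩
  have hfη : |1 + f p| ≤ 1 + η / (2 + η) := by
    refine (abs_add_le 1 (f p)).trans ?_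
    rw [abs_one]
    gcongr
    calc |f p| ≤ 20 / bg.u bg.s₀ * (η / (2 + η) * (bg.u bg.s₀ / 20)) :=
          hfp.trans (mul_le_mul_of_nonneg_left hδd.2 (by positivity))
      _ = η / (2 + η) := by field_simp
  rw [bg.pertPotential_eq_of_mem_shockSurface hfront hp, abs_neg, abs_mul, abs_mul,
    abs_of_pos (one_pos.trans_le hp.1.1)]
  calc |1 + f p| * (p.1 * |bg.profile (bg.s₀ + pertShock bg ζ p)|)
      ≤ (1 + η / (2 + η)) * (p.1 * ((1 + η / 2) * bg.u bg.s₀ * |pertShock bg ζ p|)) := by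
        have := one_pos.trans_le hp.1.1
        gcongr
        exact hprofile _ hξ.1.2
    _ = (1 + η) * bg.u bg.s₀ * (p.1 * |pertShock bg ζ p|) := by
        field_simp
        ring

theorem exists_angularSq_le (hb : 0 < b₀) : ∃ d, 0 < d ∧ ∃ K, 0 ≤ K ∧
    ∀ δ b f T ζ Φ p, 0 ≤ δ → δ ≤ d → IsPistonClose b₀ δ b → IsCorrector bg (pistonPath b) f →
    IsShockFront G (pistonPath b) T ζ Φ → p ∈ shockSurface ζ T → |pertShock bg ζ p| ≤ d →
    angularSq Φ p ≤ 2 * angularSq (pertPotential bg f Φ) p + K * pertShock bg ζ p ^ 2 := by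
  have hu := bg.u_pos hb bg.shock_mem
  have hs₀ := bg.s₀_pos hb
  obtain ⟨d₁, hd₁, L, hL, hbounds⟩ := bg.exists_shockCorrector_bounds hb
  obtain ⟨d₂, hd₂, hprofile⟩ := bg.exists_abs_profile_le hb (lt_two_mul_self hu)
  refine ⟨min d₁ d₂, by positivity, 6 * (2 * L / bg.s₀ * (2 * bg.u bg.s₀)) ^ 2, by positivity,
    fun δ b f T ζ Φ p hδ hδd hpiston hf hfront hp hξ => ?_⟩
  simp only [le_min_iff] at hδd hξ
  obtain ⟨hs, hhalf, -, -, hdZ, -⟩ := hbounds δ b f T ζ Φ p hδ hδd.1 hpiston hf hfront hp hξ.1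
  refine (bg.angularSq_le_of_corrector hs₀ hf hfront hp hs hhalf hdZ).trans
    (add_le_add_right ?_ _)
  rw [mul_assoc 6, ← mul_pow, mul_assoc (2 * L / bg.s₀)]
  refine mul_le_mul_of_nonneg_left (sq_le_sq.2 ?_) (by norm_num)
  rw [abs_mul, abs_mul _ (_ * _), abs_mul _ (pertShock bg ζ p),
    abs_of_pos (by positivity : 0 < 2 * bg.u bg.s₀)]
  exact mul_le_mul_of_nonneg_left (hprofile _ hξ.2) (abs_nonneg _)

theorem exists_frontSpeed_linearization (hb : 0 < b₀)
    (hκ : bg.polarCoeff ∈ Icc (1 / 4 : ℝ) (1 / 2)) (hsu : bg.s₀ ≤ 2 * bg.u bg.s₀) {η : ℝ}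
    (hη : 0 < η) : ∃ d, 0 < d ∧ ∃ C, 0 ≤ C ∧ ∀ δ b f T ζ Φ p, 0 ≤ δ → δ ≤ d →
    IsPistonClose b₀ δ b → IsCorrector bg (pistonPath b) f →
    IsShockFront G (pistonPath b) T ζ Φ → p ∈ shockSurface ζ T → p.1 ∈ Ioo 1 T →
    |pertShock bg ζ p| ≤ d → ‖fderiv ℝ (pertPotential bg f Φ) p‖ ≤ d → angularSq Φ p ≤ d →
    |dt (onRays ζ) p - bg.s₀ + bg.polarCoeff / bg.u bg.s₀ *
        (dt (pertPotential bg f Φ) p - bg.s₀ * bg.shockSlope * pertShock bg ζ p)| ≤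
      η * (|dt (pertPotential bg f Φ) p| + |pertShock bg ζ p|) + C * angularSq Φ p + 120 * δ := by
  have hu := bg.u_pos hb bg.shock_mem
  obtain ⟨d₁, hd₁, L, hL, hbounds⟩ := bg.exists_shockCorrector_bounds hb
  obtain ⟨d₂, hd₂, C, hC, hspeed⟩ := bg.exists_perturbedShockSpeed hb hκ hη
  refine ⟨min (min d₁ d₂) (min (d₂ / L) (d₂ / (20 / bg.u bg.s₀))), by positivity, C, hC,
    fun δ b f T ζ Φ p hδ hδd hpiston hf hfront hp ht hξ hφ hang => ?_⟩
  simp only [le_min_iff] at hδd hξ hφ hang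
  obtain ⟨⟨hδ₁, -⟩, hδL, hδu⟩ := hδd
  rw [le_div_iff₀' (by positivity)] at hδL hδu
  obtain ⟨hs, -, hfp, hft, -, hfr⟩ := hbounds δ b f T ζ Φ p hδ hδ₁ hpiston hf hfront hp hξ.1.1
  obtain ⟨htime, hradial, -⟩ := bg.fderiv_eq_fderiv_pertPotential_add hf hfront hp hs
  obtain ⟨hjump, htangent⟩ := hfront.jump_eq_zero hp ht
  obtain ⟨hpos, hlin⟩ := hspeed _ _ _ _ _ _ _ hξ.1.2 (hfp.trans hδu) (hft.trans hδL)
    (hfr.trans hδL) ((abs_dt_le_norm_fderiv _ p).trans hφ.1.2)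
    ((abs_dr_le_norm_fderiv _ p).trans hφ.1.2)
    ((abs_of_nonneg (angularSq_nonneg Φ p)).trans_le hang.1.2) _ _ htime hradial hjump
  have hfrontSpeed : dt (onRays ζ) p = -dt Φ p / dr Φ p := by
    rw [eq_div_iff hpos.ne']
    linarith
  rw [hfrontSpeed]
  refine hlin.trans ?_
  rw [abs_of_nonneg (angularSq_nonneg Φ p)]
  refine add_le_add_right ?_ _
  calc 3 * bg.s₀ * |f p| ≤ 3 * (2 * bg.u bg.s₀) * (20 / bg.u bg.s₀ * δ) := by gcongr
    _ = 120 * δ := by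
      field_simp
      ring

theorem exists_linearized_rankineHugoniot (hb : 0 < b₀)
    (hκ : bg.polarCoeff ∈ Icc (1 / 4 : ℝ) (1 / 2)) (hsu : bg.s₀ ≤ 2 * bg.u bg.s₀) {η : ℝ}
    (hη : 0 < η) : ∃ d, 0 < d ∧ ∃ C, ∀ δ B b f T ζ Φ p, 0 ≤ δ → δ ≤ d → B ≤ d →
    IsPistonClose b₀ δ b → IsCorrector bg (pistonPath b) f →
    IsShockFront G (pistonPath b) T ζ Φ → p ∈ shockSurface ζ T → p.1 ∈ Ioo 1 T →
    |pertShock bg ζ p| ≤ B → ‖fderiv ℝ (pertPotential bg f Φ) p‖ ≤ B →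
    |dt (onRays ζ) p - bg.s₀ + bg.polarCoeff / bg.u bg.s₀ *
        (dt (pertPotential bg f Φ) p - bg.s₀ * bg.shockSlope * pertShock bg ζ p)| ≤
      η * (|dt (pertPotential bg f Φ) p| + |pertShock bg ζ p|) +
        C * B * √(angularSq (pertPotential bg f Φ) p) + 120 * δ := by
  obtain ⟨d₁, hd₁, K, hK, hangular⟩ := bg.exists_angularSq_le hb
  obtain ⟨d₂, hd₂, C, hC, hspeed⟩ := bg.exists_frontSpeed_linearization hb hκ hsu (half_pos hη)
  refine ⟨min (min d₁ d₂) (min (min 1 (d₂ / (6 + K))) (η / 2 / (C * K + 1))), by positivity, 4 * C,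
    fun δ B b f T ζ Φ p hδ hδd hBd hpiston hf hfront hp ht hξ hφ => ?_⟩
  simp only [le_min_iff] at hδd hBd
  obtain ⟨⟨hB₁, hB₂⟩, ⟨hB_one, hBK⟩, hBη⟩ := hBd
  rw [le_div_iff₀ (by positivity)] at hBK hBη
  have hB : 0 ≤ B := (abs_nonneg _).trans hξ
  set W := √(angularSq (pertPotential bg f Φ) p)
  set ξ := pertShock bg ζ p
  have hW_sq : W ^ 2 = angularSq (pertPotential bg f Φ) p := Real.sq_sqrt (angularSq_nonneg _ p)
  have : 0 ≤ W := Real.sqrt_nonneg _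
  have hW3 : W ^ 2 ≤ 3 * B ^ 2 := by
    rw [hW_sq]
    exact (angularSq_le_norm_fderiv _ hp.2.1).trans (by gcongr)
  have hWB : W ≤ 2 * B := by nlinarith
  have hξB : ξ ^ 2 ≤ B * |ξ| := by
    rw [← sq_abs, sq]
    gcongr
  have hΦ := hangular δ b f T ζ Φ p hδ hδd.1.1 hpiston hf hfront hp (hξ.trans hB₁)
  rw [← hW_sq] at hΦ
  have hsmall : angularSq Φ p ≤ d₂ := by
    have : K * ξ ^ 2 ≤ K * B := mul_le_mul_of_nonneg_left (by nlinarith [abs_nonneg ξ]) hK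
    nlinarith
  refine (hspeed δ b f T ζ Φ p hδ hδd.1.2 hpiston hf hfront hp ht (hξ.trans hB₂) (hφ.trans hB₂)
    hsmall).trans (add_le_add_left ?_ _)
  have hquadratic : C * angularSq Φ p ≤ 4 * C * B * W + η / 2 * |ξ| := by
    calc C * angularSq Φ p ≤ C * (2 * W * W + K * (B * |ξ|)) := by
          gcongr
          exact hΦ.trans (by rw [mul_assoc, ← sq]; gcongr)
      _ ≤ C * (2 * (2 * B) * W + K * (B * |ξ|)) := by gcongr
      _ = 4 * C * B * W + B * (C * K) * |ξ| := by ring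
      _ ≤ 4 * C * B * W + η / 2 * |ξ| := by
          gcongr
          linarith
  have := mul_nonneg (half_pos hη).le (abs_nonneg (dt (pertPotential bg f Φ) p))
  linarith

end Background

/-! ### A weighted Hardy inequality for damped equations -/

theorem continuousOn_rpow_Icc {a b : ℝ} (ha : 0 < a) (ν : ℝ) :
    ContinuousOn (fun t : ℝ => t ^ ν) (Icc a b) :=
  continuousOn_id.rpow_const fun _ ht => Or.inl (ha.trans_le ht.1).ne'

theorem rpow_add_one_mul_sq {t : ℝ} (ht : 0 < t) (μ x : ℝ) :
    t ^ (μ + 1) * x ^ 2 = t ^ (μ - 1) * (t * x) ^ 2 := by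
  rw [show μ + 1 = μ - 1 + 2 by ring, Real.rpow_add ht, Real.rpow_two]
  ring

theorem integral_rpow_le_inv {ν g T : ℝ} (hT : 1 ≤ T) (hg : 0 < g) (hν : ν ≤ -1 - g) :
    ∫ t in (1 : ℝ)..T, t ^ ν ≤ 1 / g := by
  have h0 : (0 : ℝ) ∉ uIcc 1 T := by
    rw [uIcc_of_le hT]
    exact fun h => absurd h.1 (by norm_num)
  rw [integral_rpow (Or.inr ⟨by linarith, h0⟩), Real.one_rpow, ← neg_div_neg_eq,
    div_le_div_iff₀ (by linarith) hg]
  nlinarith [Real.rpow_nonneg (zero_le_one.trans hT) (ν + 1)]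

theorem integral_rpow_mul_sq_le_of_energy {a b μ lam : ℝ} {ψ ψ' F : ℝ → ℝ} (ha : 0 < a)
    (hab : a ≤ b) (hψ : ∀ t ∈ Icc a b, HasDerivAt ψ (ψ' t) t) (hψ' : ContinuousOn ψ' (Icc a b))
    (hF : ContinuousOn F (Icc a b))
    (h : ∀ t ∈ Ioo a b, 2 * ψ t * (t * ψ' t) ≤ lam * ψ t ^ 2 + F t) :
    (-μ - lam) * ∫ t in a..b, t ^ (μ - 1) * ψ t ^ 2 ≤
      a ^ μ * ψ a ^ 2 + ∫ t in a..b, t ^ (μ - 1) * F t := by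
  have hpos : ∀ t ∈ Icc a b, 0 < t := fun t ht => ha.trans_le ht.1
  have hψc : ContinuousOn ψ (Icc a b) := HasDerivAt.continuousOn hψ
  have hder : ∀ t ∈ uIcc a b, HasDerivAt (fun t => t ^ μ * ψ t ^ 2)
      (t ^ (μ - 1) * (μ * ψ t ^ 2 + 2 * ψ t * (t * ψ' t))) t := by
    rw [uIcc_of_le hab]
    intro t ht
    refine ((Real.hasDerivAt_rpow_const (p := μ) (Or.inl (hpos t ht).ne')).mul
      ((hψ t ht).pow 2)).congr_deriv ?_
    rw [show t ^ μ = t ^ (μ - 1) * t by rw [← Real.rpow_add_one (hpos t ht).ne', sub_add_cancel]]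
    simp only [Pi.pow_apply, Nat.cast_ofNat, Nat.add_one_sub_one, pow_one]
    ring
  have hw := continuousOn_rpow_Icc (b := b) ha (μ - 1)
  have iψ : IntervalIntegrable (fun t => t ^ (μ - 1) * ψ t ^ 2) volume a b :=
    (hw.mul (hψc.pow 2)).intervalIntegrable_of_Icc hab
  have iF : IntervalIntegrable (fun t => t ^ (μ - 1) * F t) volume a b :=
    (hw.mul hF).intervalIntegrable_of_Icc hab
  have iE : IntervalIntegrable
      (fun t => t ^ (μ - 1) * (μ * ψ t ^ 2 + 2 * ψ t * (t * ψ' t))) volume a b :=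
    ContinuousOn.intervalIntegrable_of_Icc hab (by fun_prop)
  have hmono := intervalIntegral.integral_mono_on_of_le_Ioo hab iE ((iψ.const_mul (μ + lam)).add iF)
    fun t ht => by
      have := mul_le_mul_of_nonneg_left (h t ht)
        (Real.rpow_nonneg (hpos t (Ioo_subset_Icc_self ht)).le (μ - 1))
      linarith
  rw [intervalIntegral.integral_eq_sub_of_hasDerivAt hder iE,
    intervalIntegral.integral_add (iψ.const_mul _) iF,
    intervalIntegral.integral_const_mul] at hmono
  have hb : 0 ≤ b ^ μ * ψ b ^ 2 :=
    mul_nonneg (Real.rpow_nonneg (hpos b ⟨hab, le_rfl⟩).le _) (sq_nonneg _)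
  linarith

/-- Half of `-μ x²` is spent on the cross term `x y`; the damping pays for the other terms. -/
theorem two_mul_mul_le_of_damped {μ k θ η c x p y w e : ℝ} (hμ : μ < 0) (hk : 0 ≤ k)
    (hθ : 1 / 2 ≤ θ) (hη : η ≤ 1 / 4)
    (h : |p + (k * y + θ * x)| ≤ η * (|y| + |x|) + c * w + e) :
    2 * x * p ≤ -μ / 2 * x ^ 2 +
      (2 / -μ * (k + η) ^ 2 * y ^ 2 + 4 * c ^ 2 * w ^ 2 + 4 * e ^ 2) := by
  set r := p + (k * y + θ * x) with hr
  have hp : 2 * x * p = 2 * (x * r) - 2 * k * (x * y) - 2 * θ * x ^ 2 := by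
    rw [hr]
    ring
  have hxr : x * r ≤ |x| * (η * (|y| + |x|) + c * w + e) :=
    (le_abs_self _).trans (abs_mul x r ▸ mul_le_mul_of_nonneg_left h (abs_nonneg x))
  have hxy : -(x * y) ≤ |x| * |y| := abs_mul x y ▸ neg_le_abs _
  have young : 2 * (k + η) * (|x| * |y|) ≤
      -μ / 2 * |x| ^ 2 + 2 / -μ * (k + η) ^ 2 * |y| ^ 2 := by
    have : 0 ≤ 1 / (2 * -μ) * (-μ * |x| - 2 * ((k + η) * |y|)) ^ 2 :=
      mul_nonneg (one_div_nonneg.2 (by linarith)) (sq_nonneg _)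
    have hsq : 1 / (2 * -μ) * (-μ * |x| - 2 * ((k + η) * |y|)) ^ 2 = -μ / 2 * |x| ^ 2 -
        2 * (k + η) * (|x| * |y|) + 2 / -μ * (k + η) ^ 2 * |y| ^ 2 := by
      have := hμ.ne
      field_simp
      ring
    linarith
  rw [hp, ← sq_abs x, ← sq_abs y]
  nlinarith [mul_le_mul_of_nonneg_left hxy hk, mul_le_mul_of_nonneg_right hη (sq_nonneg |x|),
    mul_le_mul_of_nonneg_right hθ (sq_nonneg |x|), sq_nonneg (1 / 2 * |x| - 2 * (c * w)),
    sq_nonneg (1 / 2 * |x| - 2 * e)]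

theorem integral_rpow_mul_sum_sq {T α β μ e : ℝ} {D W : ℝ → ℝ} (hT : 1 ≤ T)
    (hD : ContinuousOn D (Icc 1 T)) (hW : ContinuousOn W (Icc 1 T)) :
    ∫ t in (1 : ℝ)..T, t ^ (μ - 1) * (α * (t * D t) ^ 2 + β * (t * W t) ^ 2 + e * t ^ 2) =
      α * (∫ t in (1 : ℝ)..T, t ^ (μ + 1) * D t ^ 2) +
      β * (∫ t in (1 : ℝ)..T, t ^ (μ + 1) * W t ^ 2) + e * ∫ t in (1 : ℝ)..T, t ^ (μ + 1) := by
  have hweight := continuousOn_rpow_Icc (b := T) one_pos (μ + 1)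
  have iD : IntervalIntegrable (fun t => t ^ (μ + 1) * D t ^ 2) volume 1 T :=
    (hweight.mul (hD.pow 2)).intervalIntegrable_of_Icc hT
  have iW : IntervalIntegrable (fun t => t ^ (μ + 1) * W t ^ 2) volume 1 T :=
    (hweight.mul (hW.pow 2)).intervalIntegrable_of_Icc hT
  have ie : IntervalIntegrable (fun t : ℝ => t ^ (μ + 1)) volume 1 T :=
    hweight.intervalIntegrable_of_Icc hT
  rw [← intervalIntegral.integral_const_mul, ← intervalIntegral.integral_const_mul,
    ← intervalIntegral.integral_const_mul,
    ← intervalIntegral.integral_add (iD.const_mul α) (iW.const_mul β),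
    ← intervalIntegral.integral_add ((iD.const_mul α).add (iW.const_mul β)) (ie.const_mul e)]
  refine intervalIntegral.integral_congr fun t ht => ?_
  rw [uIcc_of_le hT] at ht
  have hweight := rpow_add_one_mul_sq (one_pos.trans_le ht.1) μ 1
  rw [one_pow, mul_one, mul_one] at hweight
  simp only [hweight]
  ring

theorem hardy_of_damped {T μ g k θ η c e : ℝ} {ψ ψ' D W : ℝ → ℝ} (hT : 1 ≤ T) (hg : 0 < g)
    (hμ : μ ≤ -2 - g) (hk : 0 ≤ k) (hθ : 1 / 2 ≤ θ) (hη : η ≤ 1 / 4)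
    (hψ : ∀ t ∈ Icc 1 T, HasDerivAt ψ (ψ' t) t) (hψ' : ContinuousOn ψ' (Icc 1 T))
    (hD : ContinuousOn D (Icc 1 T)) (hW : ContinuousOn W (Icc 1 T))
    (h : ∀ t ∈ Ioo 1 T, |ψ' t + (k * D t + θ * (ψ t / t))| ≤
      η * (|D t| + |ψ t / t|) + c * W t + e) :
    ∫ t in (1 : ℝ)..T, t ^ (μ - 1) * ψ t ^ 2 ≤ ψ 1 ^ 2 +
      4 * (k + η) ^ 2 / μ ^ 2 * (∫ t in (1 : ℝ)..T, t ^ (μ + 1) * D t ^ 2) +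
      4 * c ^ 2 * (∫ t in (1 : ℝ)..T, t ^ (μ + 1) * W t ^ 2) + 4 * e ^ 2 / g := by
  have hμ0 : μ < 0 := by linarith
  have hpoint : ∀ t ∈ Ioo 1 T, 2 * ψ t * (t * ψ' t) ≤ -μ / 2 * ψ t ^ 2 +
      (2 / -μ * (k + η) ^ 2 * (t * D t) ^ 2 + 4 * c ^ 2 * (t * W t) ^ 2 +
        4 * e ^ 2 * t ^ 2) := by
    intro t ht
    have ht0 : 0 < t := one_pos.trans ht.1
    have hscaled := mul_le_mul_of_nonneg_left (h t ht) ht0.le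
    rw [← abs_of_pos ht0, ← abs_mul, abs_of_pos ht0] at hscaled
    refine (two_mul_mul_le_of_damped hμ0 hk hθ hη (c := c) (w := t * W t) (e := t * e)
      (y := t * D t) ?_).trans_eq (by ring)
    calc |t * ψ' t + (k * (t * D t) + θ * ψ t)|
        = |t * (ψ' t + (k * D t + θ * (ψ t / t)))| := by
          congr 1
          field_simp
      _ ≤ t * (η * (|D t| + |ψ t / t|) + c * W t + e) := hscaled
      _ = η * (|t * D t| + |ψ t|) + c * (t * W t) + t * e := by
          rw [abs_mul, abs_div, abs_of_pos ht0]
          field_simp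
  have henergy := integral_rpow_mul_sq_le_of_energy (μ := μ) one_pos hT hψ hψ' (by fun_prop) hpoint
  rw [Real.one_rpow, one_mul, integral_rpow_mul_sum_sq hT hD hW,
    show -μ - -μ / 2 = -μ / 2 by ring] at henergy
  have hW0 : 0 ≤ ∫ t in (1 : ℝ)..T, t ^ (μ + 1) * W t ^ 2 :=
    intervalIntegral.integral_nonneg hT fun t ht =>
      mul_nonneg (Real.rpow_nonneg (zero_le_one.trans ht.1) _) (sq_nonneg _)
  refine le_of_mul_le_mul_left (henergy.trans ?_) (by linarith : 0 < -μ / 2)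
  have hrest : 0 ≤ ψ 1 ^ 2 + 4 * c ^ 2 * (∫ t in (1 : ℝ)..T, t ^ (μ + 1) * W t ^ 2) +
    4 * e ^ 2 / g := by positivity
  have hDterm : -μ / 2 * (4 * (k + η) ^ 2 / μ ^ 2 * (∫ t in (1 : ℝ)..T, t ^ (μ + 1) * D t ^ 2)) =
      2 / -μ * (k + η) ^ 2 * (∫ t in (1 : ℝ)..T, t ^ (μ + 1) * D t ^ 2) := by
    field_simp
    ring
  have heterm : 4 * e ^ 2 * (∫ t in (1 : ℝ)..T, t ^ (μ + 1)) ≤ 4 * e ^ 2 / g :=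
    (mul_le_mul_of_nonneg_left (integral_rpow_le_inv hT hg (by linarith)) (by positivity)).trans_eq
      (mul_one_div _ _)
  have := mul_le_mul_of_nonneg_right (by linarith : 1 ≤ -μ / 2) hrest
  linarith

theorem integral_rpow_mul_sq_le_of_abs_le {T ν L : ℝ} {φ ψ : ℝ → ℝ} (hT : 1 ≤ T)
    (hφ : ContinuousOn φ (Icc 1 T)) (hψ : ContinuousOn ψ (Icc 1 T))
    (h : ∀ t ∈ Icc 1 T, |φ t| ≤ L * |ψ t|) :
    ∫ t in (1 : ℝ)..T, t ^ ν * φ t ^ 2 ≤ L ^ 2 * ∫ t in (1 : ℝ)..T, t ^ ν * ψ t ^ 2 := by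
  have hweight := continuousOn_rpow_Icc (b := T) one_pos ν
  rw [← intervalIntegral.integral_const_mul]
  refine intervalIntegral.integral_mono_on hT
    ((hweight.mul (hφ.pow 2)).intervalIntegrable_of_Icc hT)
    ((continuousOn_const.mul (hweight.mul (hψ.pow 2))).intervalIntegrable_of_Icc hT)
    fun t ht => ?_
  have hsq : φ t ^ 2 ≤ L ^ 2 * ψ t ^ 2 := by
    rw [← sq_abs (φ t), ← sq_abs (ψ t), ← mul_pow]
    exact pow_le_pow_left₀ (abs_nonneg _) (h t ht) 2
  exact (mul_le_mul_of_nonneg_left hsq (Real.rpow_nonneg (zero_le_one.trans ht.1) ν)).trans_eq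
    (by ring)

theorem exists_loss {u w : ℝ} (hu : 0 < u) (hw : 0 < w) : ∃ η : ℝ, 0 < η ∧ η ≤ 1 / 4 ∧
    ∀ k : ℝ, 0 ≤ k → k * u ≤ 1 / 2 → ((1 + η) * u) ^ 2 * (4 * (k + η) ^ 2) ≤ 1 + w := by
  have hlim : Filter.Tendsto (fun η : ℝ => ((1 + η) * (2 * (1 / 2 + η * u))) ^ 2)
      (nhdsWithin 0 (Ioi 0)) (nhds 1) :=
    tendsto_nhdsWithin_of_tendsto_nhds (Continuous.tendsto' (by fun_prop) _ _ (by norm_num))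
  obtain ⟨η, hη, hη0, hη4⟩ := ((hlim.eventually (gt_mem_nhds (by linarith : 1 < 1 + w))).and
    (Ioc_mem_nhdsGT (by norm_num : (0 : ℝ) < 1 / 4))).exists
  refine ⟨η, hη0, hη4, fun k hk hku => le_trans ?_ hη.le⟩
  rw [show ((1 + η) * u) ^ 2 * (4 * (k + η) ^ 2) =
    ((1 + η) * (2 * (k * u + η * u))) ^ 2 by ring]
  gcongr


/-! ### Integration over the shock surface -/

section ShockIntegral

variable {ζ : ℝ → E3 → ℝ} {T : ℝ}

theorem continuous_shockCurve
    (hζ : ∀ p : ℝ × E3, p.1 ∈ Icc 1 T → p.2 ≠ 0 → ContinuousAt (onRays ζ) p) :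
    Continuous fun z : Metric.sphere (0 : E3) 1 × Icc 1 T =>
      ((z.2 : ℝ), ζ z.2 z.1 • (z.1 : E3)) := by
  suffices hradius : Continuous fun z : Metric.sphere (0 : E3) 1 × Icc 1 T => ζ z.2 z.1 from
    (continuous_subtype_val.comp continuous_snd).prodMk
      (hradius.smul (continuous_subtype_val.comp continuous_fst))
  have honRays : (fun z : Metric.sphere (0 : E3) 1 × Icc 1 T => ζ z.2 z.1) =
      fun z => onRays ζ ((z.2 : ℝ), (z.1 : E3)) := by
    ext z
    simp [onRays]
  rw [honRays, continuous_iff_continuousAt]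
  exact fun z => (hζ ((z.2 : ℝ), (z.1 : E3)) z.2.2 (ne_zero_of_mem_unit_sphere z.1)).comp
    (f := fun z : Metric.sphere (0 : E3) 1 × Icc 1 T => ((z.2 : ℝ), (z.1 : E3)))
    (by fun_prop)

theorem continuous_comp_shockCurve {g : ℝ × E3 → ℝ}
    (hζ : ∀ p : ℝ × E3, p.1 ∈ Icc 1 T → p.2 ≠ 0 → ContinuousAt (onRays ζ) p)
    (hpos : ∀ t ∈ Icc 1 T, ∀ y : E3, ‖y‖ = 1 → 0 < ζ t y)
    (hg : ∀ p ∈ shockSurface ζ T, ContinuousAt g p) :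
    Continuous fun z : Metric.sphere (0 : E3) 1 × Icc 1 T =>
      g ((z.2 : ℝ), ζ z.2 z.1 • (z.1 : E3)) :=
  continuous_iff_continuousAt.2 fun z =>
    (hg _ (smul_mem_shockSurface z.2.2 (norm_eq_of_mem_sphere z.1)
      (hpos _ z.2.2 _ (norm_eq_of_mem_sphere z.1)))).comp
      (f := fun z : Metric.sphere (0 : E3) 1 × Icc 1 T => ((z.2 : ℝ), ζ z.2 z.1 • (z.1 : E3)))
      (continuous_shockCurve hζ).continuousAt

theorem continuousOn_shockRay {g : ℝ × E3 → ℝ} {y : E3} (hy : ‖y‖ = 1)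
    (hζ : ∀ p : ℝ × E3, p.1 ∈ Icc 1 T → p.2 ≠ 0 → ContinuousAt (onRays ζ) p)
    (hpos : ∀ t ∈ Icc 1 T, ∀ y : E3, ‖y‖ = 1 → 0 < ζ t y)
    (hg : ∀ p ∈ shockSurface ζ T, ContinuousAt g p) :
    ContinuousOn (fun t => g (t, ζ t y • y)) (Icc 1 T) :=
  continuousOn_iff_continuous_domRestrict.2 <| (continuous_comp_shockCurve hζ hpos hg).comp
    (f := fun t : Icc 1 T => ((⟨y, by simpa using hy⟩ : Metric.sphere (0 : E3) 1), t))
    (by fun_prop)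

theorem integrable_shockRay_integral {g : ℝ × E3 → ℝ} (hT : 1 ≤ T)
    (hζ : ∀ p : ℝ × E3, p.1 ∈ Icc 1 T → p.2 ≠ 0 → ContinuousAt (onRays ζ) p)
    (hpos : ∀ t ∈ Icc 1 T, ∀ y : E3, ‖y‖ = 1 → 0 < ζ t y)
    (hg : ∀ p ∈ shockSurface ζ T, ContinuousAt g p) :
    Integrable (fun y : Metric.sphere (0 : E3) 1 => ∫ t in (1 : ℝ)..T, g (t, ζ t y • (y : E3)))
      (volume : Measure E3).toSphere := by
  refine Continuous.integrable_of_hasCompactSupport ?_ (HasCompactSupport.of_compactSpace _)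
  have hextended : Continuous fun z : Metric.sphere (0 : E3) 1 × ℝ =>
      g ((projIcc 1 T hT z.2 : ℝ), ζ (projIcc 1 T hT z.2) z.1 • (z.1 : E3)) :=
    (continuous_comp_shockCurve hζ hpos hg).comp
      (f := fun z : Metric.sphere (0 : E3) 1 × ℝ => (z.1, projIcc 1 T hT z.2))
      (continuous_fst.prodMk (continuous_projIcc.comp continuous_snd))
  refine (intervalIntegral.continuous_parametric_intervalIntegral_of_continuous (μ := volume)
    (f := fun (y : Metric.sphere (0 : E3) 1) (t : ℝ) =>
      g ((projIcc 1 T hT t : ℝ), ζ (projIcc 1 T hT t) y • (y : E3)))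
    (a₀ := 1) hextended (s := fun _ => T) continuous_const).congr
      fun y => intervalIntegral.integral_congr fun t ht => ?_
  rw [uIcc_of_le hT] at ht
  simp only [projIcc_of_mem hT ht]

theorem shockIntegral_le_of_ray {F g₁ g₂ : ℝ × E3 → ℝ} {a₀ a₁ a₂ : ℝ} (hT : 1 ≤ T)
    (hζ : ∀ p : ℝ × E3, p.1 ∈ Icc 1 T → p.2 ≠ 0 → ContinuousAt (onRays ζ) p)
    (hpos : ∀ t ∈ Icc 1 T, ∀ y : E3, ‖y‖ = 1 → 0 < ζ t y)
    (hF : ∀ p ∈ shockSurface ζ T, ContinuousAt F p)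
    (hg₁ : ∀ p ∈ shockSurface ζ T, ContinuousAt g₁ p)
    (hg₂ : ∀ p ∈ shockSurface ζ T, ContinuousAt g₂ p)
    (h : ∀ y : E3, ‖y‖ = 1 → ∫ t in (1 : ℝ)..T, F (t, ζ t y • y) ≤
      a₀ + a₁ * (∫ t in (1 : ℝ)..T, g₁ (t, ζ t y • y)) +
        a₂ * ∫ t in (1 : ℝ)..T, g₂ (t, ζ t y • y)) :
    shockIntegral ζ T F ≤ (volume : Measure E3).toSphere.real univ * a₀ +
      a₁ * shockIntegral ζ T g₁ + a₂ * shockIntegral ζ T g₂ := by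
  have i₁ := (integrable_shockRay_integral hT hζ hpos hg₁).const_mul a₁
  have i₂ := (integrable_shockRay_integral hT hζ hpos hg₂).const_mul a₂
  refine (integral_mono (integrable_shockRay_integral hT hζ hpos hF)
    (((integrable_const a₀).add i₁).add i₂)
    fun y => h y (norm_eq_of_mem_sphere y)).trans_eq ?_
  rw [integral_add' ((integrable_const a₀).add i₁) i₂, integral_add' (integrable_const a₀) i₁,
    integral_const, smul_eq_mul, integral_const_mul, integral_const_mul]
  rfl

theorem shockIntegral_rpow_mul_nonneg {g : ℝ × E3 → ℝ} (hT : 1 ≤ T) (ν : ℝ)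
    (hg : ∀ p, 0 ≤ g p) : 0 ≤ shockIntegral ζ T fun p => p.1 ^ ν * g p :=
  integral_nonneg fun _ => intervalIntegral.integral_nonneg hT fun _ ht =>
    mul_nonneg (Real.rpow_nonneg (zero_le_one.trans ht.1) _) (hg _)

theorem continuousAt_time_rpow_mul {g : ℝ × E3 → ℝ} {p : ℝ × E3} (hp : p ∈ shockSurface ζ T)
    (ν : ℝ) (hg : ContinuousAt g p) : ContinuousAt (fun p => p.1 ^ ν * g p) p :=
  (continuousAt_fst.rpow_const (Or.inl (one_pos.trans_le hp.1.1).ne')).mul hg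

end ShockIntegral

theorem continuousAt_dt {f : ℝ × E3 → ℝ} {p : ℝ × E3} (hf : ContDiffAt ℝ 1 f p) :
    ContinuousAt (dt f) p :=
  (contDiffAt_dt (n := 0) hf (by norm_num)).continuousAt

theorem continuousAt_angularSq {f : ℝ × E3 → ℝ} {p : ℝ × E3} (hf : ContDiffAt ℝ 1 f p)
    (hp : p.2 ≠ 0) : ContinuousAt (angularSq f) p := by
  refine (continuousAt_const.div (continuousAt_snd.norm.pow 2)
    (pow_ne_zero 2 (norm_ne_zero_iff.2 hp))).mul (tendsto_finsetSum _ fun k _ => ?_)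
  exact (contDiffAt_dZ (n := 0) hf (by norm_num) k).continuousAt.pow 2

/-! ### The Hardy-type inequality -/

section HardyOnShock

variable {G : Gas} {b₀ : ℝ}

theorem IsShockFront.pos_of_isPistonClose {b ζ : ℝ → E3 → ℝ} {δ T : ℝ} {Φ : ℝ × E3 → ℝ}
    (hfront : IsShockFront G (pistonPath b) T ζ Φ) (hpiston : IsPistonClose b₀ δ b) (hδ : δ < b₀)
    {t : ℝ} {y : E3} (ht : t ∈ Icc 1 T) (hy : ‖y‖ = 1) : 0 < ζ t y := by
  have hy0 : y ≠ 0 := norm_pos_iff.1 (hy ▸ one_pos)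
  have hahead := hfront.ahead (t, y) ht hy0
  have hspeed := neg_le_of_abs_le (hpiston.speed (t, y) ht.1 hy0)
  rw [onRays_pistonPath] at hahead
  have hpath : 0 < t * onRays b (t, y) := mul_pos (one_pos.trans_le ht.1) (by linarith)
  simpa [onRays, hy] using hpath.trans_le hahead

theorem Background.hardy_on_ray (bg : Background G b₀) {ζ : ℝ → E3 → ℝ} {φ : ℝ × E3 → ℝ}
    {T μ g k θ η c e L : ℝ} {y : E3} (hT : 1 ≤ T) (hg : 0 < g) (hμ : μ ≤ -2 - g) (hk : 0 ≤ k)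
    (hθ : 1 / 2 ≤ θ) (hη : η ≤ 1 / 4) (hy : ‖y‖ = 1)
    (hζ : ∀ p : ℝ × E3, p.1 ∈ Icc 1 T → p.2 ≠ 0 → ContDiffAt ℝ 1 (onRays ζ) p)
    (hpos : ∀ t ∈ Icc 1 T, ∀ y : E3, ‖y‖ = 1 → 0 < ζ t y)
    (hφ : ∀ p ∈ shockSurface ζ T, ContDiffAt ℝ 1 φ p)
    (hφξ : ∀ p ∈ shockSurface ζ T, |φ p| ≤ L * (p.1 * |pertShock bg ζ p|))
    (hfront : ∀ p ∈ shockSurface ζ T, p.1 ∈ Ioo 1 T →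
      |dt (onRays ζ) p - bg.s₀ + (k * dt φ p + θ * pertShock bg ζ p)| ≤
        η * (|dt φ p| + |pertShock bg ζ p|) + c * √(angularSq φ p) + e) :
    ∫ t in (1 : ℝ)..T, t ^ (μ - 1) * φ (t, ζ t y • y) ^ 2 ≤
      L ^ 2 * (pertShock bg ζ (1, ζ 1 y • y) ^ 2 + 4 * e ^ 2 / g) +
      L ^ 2 * (4 * (k + η) ^ 2 / μ ^ 2) *
        (∫ t in (1 : ℝ)..T, t ^ (μ + 1) * dt φ (t, ζ t y • y) ^ 2) +
      L ^ 2 * (4 * c ^ 2) *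
        ∫ t in (1 : ℝ)..T, t ^ (μ + 1) * angularSq φ (t, ζ t y • y) := by
  have hmem (t : ℝ) (ht : t ∈ Icc 1 T) : (t, ζ t y • y) ∈ shockSurface ζ T :=
    smul_mem_shockSurface ht hy (hpos t ht y hy)
  have hξ (t : ℝ) (ht : t ∈ Icc 1 T) :
      pertShock bg ζ (t, ζ t y • y) = (ζ t y - bg.s₀ * t) / t := by
    have : t ≠ 0 := (one_pos.trans_le ht.1).ne'
    rw [pertShock, onRays_smul_of_norm_eq_one ζ t hy (hpos t ht y hy)]
    field_simp
  have hζsurface (p : ℝ × E3) (hp : p ∈ shockSurface ζ T) := hζ p hp.1 hp.2.1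
  have hray {h : ℝ × E3 → ℝ} (hh : ∀ p ∈ shockSurface ζ T, ContinuousAt h p) :
      ContinuousOn (fun t => h (t, ζ t y • y)) (Icc 1 T) :=
    continuousOn_shockRay hy (fun p ht hp => (hζ p ht hp).continuousAt) hpos hh
  have hψ (t : ℝ) (ht : t ∈ Icc 1 T) : HasDerivAt (fun t => ζ t y - bg.s₀ * t)
      (dt (onRays ζ) (t, ζ t y • y) - bg.s₀) t :=
    (hasDerivAt_onRays_time (hpos t ht y hy) hy
      ((hζsurface _ (hmem t ht)).differentiableAt one_ne_zero)).sub (hasDerivAt_const_mul bg.s₀)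
  have hhardy := hardy_of_damped hT hg hμ hk hθ hη hψ
    ((hray fun p hp => continuousAt_dt (hζsurface p hp)).sub continuousOn_const)
    (hray fun p hp => continuousAt_dt (hφ p hp))
    (hray fun p hp => (continuousAt_angularSq (hφ p hp) hp.2.1).sqrt)
    (c := c) (e := e) fun t ht => by
      have hp := Ioo_subset_Icc_self ht
      rw [← hξ t hp]
      exact hfront _ (hmem t hp) ht
  have hle := integral_rpow_mul_sq_le_of_abs_le (ν := μ - 1) hT
    (hray fun p hp => (hφ p hp).continuousAt) (HasDerivAt.continuousOn hψ) fun t ht => by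
      have ht0 := one_pos.trans_le ht.1
      refine (hφξ _ (hmem t ht)).trans_eq ?_
      rw [hξ t ht, abs_div, abs_of_pos ht0, mul_div_cancel₀ _ ht0.ne']
  refine (hle.trans (mul_le_mul_of_nonneg_left hhardy (sq_nonneg L))).trans_eq ?_
  simp only [Real.sq_sqrt (angularSq_nonneg _ _)]
  rw [hξ 1 ⟨le_rfl, hT⟩, div_one]
  ring

theorem Background.hardy_on_shock (bg : Background G b₀) {ζ : ℝ → E3 → ℝ} {φ : ℝ × E3 → ℝ}
    {T μ g k θ η c e L B : ℝ} (hT : 1 ≤ T) (hg : 0 < g) (hμ : μ ≤ -2 - g) (hk : 0 ≤ k)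
    (hθ : 1 / 2 ≤ θ) (hη : η ≤ 1 / 4)
    (hζ : ∀ p : ℝ × E3, p.1 ∈ Icc 1 T → p.2 ≠ 0 → ContDiffAt ℝ 1 (onRays ζ) p)
    (hpos : ∀ t ∈ Icc 1 T, ∀ y : E3, ‖y‖ = 1 → 0 < ζ t y)
    (hφ : ∀ p ∈ shockSurface ζ T, ContDiffAt ℝ 1 φ p)
    (hinit : ∀ p ∈ shockSurface ζ T, p.1 = 1 → |pertShock bg ζ p| ≤ B)
    (hφξ : ∀ p ∈ shockSurface ζ T, |φ p| ≤ L * (p.1 * |pertShock bg ζ p|))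
    (hfront : ∀ p ∈ shockSurface ζ T, p.1 ∈ Ioo 1 T →
      |dt (onRays ζ) p - bg.s₀ + (k * dt φ p + θ * pertShock bg ζ p)| ≤
        η * (|dt φ p| + |pertShock bg ζ p|) + c * √(angularSq φ p) + e) :
    shockIntegral ζ T (fun p => p.1 ^ (μ - 1) * φ p ^ 2) ≤
      (volume : Measure E3).toSphere.real univ * (L ^ 2 * (B ^ 2 + 4 * e ^ 2 / g)) +
      L ^ 2 * (4 * (k + η) ^ 2 / μ ^ 2) *
        shockIntegral ζ T (fun p => p.1 ^ (μ + 1) * dt φ p ^ 2) +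
      L ^ 2 * (4 * c ^ 2) * shockIntegral ζ T (fun p => p.1 ^ (μ + 1) * angularSq φ p) := by
  refine shockIntegral_le_of_ray hT (fun p ht hp => (hζ p ht hp).continuousAt) hpos
    (fun p hp => continuousAt_time_rpow_mul hp _ ((hφ p hp).continuousAt.pow 2))
    (fun p hp => continuousAt_time_rpow_mul hp _ ((continuousAt_dt (hφ p hp)).pow 2))
    (fun p hp => continuousAt_time_rpow_mul hp _ (continuousAt_angularSq (hφ p hp) hp.2.1))
    fun y hy => (bg.hardy_on_ray hT hg hμ hk hθ hη hy hζ hpos hφ hφξ hfront).trans ?_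
  have hstart := hinit _ (smul_mem_shockSurface (⟨le_rfl, hT⟩ : (1 : ℝ) ∈ Icc 1 T) hy
    (hpos 1 ⟨le_rfl, hT⟩ y hy)) rfl
  have hsq : pertShock bg ζ (1, ζ 1 y • y) ^ 2 ≤ B ^ 2 :=
    sq_le_sq' (neg_le_of_abs_le hstart) (le_of_abs_le hstart)
  gcongr

theorem Background.half_le_neg_polarCoeff_mul_shockSlope (bg : Background G b₀) (hb : 0 < b₀)
    (hκ : 1 / 4 ≤ bg.polarCoeff) :
    1 / 2 ≤ -(bg.polarCoeff / bg.u bg.s₀ * (bg.s₀ * bg.shockSlope)) := by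
  have hu := bg.u_pos hb bg.shock_mem
  calc (1 / 2 : ℝ) ≤ bg.polarCoeff / bg.u bg.s₀ * (2 * bg.u bg.s₀) := by
        field_simp
        linarith
    _ ≤ bg.polarCoeff / bg.u bg.s₀ * -(bg.s₀ * bg.shockSlope) :=
        mul_le_mul_of_nonneg_left (bg.two_mul_u_le_neg_shockSlope hb)
          (div_nonneg (by linarith) hu.le)
    _ = -(bg.polarCoeff / bg.u bg.s₀ * (bg.s₀ * bg.shockSlope)) := mul_neg _ _

theorem Background.u_shock_le_b₀ (bg : Background G b₀) (hb : 0 < b₀) : bg.u bg.s₀ ≤ b₀ :=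
  (bg.antitoneOn_u hb bg.wall_mem bg.shock_mem bg.b₀_lt_s₀.le).trans_eq bg.wall

theorem Gas.exists_forall_background (G : Gas) : ∃ bMin : ℝ, 0 < bMin ∧ ∀ b₀, bMin ≤ b₀ →
    ∀ bg : Background G b₀,
      bg.polarCoeff ∈ Icc (1 / 4 : ℝ) (1 / 2) ∧ bg.s₀ ≤ 2 * bg.u bg.s₀ := by
  set q := min (1 / 4) ((G.γ - 1) / 8)
  have hq : 0 < q := lt_min (by norm_num) (div_pos G.γ_sub_one_pos (by norm_num))
  have henthalpy := G.enthalpy_pos G.ρ₀_pos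
  refine ⟨√(2 * G.enthalpy G.ρ₀) / q, by positivity, fun b₀ hb bg => ?_⟩
  have hb₀ : 0 < b₀ := lt_of_lt_of_le (by positivity) hb
  have hratio := bg.densityRatio_le hq hb₀
    ((Real.sqrt_le_left (by positivity)).1 ((div_le_iff₀ hq).1 hb))
  have hratio₄ := hratio.trans (min_le_left _ _)
  refine ⟨bg.polarCoeff_mem hb₀ hratio₄ (hratio.trans (min_le_right _ _)), ?_⟩
  rw [bg.u_shock]
  linarith [mul_le_mul_of_nonneg_left hratio₄ (bg.s₀_pos hb₀).le, bg.s₀_pos hb₀]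


theorem Background.exists_hardy_on_shock (bg : Background G b₀) (hb : 0 < b₀)
    (hκ : bg.polarCoeff ∈ Icc (1 / 4 : ℝ) (1 / 2)) (hsu : bg.s₀ ≤ 2 * bg.u bg.s₀)
    {w g : ℝ} (hw : 0 < w) (hg : 0 < g) : ∃ d : ℝ, 0 < d ∧ ∃ C : ℝ, 0 ≤ C ∧
    ∀ (δ B B₁ : ℝ) (b : ℝ → E3 → ℝ) (f : ℝ × E3 → ℝ) (T : ℝ) (ζ : ℝ → E3 → ℝ) (Φ : ℝ × E3 → ℝ)
      (μ : ℝ), 0 ≤ δ → δ ≤ d → B ≤ d → IsPistonClose b₀ δ b → IsCorrector bg (pistonPath b) f →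
    1 ≤ T → IsShockFront G (pistonPath b) T ζ Φ →
    (∀ p ∈ shockSurface ζ T, p.1 = 1 → |pertShock bg ζ p| ≤ B₁) →
    (∀ p ∈ shockSurface ζ T,
      |pertShock bg ζ p| ≤ B ∧ ‖fderiv ℝ (pertPotential bg f Φ) p‖ ≤ B) →
    μ ≤ -2 - g →
    shockIntegral ζ T (fun p => p.1 ^ (μ - 1) * pertPotential bg f Φ p ^ 2) ≤
      (volume : Measure E3).toSphere.real univ *
        (4 * b₀ ^ 2 * (B₁ ^ 2 + 4 * (120 * δ) ^ 2 / g)) +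
      (1 + w) / μ ^ 2 *
        shockIntegral ζ T (fun p => p.1 ^ (μ + 1) * dt (pertPotential bg f Φ) p ^ 2) +
      C * B ^ 2 *
        shockIntegral ζ T (fun p => p.1 ^ (μ + 1) * angularSq (pertPotential bg f Φ) p) := by
  have hu := bg.u_pos hb bg.shock_mem
  obtain ⟨η, hη, hη₄, hloss⟩ := exists_loss hu hw
  obtain ⟨d₁, hd₁, hpotential⟩ := bg.exists_abs_pertPotential_le hb hη
  obtain ⟨d₂, hd₂, C, hfrontSpeed⟩ := bg.exists_linearized_rankineHugoniot hb hκ hsu hη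
  refine ⟨min (b₀ / 2) (min d₁ d₂), by positivity, 4 * b₀ ^ 2 * (4 * C ^ 2), by positivity,
    fun δ B B₁ b f T ζ Φ μ hδ hδd hBd hpiston hf hT hfront hinit hbound hμ => ?_⟩
  simp only [le_min_iff] at hδd hBd
  have hφ (p : ℝ × E3) (hp : p ∈ shockSurface ζ T) := hpotential δ b f T ζ Φ p hδ hδd.2.1
    hpiston hf hfront hp ((hbound p hp).1.trans hBd.2.1)
  have hk : 0 ≤ bg.polarCoeff / bg.u bg.s₀ := div_nonneg (by linarith [hκ.1]) hu.le
  refine (bg.hardy_on_shock hT hg hμ hk (bg.half_le_neg_polarCoeff_mul_shockSlope hb hκ.1) hη₄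
    hfront.regular_ζ (fun t ht y hy => hfront.pos_of_isPistonClose hpiston (by linarith) ht hy)
    (fun p hp => (hφ p hp).1) hinit (fun p hp => (hφ p hp).2) (c := C * B) (e := 120 * δ)
    fun p hp ht => ?_).trans ?_
  · refine (congrArg abs ?_).trans_le (hfrontSpeed δ B b f T ζ Φ p hδ hδd.2.2 hBd.2.2 hpiston hf
      hfront hp ht (hbound p hp).1 (hbound p hp).2)
    ring
  have hL : ((1 + η) * bg.u bg.s₀) ^ 2 ≤ 4 * b₀ ^ 2 := by
    rw [show 4 * b₀ ^ 2 = (2 * b₀) ^ 2 by ring]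
    have := bg.u_shock_le_b₀ hb
    gcongr
    linarith
  have hmain := hloss _ hk (by rw [div_mul_cancel₀ _ hu.ne']; exact hκ.2)
  have hY := shockIntegral_rpow_mul_nonneg (ζ := ζ) hT (μ + 1)
    (fun p => sq_nonneg (dt (pertPotential bg f Φ) p))
  have hZ := shockIntegral_rpow_mul_nonneg (ζ := ζ) hT (μ + 1)
    (angularSq_nonneg (pertPotential bg f Φ))
  rw [← mul_div_assoc, show 4 * b₀ ^ 2 * (4 * C ^ 2) * B ^ 2 =
    4 * b₀ ^ 2 * (4 * (C * B) ^ 2) by ring]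
  gcongr

end HardyOnShock

theorem lemma5p2_general (G : Gas) {ν : ℝ} (hν : ν < -2) : ∃ bMin : ℝ, 0 < bMin ∧
    ∀ b₀ : ℝ, bMin ≤ b₀ → ∀ N K₀ : ℝ, 0 < N → ∃ C : ℝ, 0 < C ∧
    ∀ (bg : Background G b₀) (M w : ℝ), 0 < M → 0 < w → ∃ ε₀ : ℝ, 0 < ε₀ ∧
    ∀ ε : ℝ, 0 < ε → ε < ε₀ →
    ∀ b : ℝ → E3 → ℝ, IsPistonClose b₀ (N * ε) b →
    ∀ f : ℝ × E3 → ℝ, IsCorrector bg (pistonPath b) f → ∀ T : ℝ, 1 ≤ T →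
    ∀ (ζ : ℝ → E3 → ℝ) (Φ : ℝ × E3 → ℝ), IsShockFront G (pistonPath b) T ζ Φ →
    (∀ p ∈ shockSurface ζ T, p.1 = 1 → |pertShock bg ζ p| ≤ K₀ * ε) →
    (∀ p ∈ shockSurface ζ T,
      |pertShock bg ζ p| ≤ M * ε ∧ ‖fderiv ℝ (pertPotential bg f Φ) p‖ ≤ M * ε) →
    ∀ μ : ℝ, μ ≤ ν →
    shockIntegral ζ T (fun p => p.1 ^ (μ - 1) * pertPotential bg f Φ p ^ 2) ≤
      C * ε ^ 2 +
      (1 + w) / μ ^ 2 *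
        shockIntegral ζ T (fun p => p.1 ^ (μ + 1) * dt (pertPotential bg f Φ) p ^ 2) +
      C * ε *
        shockIntegral ζ T (fun p => p.1 ^ (μ + 1) * angularSq (pertPotential bg f Φ) p) := by
  obtain ⟨bMin, hbMin, hbackground⟩ := G.exists_forall_background
  refine ⟨bMin, hbMin, fun b₀ hb N K₀ hN => ?_⟩
  set V := (volume : Measure E3).toSphere.real univ *
    (4 * b₀ ^ 2 * (K₀ ^ 2 + 4 * (120 * N) ^ 2 / (-2 - ν)))
  have hg : 0 < -2 - ν := by linarith
  have hV : 0 ≤ V := by positivity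
  refine ⟨V + 1, by positivity, fun bg M w hM hw => ?_⟩
  obtain ⟨hκ, hsu⟩ := hbackground b₀ hb bg
  obtain ⟨d, hd, C, hC, hhardy⟩ :=
    bg.exists_hardy_on_shock (hbMin.trans_le hb) hκ hsu hw hg
  refine ⟨min (d / N) (min (d / M) (1 / (C * M ^ 2 + 1))), by positivity,
    fun ε hε hlt b hpiston f hf T hT ζ Φ hfront hinit hbound μ hμ => ?_⟩
  rw [lt_min_iff, lt_min_iff, lt_div_iff₀' hN, lt_div_iff₀' hM, lt_div_iff₀' (by positivity)] at hlt
  refine (hhardy (N * ε) (M * ε) (K₀ * ε) b f T ζ Φ μ (by positivity) hlt.1.le hlt.2.1.le hpiston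
    hf hT hfront hinit hbound (by linarith)).trans ?_
  have hZ := shockIntegral_rpow_mul_nonneg (ζ := ζ) hT (μ + 1)
    (angularSq_nonneg (pertPotential bg f Φ))
  have hquadratic : C * (M * ε) ^ 2 ≤ (V + 1) * ε := by
    nlinarith [mul_nonneg hV hε.le]
  have hconst : (volume : Measure E3).toSphere.real univ *
      (4 * b₀ ^ 2 * ((K₀ * ε) ^ 2 + 4 * (120 * (N * ε)) ^ 2 / (-2 - ν))) ≤ (V + 1) * ε ^ 2 := by
    rw [add_mul, one_mul]
    exact le_add_of_le_of_nonneg (by simp only [V]; exact le_of_eq (by ring)) (sq_nonneg ε)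
  gcongr

theorem IsShockFront.shockSurface_subset_shockDomain {G : Gas} {σ ζ : ℝ → E3 → ℝ} {T : ℝ}
    {Φ : ℝ × E3 → ℝ} (hfront : IsShockFront G σ T ζ Φ) :
    shockSurface ζ T ⊆ shockDomain σ ζ T :=
  fun _ hp => ⟨hp.1, hp.2.1, hfront.onRays_le_norm hp, hp.2.2.le⟩

theorem le_and_norm_fderiv_le_of_sum_le {f g : ℝ × E3 → ℝ} {p : ℝ × E3} {x B : ℝ}
    (hp : 0 ≤ p.1) (hx : 0 ≤ x)
    (h : x + ∑ l ∈ Finset.range 2, p.1 ^ l *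
      (‖iteratedFDeriv ℝ (l + 1) f p‖ + ‖iteratedFDeriv ℝ (l + 1) g p‖) ≤ B) :
    x ≤ B ∧ ‖fderiv ℝ f p‖ ≤ B := by
  have hterm (l : ℕ) : 0 ≤ p.1 ^ l *
      (‖iteratedFDeriv ℝ (l + 1) f p‖ + ‖iteratedFDeriv ℝ (l + 1) g p‖) := by positivity
  refine ⟨(le_add_of_nonneg_right (Finset.sum_nonneg fun l _ => hterm l)).trans h, ?_⟩
  have hfirst := Finset.single_le_sum (fun l _ => hterm l) (Finset.mem_range.2 zero_lt_two)
  rw [pow_zero, one_mul, zero_add, norm_iteratedFDeriv_one, norm_iteratedFDeriv_one] at hfirst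
  linarith [norm_nonneg (fderiv ℝ g p)]

theorem lemma5p2 (G : Gas) :
    ∃ bMin : ℝ, 0 < bMin ∧ ∃ CO : ℝ, 0 < CO ∧
    ∀ b₀ : ℝ, bMin ≤ b₀ →
    ∀ (K : ℕ → (Fin 3 → ℕ) → ℝ) (K₀ : ℝ), ∃ C : ℝ, 0 < C ∧
    ∀ (bg : Background G b₀) (M : ℝ), 0 < M → ∃ ε₀ : ℝ, 0 < ε₀ ∧
    ∀ ε : ℝ, 0 < ε → ε < ε₀ →
    ∀ b : ℝ → E3 → ℝ, IsPistonSpeed b₀ ε K b →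
    ∀ f : ℝ × E3 → ℝ, IsCorrector bg (pistonPath b) f →
    ∀ T : ℝ, 1 < T →
    ∀ (ζ : ℝ → E3 → ℝ) (Φ : ℝ × E3 → ℝ), IsShockSolution G (pistonPath b) T ζ Φ →
    (∀ p ∈ shockDomain (pistonPath b) ζ T, p.1 = 1 →
      |pertPotential bg f Φ p| + |pertShock bg ζ p| ≤ K₀ * ε) →
    (∀ p ∈ shockDomain (pistonPath b) ζ T,
      |pertShock bg ζ p| + ∑ l ∈ Finset.range 2, p.1 ^ l *
        (‖iteratedFDeriv ℝ (l + 1) (pertPotential bg f Φ) p‖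
          + ‖iteratedFDeriv ℝ (l + 1) (pertShock bg ζ) p‖) ≤ M * ε) →
    ∀ μ : ℝ, μ < -1 - 1 / 2 * Real.sqrt ((G.γ + 7) / 2) →
    shockIntegral ζ T (fun p => p.1 ^ (μ - 1) * pertPotential bg f Φ p ^ 2)
      ≤ C * ε ^ 2
        + 1 / μ ^ 2 * (1 + CO * (b₀ ^ (-2 / (G.γ - 1)) + b₀ ^ (-2 : ℝ)))
          * shockIntegral ζ T (fun p => p.1 ^ (μ + 1) * dt (pertPotential bg f Φ) p ^ 2)
        + C * ε *
          (shockIntegral ζ T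
              (fun p => p.1 ^ (μ + 1) * bg.shockOp (pertPotential bg f Φ) p ^ 2)
            + shockIntegral ζ T
              (fun p => p.1 ^ (μ + 1) *
                (1 / ‖p.2‖ ^ 2 * ∑ k, dZ k (pertPotential bg f Φ) p ^ 2))) := by
  have hν : -1 - 1 / 2 * √((G.γ + 7) / 2) < -2 := by
    have := Real.lt_sqrt_of_sq_lt (x := 2) (y := (G.γ + 7) / 2) (by linarith [G.one_lt_γ])
    linarith
  obtain ⟨bMin, hbMin, hgeneral⟩ := lemma5p2_general G hν
  refine ⟨bMin, hbMin, 1, one_pos, fun b₀ hb K K₀ => ?_⟩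
  have hb₀ : 0 < b₀ := hbMin.trans_le hb
  obtain ⟨N, hN, hpiston⟩ := exists_isPistonClose b₀ K
  obtain ⟨C, hC, hhardy⟩ := hgeneral b₀ hb N K₀ hN
  refine ⟨C, hC, fun bg M hM => ?_⟩
  obtain ⟨ε₀, hε₀, hestimate⟩ :=
    hhardy bg M (b₀ ^ (-2 / (G.γ - 1)) + b₀ ^ (-2 : ℝ)) hM (by positivity)
  refine ⟨ε₀, hε₀, fun ε hε hlt b hb f hf T hT ζ Φ hsol hinit hbound μ hμ => ?_⟩
  have hdomain := hsol.isShockFront.shockSurface_subset_shockDomain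
  have hshock := hestimate ε hε hlt b (hpiston ε hε b hb) f hf T hT.le ζ Φ hsol.isShockFront
    (fun p hp ht => (le_add_of_nonneg_left (abs_nonneg _)).trans (hinit p (hdomain hp) ht))
    (fun p hp => le_and_norm_fderiv_le_of_sum_le (zero_le_one.trans hp.1.1)
      (abs_nonneg _) (hbound p (hdomain hp))) μ hμ.le
  have hshockOp := shockIntegral_rpow_mul_nonneg (ζ := ζ) hT.le (μ + 1)
    (fun p => sq_nonneg (bg.shockOp (pertPotential bg f Φ) p))
  rw [one_mul, one_div_mul_eq_div]
  exact hshock.trans (add_le_add_right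
    (mul_le_mul_of_nonneg_left (le_add_of_nonneg_left hshockOp) (by positivity)) _)
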